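/- Let $F$ be a nonarchimedean local field with ring of integers $\mathcal O$ and uniformizer $\pi$, let $G=\mathrm{PGL}_3(F)$ and $K=\mathrm{PGL}_3(\mathcal O)$, and let $\mu$ be the Haar measure on $G$ with $\mu(K)=1$. Let $\mathcal B$ be the Bruhat–Tits building of $G$: its vertices are the cosets $gK$ (equivalently the homothety classes of lattices $g\mathcal O^3$), and vertices $g_0K,\dots,g_iK$ form an $i$-cell if, possibly after reordering, they have representatives $g_j'\in\mathrm{GL}_3(F)$ with $\pi g_0'\mathcal O^3\subsetneq g_i'\mathcal O^3\subsetneq\dots\subsetneq g_0'\mathcal O^3$. Put $$\sigma=\begin{pmatrix}0&1&0\\0&0&1\\ \pi&0&0\end{pmatrix},\qquad v_0=K,\quad e_0=[v_0,\sigma v_0],\quad t_0=[v_0,\sigma v_0,\sigma^2v_0],$$ $$K_0=K,\qquad K_1=E=\mathrm{Stab}_G(e_0)=K\cap\sigma K\sigma^{-1},\qquad K_2=T=\mathrm{Stab}_G(t_0),$$ where $E$ is the stabilizer of the oriented edge and $T$ that of the triangle as a cell, and let $I=K\cap\sigma K\sigma^{-1}\cap\sigma^2K\sigma^{-2}$ be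 the Iwahori subgroup. Let $\mathcal H=C_c(I\backslash G/I)$ be the Iwahori–Hecke algebra of compactly supported bi-$I$-invariant complex functions on $G$; $\eta\in\mathcal H$ acts on a representation $(\rho,V)$ of $G$ by $\eta v=\int_G\eta(g)\rho(g)v\,d\mu(g)$. Let $\Gamma\le G$ be a torsion-free cocompact lattice, and let $L^2(\Gamma\backslash G)$ be taken with respect to the measure induced by $\mu$, with the right regular representation $(\rho(x)f)(\Gamma g)=f(\Gamma gx)$. Let $X=\Gamma\backslash\mathcal B$, whose (ordered) cells are the $\Gamma$-orbits of (ordered) cells of $\mathcal B$, and let $\Omega^i(X)$ be the space of $i$-forms, i.e. skew-symmetric complex functions on the ordered $i$-cells of $X$, with the boundary and coboundary maps $$\partial_i:\Omega^i(X)\to\Omega^{i-1}(X),\quad(\partial_if)(x)=\sum_{y}f(y),\qquad \delta_i:\Omega^{i-1}(X)\to\Omega^i(X),\quad(\delta_if)(y)=\sum_{j=0}^i(-1)^jf(y\setminus y_j),$$ where the first sum is over the ordered $i$-cells $y$ of $X$ (written $y=vx$) from which $x$ arises by deleting the first vertex. Then $X$ has finitely many cells, and for $i=0,1,2$ there is a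 linear bijection $\Omega^i(X)\cong L^2(\Gamma\backslash G)^{K_i}$ under which $f\in\Omega^i(X)$ corresponds to the function on $\Gamma\backslash G$, again denoted $f$, with $$f(gc_i)=\sqrt{\mu(K_i)}\,f(\Gamma g)\qquad(c_0=v_0,\ c_1=e_0,\ c_2=t_0).$$ Moreover the functions $$\partial_1=\tfrac1{\sqrt{\mu(E)}}\left(\mathbf 1_{K\sigma^2}-\mathbf 1_K\right),\quad \delta_1=\tfrac1{\sqrt{\mu(E)}}\left(\mathbf 1_{\sigma K}-\mathbf 1_K\right),\quad \partial_2=\tfrac1{\sqrt{\mu(E)\mu(T)}}\mathbf 1_{ET},\quad \delta_2=\tfrac1{\sqrt{\mu(E)\mu(T)}}\mathbf 1_{TE}$$ belong to $\mathcal H$, and for $i=1,2$ the element $\partial_i$ maps $L^2(\Gamma\backslash G)^{K_i}$ into $L^2(\Gamma\backslash G)^{K_{i-1}}$ and acts there as the boundary map $\partial_i:\Omega^i(X)\to\Omega^{i-1}(X)$ under these identifications, while $\delta_i$ maps $L^2(\Gamma\backslash G)^{K_{i-1}}$ into $L^2(\Gamma\backslash G)^{K_i}$ and acts there as the coboundary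 map $\delta_i:\Omega^{i-1}(X)\to\Omega^i(X)$. -/

import Mathlib

open MeasureTheory ValuativeRel
open scoped MatrixGroups Pointwise NNReal

namespace PGL3
section
variable (F : Type*) [Field F] [ValuativeRel F] [TopologicalSpace F] [IsNonarchimedeanLocalField F]

instance : TopologicalSpace PGL(3, F) :=
  inferInstanceAs (TopologicalSpace (GL (Fin 3) F ⧸ Subgroup.center (GL (Fin 3) F)))

instance : IsTopologicalGroup PGL(3, F) :=
  inferInstanceAs (IsTopologicalGroup (GL (Fin 3) F ⧸ Subgroup.center (GL (Fin 3) F)))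

instance : MeasurableSpace PGL(3, F) := borel _

instance : BorelSpace PGL(3, F) := ⟨rfl⟩

theorem field_topology : SecondCountableTopology F ∧ T2Space F := by
  let := IsTopologicalAddGroup.rightUniformSpace F
  have := isUniformAddGroup_of_addCommGroup (G := F)
  let : (Valued.v (R := F)).RankOne :=
  { hom' := IsRankLeOne.nonempty.some.emb (R := F).comp MonoidWithZeroHom.ValueGroup₀.embedding
    strictMono' := IsRankLeOne.nonempty.some.strictMono.comp
        MonoidWithZeroHom.ValueGroup₀.embedding_strictMono }
  open scoped Valued in
  have : ProperSpace F := .of_nontriviallyNormedField_of_weaklyLocallyCompactSpace F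
  open scoped Valued in
  exact ⟨secondCountable_of_proper, inferInstance⟩

theorem matrix_topology : SecondCountableTopology (Matrix (Fin 3) (Fin 3) F) ∧
    T2Space (Matrix (Fin 3) (Fin 3) F) ∧ LocallyCompactSpace (Matrix (Fin 3) (Fin 3) F) := by
  have := (field_topology F).1
  have := (field_topology F).2
  exact ⟨inferInstanceAs (SecondCountableTopology (Fin 3 → Fin 3 → F)),
    inferInstanceAs (T2Space (Fin 3 → Fin 3 → F)),
    inferInstanceAs (LocallyCompactSpace (Fin 3 → Fin 3 → F))⟩

instance : LocallyCompactSpace PGL(3, F) := by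
  obtain ⟨_, _, _⟩ := matrix_topology F
  exact inferInstanceAs (LocallyCompactSpace (GL (Fin 3) F ⧸ Subgroup.center (GL (Fin 3) F)))

instance : SecondCountableTopology PGL(3, F) := by
  obtain ⟨_, _, _⟩ := matrix_topology F
  have : SecondCountableTopology (Matrix (Fin 3) (Fin 3) F)ᵐᵒᵖ :=
    MulOpposite.opHomeomorph.symm.isInducing.secondCountableTopology
  have : SecondCountableTopology (GL (Fin 3) F) :=
    (Units.isInducing_embedProduct (M := Matrix (Fin 3) (Fin 3) F)).secondCountableTopology
  exact inferInstanceAs (SecondCountableTopology (GL (Fin 3) F ⧸ Subgroup.center (GL (Fin 3) F)))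

instance : T2Space PGL(3, F) := by
  obtain ⟨_, _, _⟩ := matrix_topology F
  have : IsClosed (Subgroup.center (GL (Fin 3) F) : Set (GL (Fin 3) F)) := by
    have h : (Subgroup.center (GL (Fin 3) F) : Set (GL (Fin 3) F))
        = Set.centralizer Set.univ := by
      rw [Set.centralizer_univ]; rfl
    rw [h]
    exact Set.isClosed_centralizer _
  exact inferInstanceAs (T2Space (GL (Fin 3) F ⧸ Subgroup.center (GL (Fin 3) F)))

theorem exists_ne_zero_ne_one : ∃ u : F, u ≠ 0 ∧ u ≠ 1 := by
  obtain ⟨x, h0, h1⟩ := Valuation.IsNontrivial.exists_lt_one (v := valuation F)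
  refine ⟨x, fun h => h0 (by simp [h]), fun h => ?_⟩
  simp [h] at h1

/-- Every homomorphism from `PGL₃(F)` to the positive reals is trivial. -/
theorem hom_eq_one {F : Type*} [Field F] (hF : ∃ u : F, u ≠ 0 ∧ u ≠ 1)
    (χ : PGL(3, F) →* ℝ≥0) (g : PGL(3, F)) : χ g = 1 := by
  obtain ⟨u, hu0, hu1⟩ := hF
  have hne : ∀ x, χ x ≠ 0 := fun x h => by
    have := map_mul χ x x⁻¹
    simp [h] at this
  let ψ : GL (Fin 3) F →* ℝ≥0 := χ.comp Matrix.ProjGenLinGroup.mk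
  have hψ : ∀ x, ψ x ≠ 0 := fun x => hne _
  suffices H : ∀ M : Matrix (Fin 3) (Fin 3) F, M.det ≠ 0 →
      ∀ x : GL (Fin 3) F, (x : Matrix (Fin 3) (Fin 3) F) = M → ψ x = 1 by
    obtain ⟨x, rfl⟩ := Matrix.ProjGenLinGroup.mk_surjective g
    exact H x x.det_ne_zero x rfl
  intro M hM
  refine Matrix.diagonal_transvection_induction_of_det_ne_zero
    (fun M => ∀ x : GL (Fin 3) F, (x : Matrix (Fin 3) (Fin 3) F) = M → ψ x = 1) M hM ?_ ?_ ?_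
  · intro D hD x hx
    let P : Matrix (Fin 3) (Fin 3) F := !![0, 1, 0; 0, 0, 1; 1, 0, 0]
    have hP : P.det ≠ 0 := by simp [P, Matrix.det_fin_three]
    let p : GL (Fin 3) F := Matrix.GeneralLinearGroup.mkOfDetNeZero P hP
    have hpr : D 0 * D 1 * D 2 ≠ 0 := by
      simpa [Matrix.det_diagonal, Fin.prod_univ_three] using hD
    have key : x * p * x * p * x * p = .scalar (Fin 3) (Units.mk0 _ hpr) := by
      ext i j
      simp only [Units.val_mul, hx]
      have : (p : Matrix (Fin 3) (Fin 3) F) = P := rfl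
      rw [this]
      fin_cases i <;> fin_cases j <;>
        simp [P, Matrix.mul_apply, Fin.sum_univ_three, Matrix.diagonal] <;> ring
    have keyp : p * p * p = 1 := by
      ext i j
      simp only [Units.val_mul]
      have : (p : Matrix (Fin 3) (Fin 3) F) = P := rfl
      rw [this]
      fin_cases i <;> fin_cases j <;>
        simp [P, Matrix.mul_apply, Fin.sum_univ_three]
    have e1 : ψ (.scalar (Fin 3) (Units.mk0 _ hpr)) = 1 := by
      simp [ψ]
    rw [← key] at e1
    have e2 := congrArg ψ keyp
    simp only [map_mul, map_one] at e1 e2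
    have e3 : (ψ x) ^ 3 = 1 := by
      calc (ψ x) ^ 3 = (ψ x) ^ 3 * (ψ p * ψ p * ψ p) := by rw [e2, mul_one]
        _ = ψ x * ψ p * ψ x * ψ p * ψ x * ψ p := by ring
        _ = 1 := e1
    exact (pow_eq_one_iff_of_nonneg zero_le (by norm_num)).1 e3
  · intro t x hx
    have hu : u - 1 ≠ 0 := sub_ne_zero.2 hu1
    let s : Matrix.TransvectionStruct (Fin 3) F := ⟨t.i, t.j, t.hij, (u - 1)⁻¹ * t.c⟩
    let D : Matrix (Fin 3) (Fin 3) F := Matrix.diagonal (fun k => if k = t.i then u else 1)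
    have hD : D.det ≠ 0 := by
      simp only [D, Matrix.det_diagonal]
      exact Finset.prod_ne_zero_iff.2 fun k _ => by split_ifs <;> simp [hu0]
    let d : GL (Fin 3) F := Matrix.GeneralLinearGroup.mkOfDetNeZero D hD
    let y : GL (Fin 3) F := Matrix.GeneralLinearGroup.mkOfDetNeZero s.toMatrix (by simp)
    have key : d * y = x * y * d := by
      ext1
      simp only [Units.val_mul, hx]
      have h1 : (d : Matrix (Fin 3) (Fin 3) F) = D := rfl
      have h2 : (y : Matrix (Fin 3) (Fin 3) F) = s.toMatrix := rfl
      rw [h1, h2]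
      have hc : t.toMatrix * s.toMatrix = Matrix.transvection t.i t.j (t.c + (u - 1)⁻¹ * t.c) := by
        simp only [Matrix.TransvectionStruct.toMatrix, s]
        exact Matrix.transvection_mul_transvection_same _ _ t.hij _ _
      rw [hc]
      have hij := t.hij
      have hc2 : u * ((u - 1)⁻¹ * t.c) = t.c + (u - 1)⁻¹ * t.c := by
        field_simp; ring
      ext a b
      simp only [Matrix.TransvectionStruct.toMatrix, s, D, Matrix.transvection,
        Matrix.diagonal_mul, Matrix.mul_diagonal, Matrix.add_apply, Matrix.one_apply,
        Matrix.single_apply]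
      rw [← hc2]
      grind
    have e := congrArg ψ key
    simp only [map_mul] at e
    have : ψ d * ψ y * 1 = ψ d * ψ y * ψ x := by
      rw [mul_one]
      calc ψ d * ψ y = ψ x * ψ y * ψ d := e
        _ = ψ d * ψ y * ψ x := by ring
    exact (mul_left_cancel₀ (mul_ne_zero (hψ d) (hψ y)) this).symm
  · intro A B hA hB ihA ihB x hx
    let a : GL (Fin 3) F := Matrix.GeneralLinearGroup.mkOfDetNeZero A hA
    let b : GL (Fin 3) F := Matrix.GeneralLinearGroup.mkOfDetNeZero B hB
    have : x = a * b := by ext1; exact hx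
    rw [this, map_mul, ihA a rfl, ihB b rfl, mul_one]

instance (μ : Measure PGL(3, F)) [μ.IsHaarMeasure] : μ.IsMulRightInvariant := by
  refine ⟨fun g => ?_⟩
  rw [Measure.map_right_mul_eq_modularCharacterFun_smul μ g]
  have h : Measure.modularCharacterFun g = 1 :=
    hom_eq_one (exists_ne_zero_ne_one F) Measure.modularCharacter g
  rw [h, one_smul]

/-- The maximal compact subgroup `K = PGL₃(𝒪)` of `PGL₃(F)`. -/
noncomputable def K : Subgroup PGL(3, F) :=
  (Matrix.ProjGenLinGroup.map (n := Fin 3) (algebraMap 𝒪[F] F)).range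

theorem isCompact_K : IsCompact (K F : Set PGL(3, F)) := by
  have := (field_topology F).2
  have h1 : Continuous (Matrix.GeneralLinearGroup.map (n := Fin 3) (algebraMap 𝒪[F] F)) := by
    refine Continuous.units_map _ ?_
    exact continuous_id.matrix_map continuous_subtype_val
  have h2 : Continuous (Matrix.ProjGenLinGroup.mk : GL (Fin 3) F → PGL(3, F)) :=
    continuous_quot_mk
  have : CompactSpace (Matrix (Fin 3) (Fin 3) 𝒪[F]) :=
    inferInstanceAs (CompactSpace (Fin 3 → Fin 3 → 𝒪[F]))
  have : T1Space (Matrix (Fin 3) (Fin 3) 𝒪[F]) :=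
    inferInstanceAs (T1Space (Fin 3 → Fin 3 → 𝒪[F]))
  have h := isCompact_range (h2.comp h1)
  convert! h using 1
  ext x
  constructor
  · rintro ⟨y, rfl⟩
    obtain ⟨y, rfl⟩ := Matrix.ProjGenLinGroup.mk_surjective y
    exact ⟨y, rfl⟩
  · rintro ⟨y, rfl⟩
    exact ⟨Matrix.ProjGenLinGroup.mk y, rfl⟩

theorem isOpen_integers : IsOpen (𝒪[F] : Set F) := by
  let := IsTopologicalAddGroup.rightUniformSpace F
  have := isUniformAddGroup_of_addCommGroup (G := F)
  exact Valued.isOpen_integer F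

theorem isOpen_K : IsOpen (K F : Set PGL(3, F)) := by
  have h2 : IsOpenMap (Matrix.ProjGenLinGroup.mk : GL (Fin 3) F → PGL(3, F)) :=
    QuotientGroup.isOpenMap_coe
  let U : Set (GL (Fin 3) F) := {x | ∀ i j, x.1 i j ∈ 𝒪[F] ∧ (x⁻¹).1 i j ∈ 𝒪[F]}
  have hU : IsOpen U := by
    simp only [U, Set.ofPred_forall]
    refine isOpen_iInter_of_finite fun i => isOpen_iInter_of_finite fun j => ?_
    refine IsOpen.inter ?_ ?_
    · exact (isOpen_integers F).preimage (Units.continuous_val.matrix_elem i j)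
    · exact (isOpen_integers F).preimage
        ((Units.continuous_val.comp continuous_inv).matrix_elem i j)
  have h := h2 U hU
  convert! h using 1
  ext x
  constructor
  · rintro ⟨y, rfl⟩
    obtain ⟨y, rfl⟩ := Matrix.ProjGenLinGroup.mk_surjective y
    refine ⟨Matrix.GeneralLinearGroup.map (algebraMap 𝒪[F] F) y, ?_, rfl⟩
    intro i j
    rw [← map_inv]
    exact ⟨(y.1 i j).2, ((y⁻¹).1 i j).2⟩
  · rintro ⟨y, hy, rfl⟩
    let A : Matrix (Fin 3) (Fin 3) 𝒪[F] := fun i j => ⟨y.1 i j, (hy i j).1⟩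
    let B : Matrix (Fin 3) (Fin 3) 𝒪[F] := fun i j => ⟨(y⁻¹).1 i j, (hy i j).2⟩
    have hinj : Function.Injective (fun M : Matrix (Fin 3) (Fin 3) 𝒪[F] =>
        M.map (algebraMap 𝒪[F] F)) := Matrix.map_injective Subtype.val_injective
    have hA : A.map (algebraMap 𝒪[F] F) = y.1 := rfl
    have hB : B.map (algebraMap 𝒪[F] F) = (y⁻¹).1 := rfl
    let z : GL (Fin 3) 𝒪[F] := ⟨A, B,
      hinj (by simp only [Matrix.map_mul, hA, hB]; simp),
      hinj (by simp only [Matrix.map_mul, hA, hB]; simp)⟩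
    refine ⟨Matrix.ProjGenLinGroup.mk z, ?_⟩
    rw [Matrix.ProjGenLinGroup.map_mk]
    congr 1

end

section
variable {F : Type*} [Field F] [ValuativeRel F] [TopologicalSpace F] [IsNonarchimedeanLocalField F]

/-- The space `Γ\G` for a subgroup `Γ` of `G = PGL₃(F)`. -/
abbrev Coset (Γ : Subgroup PGL(3, F)) : Type _ := Quotient (MulAction.orbitRel Γ PGL(3, F))

/-- `Γ` is a torsion-free cocompact lattice in `PGL₃(F)`. -/
class IsTorsionFreeCocompactLattice (Γ : Subgroup PGL(3, F)) : Prop where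
  discrete : DiscreteTopology Γ
  cocompact : CompactSpace (Coset Γ)
  torsionFree : ∀ γ ∈ Γ, IsOfFinOrder γ → γ = 1

/-- The set `D = ∐ gᵢK`, where the `gᵢK` represent the orbits of `Γ` on `G/K`. -/
def fundDomain (Γ : Subgroup PGL(3, F)) : Set PGL(3, F) :=
  {g | (g : PGL(3, F) ⧸ K F) ∈
    Set.range (Quotient.out : Quotient (MulAction.orbitRel Γ (PGL(3, F) ⧸ K F)) → _)}

/-- The measure on `Γ\G` induced by a measure `μ` on `G`: the image of the restriction of `μ` to
the fundamental domain `D` of `Γ`. -/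
noncomputable def quotientMeasure (Γ : Subgroup PGL(3, F)) (μ : Measure PGL(3, F)) :
    Measure (Coset Γ) :=
  (μ.restrict (fundDomain Γ)).map (Quotient.mk _)

theorem eq_one_of_mem_conj (Γ : Subgroup PGL(3, F)) [h : IsTorsionFreeCocompactLattice Γ]
    {γ g : PGL(3, F)} (hγ : γ ∈ Γ) (hK : g⁻¹ * γ * g ∈ K F) : γ = 1 := by
  have := h.discrete
  refine h.torsionFree γ hγ ?_
  have hc : IsClosed (Γ : Set PGL(3, F)) := Subgroup.isClosed_of_discrete
  have hk : IsCompact ((fun x => g * x * g⁻¹) '' (K F : Set PGL(3, F))) :=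
    (isCompact_K F).image (by fun_prop)
  have hfin : ((Γ : Set PGL(3, F)) ∩ ((fun x => g * x * g⁻¹) '' (K F : Set PGL(3, F)))).Finite := by
    refine (hk.inter_left hc).finite ?_
    exact (isDiscrete_iff_discreteTopology.2 h.discrete).mono Set.inter_subset_left
  rw [isOfFinOrder_iff_pow_eq_one]
  have hmem : ∀ n : ℕ, γ ^ n ∈
      (Γ : Set PGL(3, F)) ∩ ((fun x => g * x * g⁻¹) '' (K F : Set PGL(3, F))) := fun n =>
    ⟨Γ.pow_mem hγ n, (g⁻¹ * γ * g) ^ n, (K F).pow_mem hK n, by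
      have : (g⁻¹ * γ * g) ^ n = g⁻¹ * γ ^ n * g := by
        simpa using conj_pow (a := g⁻¹) (b := γ) (i := n)
      simp only [this]; group⟩
  obtain ⟨m, -, n, -, hmn, hpow⟩ := Set.infinite_univ.exists_lt_map_eq_of_mapsTo
    (fun n _ => hmem n) hfin
  refine ⟨n - m, by omega, ?_⟩
  have := pow_sub_mul_pow γ hmn.le
  rw [← hpow] at this
  exact mul_eq_right.1 this

theorem isFundamentalDomain (Γ : Subgroup PGL(3, F)) [IsTorsionFreeCocompactLattice Γ]
    (μ : Measure PGL(3, F)) : IsFundamentalDomain Γ (fundDomain Γ) μ := by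
  refine .mk' ?_ ?_
  · have hd : DiscreteTopology (PGL(3, F) ⧸ K F) := QuotientGroup.discreteTopology (isOpen_K F)
    have ho : IsOpen (fundDomain Γ) :=
      (isOpen_discrete (α := PGL(3, F) ⧸ K F) _).preimage QuotientGroup.continuous_mk
    exact ho.measurableSet.nullMeasurableSet
  · intro x
    let q : Quotient (MulAction.orbitRel Γ (PGL(3, F) ⧸ K F)) :=
      Quotient.mk _ (x : PGL(3, F) ⧸ K F)
    have hq : (MulAction.orbitRel Γ (PGL(3, F) ⧸ K F)) q.out (x : PGL(3, F) ⧸ K F) :=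
      Quotient.mk_out (s := MulAction.orbitRel Γ (PGL(3, F) ⧸ K F)) _
    obtain ⟨γ, hγ⟩ := hq
    refine ⟨γ, ⟨q, hγ.symm⟩, ?_⟩
    rintro δ ⟨r, hr⟩
    have hr' : r = q := by
      rw [← Quotient.out_eq r, hr]
      exact Quotient.sound ⟨δ, rfl⟩
    subst hr'
    have h1 : ((δ : PGL(3, F)) * x : PGL(3, F) ⧸ K F) = ((γ : PGL(3, F)) * x : PGL(3, F)) :=
      hr.symm.trans hγ.symm
    have h2 := QuotientGroup.eq.1 h1
    have h3 : (δ : PGL(3, F))⁻¹ * γ = 1 := by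
      refine eq_one_of_mem_conj Γ (g := x) (Γ.mul_mem (Γ.inv_mem δ.2) γ.2) ?_
      convert h2 using 1
      group
    exact Subtype.ext (inv_mul_eq_one.1 h3)

/-- Right translation `Γg ↦ Γgx` on `Γ\G`. -/
def rightMul (Γ : Subgroup PGL(3, F)) (x : PGL(3, F)) : Coset Γ → Coset Γ :=
  Quotient.map (fun g => g * x) (by
    rintro _ b ⟨γ, rfl⟩
    exact ⟨γ, (mul_assoc (γ : PGL(3, F)) b x).symm⟩)

theorem measurePreserving_rightMul (Γ : Subgroup PGL(3, F)) [h : IsTorsionFreeCocompactLattice Γ]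
    (μ : Measure PGL(3, F)) [μ.IsHaarMeasure] (x : PGL(3, F)) :
    MeasurePreserving (rightMul Γ x) (quotientMeasure Γ μ) (quotientMeasure Γ μ) := by
  have := h.discrete
  have : Countable Γ := countable_of_Lindelof_of_discrete
  have hq : Measurable (Quotient.mk (MulAction.orbitRel Γ PGL(3, F))) := measurable_quotient_mk''
  have hm : Measurable (rightMul Γ x) :=
    measurable_from_quotient.2 (hq.comp (measurable_mul_const x))
  refine ⟨hm, ?_⟩
  have hD := isFundamentalDomain Γ μ
  have hDx := hD.smul_of_comm (MulOpposite.op x)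
  have hmp : MeasurePreserving (fun g => g * x) (μ.restrict (fundDomain Γ))
      (μ.restrict (MulOpposite.op x • fundDomain Γ)) := by
    have h0 : MeasurePreserving (fun g => g * x) μ μ := measurePreserving_mul_right μ x
    have h1 : (fun g => g * x) ⁻¹' (MulOpposite.op x • fundDomain Γ) = fundDomain Γ := by
      ext g
      simp only [Set.mem_preimage]
      exact Set.smul_mem_smul_set_iff (a := MulOpposite.op x)
    have h2 := h0.restrict_preimage_emb (measurableEmbedding_mulRight x)
      (MulOpposite.op x • fundDomain Γ)
    rwa [h1] at h2
  unfold quotientMeasure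
  rw [Measure.map_map hm hq]
  have : rightMul Γ x ∘ Quotient.mk (MulAction.orbitRel Γ PGL(3, F))
      = Quotient.mk (MulAction.orbitRel Γ PGL(3, F)) ∘ fun g => g * x := rfl
  rw [this, ← Measure.map_map hq hmp.measurable, hmp.map_eq]
  exact (IsFundamentalDomain.quotientMeasure_eq μ hD hDx).symm

/-- The Hilbert space `L²(Γ\G)`. -/
abbrev L2 (Γ : Subgroup PGL(3, F)) (μ : Measure PGL(3, F)) : Type _ :=
  Lp ℂ 2 (quotientMeasure Γ μ)

/-- The right regular representation of `G` on `L²(Γ\G)`, `(ρ(x)f)(Γg) = f(Γgx)`. -/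
noncomputable def regularRep (Γ : Subgroup PGL(3, F)) [IsTorsionFreeCocompactLattice Γ]
    (μ : Measure PGL(3, F)) [μ.IsHaarMeasure] : Representation ℂ PGL(3, F) (L2 Γ μ) where
  toFun x := Lp.compMeasurePreservingₗ ℂ (rightMul Γ x) (measurePreserving_rightMul Γ μ x)
  map_one' := by
    have h : rightMul Γ 1 = id := by
      funext q
      induction q using Quotient.inductionOn with
      | h g => simp [rightMul]
    ext1 f
    have h' : Lp.compMeasurePreserving (rightMul Γ 1) (measurePreserving_rightMul Γ μ 1) f
        = Lp.compMeasurePreserving id (.id _) f := by congr 1; simp only [h]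
    exact h'.trans (Lp.compMeasurePreserving_id_apply f)
  map_mul' x y := by
    have h : rightMul Γ (x * y) = rightMul Γ y ∘ rightMul Γ x := by
      funext q
      induction q using Quotient.inductionOn with
      | h g => simp [rightMul, mul_assoc]
    ext1 f
    have h' : Lp.compMeasurePreserving (rightMul Γ (x * y))
          (measurePreserving_rightMul Γ μ (x * y)) f
        = Lp.compMeasurePreserving (rightMul Γ y ∘ rightMul Γ x)
          ((measurePreserving_rightMul Γ μ y).comp (measurePreserving_rightMul Γ μ x)) f := by
      congr 1; simp only [h]
    exact h'.trans (Lp.compMeasurePreserving_comp_apply f _ _)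

/-- The subspace of vectors fixed by a subgroup `H` in a representation. -/
def fixedVectors {G V : Type*} [Group G] [AddCommGroup V] [Module ℂ V]
    (ρ : Representation ℂ G V) (H : Subgroup G) : Submodule ℂ V where
  carrier := {v | ∀ h ∈ H, ρ h v = v}
  add_mem' hv hw h hh := by rw [map_add, hv h hh, hw h hh]
  zero_mem' h _ := map_zero _
  smul_mem' c v hv h hh := by rw [map_smul, hv h hh]

/-- The operator `ρ(η) v = ∫_G η(g) ρ(g) v dg`. -/
noncomputable def heckeAct {G V : Type*} [Group G] [MeasurableSpace G] [NormedAddCommGroup V]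
    [NormedSpace ℂ V] (μ : Measure G) (ρ : Representation ℂ G V) (η : G → ℂ) (v : V) : V :=
  ∫ g, η g • ρ g v ∂μ

theorem coe_ne_zero {F : Type*} [Field F] [ValuativeRel F] {ϖ : 𝒪[F]} (hϖ : Irreducible ϖ) : (ϖ : F) ≠ 0 :=
  fun h => hϖ.ne_zero (Subtype.ext h)

/-- The matrix `σ` in `GL₃(F)`. -/
noncomputable def sigmaGL {ϖ : 𝒪[F]} (hϖ : Irreducible ϖ) : GL (Fin 3) F :=
  Matrix.GeneralLinearGroup.mkOfDetNeZero !![0, 1, 0; 0, 0, 1; (ϖ : F), 0, 0]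
    (by simp [Matrix.det_fin_three, coe_ne_zero hϖ])

/-- The element `σ` of `PGL₃(F)`. -/
noncomputable def sigma {ϖ : 𝒪[F]} (hϖ : Irreducible ϖ) : PGL(3, F) :=
  Matrix.ProjGenLinGroup.mk (sigmaGL hϖ)

/-- The vertices of the building, `G/K`. -/
abbrev Vertex (F : Type*) [Field F] [ValuativeRel F] [TopologicalSpace F]
    [IsNonarchimedeanLocalField F] : Type _ := PGL(3, F) ⧸ K F

/-- The vertex `gK` given by a matrix `g` in `GL₃(F)`. -/
noncomputable def vertexOf (g : GL (Fin 3) F) : Vertex F :=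
  ((Matrix.ProjGenLinGroup.mk g : PGL(3, F)) : PGL(3, F) ⧸ K F)

/-- The lattice `g𝒪³` in `F³`, as a set. -/
def latticeOf (g : GL (Fin 3) F) : Set (Fin 3 → F) :=
  Set.range fun w : Fin 3 → 𝒪[F] => g.1.mulVec fun k => (w k : F)

/-- The vertices `x₀, …, xᵢ` form an `i`-cell of the building: they have representatives whose
lattices `Lⱼ` form a chain of `i + 1` distinct lattices, all lying above `ϖ` times each of them.
If the chain is sorted as `Lᵢ < ⋯ < L₁ < L₀` then this reads `ϖL₀ < Lᵢ < ⋯ < L₁ < L₀`. -/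
def IsCell (ϖ : 𝒪[F]) {i : ℕ} (x : Fin (i + 1) → Vertex F) : Prop :=
  ∃ g : Fin (i + 1) → GL (Fin 3) F, (∀ j, vertexOf (g j) = x j) ∧
    (∀ j k, j ≠ k → latticeOf (g j) ⊂ latticeOf (g k) ∨ latticeOf (g k) ⊂ latticeOf (g j)) ∧
    ∀ j k, (ϖ : F) • latticeOf (g j) ⊂ latticeOf (g k)

/-- The ordered `i`-cells of the building `ℬ`. -/
abbrev BuildingCell (ϖ : 𝒪[F]) (i : ℕ) : Type _ :=
  {x : Fin (i + 1) → Vertex F // IsCell ϖ x}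

/-- Two ordered cells of the building are equivalent if they are in the same `Γ`-orbit. -/
def cellSetoid (ϖ : 𝒪[F]) (Γ : Subgroup PGL(3, F)) (i : ℕ) : Setoid (BuildingCell ϖ i) where
  r x y := ∃ γ ∈ Γ, ∀ j, y.1 j = γ • x.1 j
  iseqv :=
    { refl := fun x => ⟨1, Γ.one_mem, fun j => (one_smul _ _).symm⟩
      symm := by
        rintro x y ⟨γ, hγ, h⟩
        exact ⟨γ⁻¹, Γ.inv_mem hγ, fun j => by rw [h j, inv_smul_smul]⟩
      trans := by
        rintro x y z ⟨γ, hγ, h⟩ ⟨δ, hδ, h'⟩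
        exact ⟨δ * γ, Γ.mul_mem hδ hγ, fun j => by rw [h' j, h j, mul_smul]⟩ }

/-- The ordered `i`-cells of the quotient `X = Γ\ℬ`. -/
def Cell (ϖ : 𝒪[F]) (Γ : Subgroup PGL(3, F)) (i : ℕ) : Type _ := Quotient (cellSetoid ϖ Γ i)

theorem IsCell.comp {ϖ : 𝒪[F]} {i k : ℕ} {x : Fin (i + 1) → Vertex F} (hx : IsCell ϖ x)
    {e : Fin (k + 1) → Fin (i + 1)} (he : Function.Injective e) : IsCell ϖ (x ∘ e) := by
  obtain ⟨g, h1, h2, h3⟩ := hx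
  exact ⟨g ∘ e, fun j => h1 _, fun j k h => h2 _ _ fun h' => h (he h'), fun j k => h3 _ _⟩

/-- Reindexing of the vertices of ordered cells of `X` along an injection of index sets. -/
def Cell.comp {ϖ : 𝒪[F]} {Γ : Subgroup PGL(3, F)} {i k : ℕ} (x : Cell ϖ Γ i)
    (e : Fin (k + 1) ↪ Fin (i + 1)) : Cell ϖ Γ k :=
  Quotient.map (fun y : BuildingCell ϖ i => (⟨y.1 ∘ e, y.2.comp e.injective⟩ : BuildingCell ϖ k))
    (by rintro y z ⟨γ, hγ, h⟩; exact ⟨γ, hγ, fun j => h (e j)⟩) x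

theorem Cell.comp_comp {ϖ : 𝒪[F]} {Γ : Subgroup PGL(3, F)} {i k l : ℕ} (x : Cell ϖ Γ i)
    (e : Fin (k + 1) ↪ Fin (i + 1)) (e' : Fin (l + 1) ↪ Fin (k + 1)) :
    (x.comp e).comp e' = x.comp (e'.trans e) := by
  induction x using Quotient.inductionOn with
  | h x => rfl

theorem Cell.comp_refl {ϖ : 𝒪[F]} {Γ : Subgroup PGL(3, F)} {i : ℕ} (x : Cell ϖ Γ i) :
    x.comp (Function.Embedding.refl _) = x := by
  induction x using Quotient.inductionOn with
  | h x => rfl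

/-- Reordering the vertices of a cell. -/
def Cell.perm {ϖ : 𝒪[F]} {Γ : Subgroup PGL(3, F)} {i : ℕ} (x : Cell ϖ Γ i)
    (τ : Equiv.Perm (Fin (i + 1))) : Cell ϖ Γ i := x.comp τ.toEmbedding

/-- The `j`-th face, obtained by deleting the `j`-th vertex. -/
def Cell.face {ϖ : 𝒪[F]} {Γ : Subgroup PGL(3, F)} {i : ℕ} (x : Cell ϖ Γ (i + 1))
    (j : Fin (i + 2)) : Cell ϖ Γ i := x.comp (Fin.succAboveEmb j)

/-- The space `Ωⁱ(X)` of `i`-forms: the skew-symmetric complex functions on the ordered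
`i`-cells of `X`. -/
def Form (ϖ : 𝒪[F]) (Γ : Subgroup PGL(3, F)) (i : ℕ) : Submodule ℂ (Cell ϖ Γ i → ℂ) where
  carrier := {f | ∀ (τ : Equiv.Perm (Fin (i + 1))) (x : Cell ϖ Γ i),
    f (x.perm τ) = ((Equiv.Perm.sign τ : ℤ) : ℂ) * f x}
  add_mem' hf hg τ x := by simp only [Pi.add_apply, hf τ x, hg τ x, mul_add]
  zero_mem' τ x := by simp
  smul_mem' c f hf τ x := by simp only [Pi.smul_apply, smul_eq_mul, hf τ x]; ring

/-- The boundary map `Ωⁱ⁺¹(X) → Ωⁱ(X)`, `(∂f)(x) = ∑ f(vx)`; the sum is over the ordered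
`(i+1)`-cells `y = vx` of `X` from which `x` arises by deleting the first vertex. -/
noncomputable def boundary {ϖ : 𝒪[F]} {Γ : Subgroup PGL(3, F)} {i : ℕ}
    (f : Form ϖ Γ (i + 1)) : Form ϖ Γ i where
  val x := ∑ᶠ y : {y : Cell ϖ Γ (i + 1) // y.face 0 = x}, f.1 y
  property τ x := by
    let τ' : Equiv.Perm (Fin (i + 2)) := Equiv.Perm.decomposeFin.symm (0, τ)
    have hτ' : ∀ y : Cell ϖ Γ (i + 1), (y.perm τ').face 0 = (y.face 0).perm τ := fun y => by
      simp only [Cell.perm, Cell.face, Cell.comp_comp]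
      congr 1
    have hinv : ∀ {k : ℕ} (τ : Equiv.Perm (Fin (k + 1))) (y : Cell ϖ Γ k),
        (y.perm τ).perm τ⁻¹ = y ∧ (y.perm τ⁻¹).perm τ = y := fun τ y => by
      constructor
      all_goals
        simp only [Cell.perm, Cell.comp_comp]
        refine Eq.trans ?_ y.comp_refl
        congr 1
        ext j : 1
        simp
    let e : {y : Cell ϖ Γ (i + 1) // y.face 0 = x} ≃
        {y : Cell ϖ Γ (i + 1) // y.face 0 = x.perm τ} :=
      { toFun := fun y => ⟨y.1.perm τ', by rw [hτ', y.2]⟩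
        invFun := fun y => ⟨y.1.perm τ'⁻¹, by
          have h := hτ' (y.1.perm τ'⁻¹)
          rw [(hinv τ' y.1).2, y.2] at h
          have h2 := congrArg (fun z => Cell.perm z τ⁻¹) h
          simpa only [(hinv τ _).1] using h2.symm⟩
        left_inv := fun y => Subtype.ext (hinv τ' y.1).1
        right_inv := fun y => Subtype.ext (hinv τ' y.1).2 }
    have hs : Equiv.Perm.sign τ' = Equiv.Perm.sign τ := by simp [τ']
    calc ∑ᶠ y : {y : Cell ϖ Γ (i + 1) // y.face 0 = x.perm τ}, f.1 y
        = ∑ᶠ y : {y : Cell ϖ Γ (i + 1) // y.face 0 = x}, f.1 (y.1.perm τ') :=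
          (finsum_comp_equiv e (f := fun y => f.1 y.1)).symm
      _ = ∑ᶠ y : {y : Cell ϖ Γ (i + 1) // y.face 0 = x},
            ((Equiv.Perm.sign τ : ℤ) : ℂ) * f.1 y := by
          refine finsum_congr fun y => ?_
          rw [f.2 τ' y.1, hs]
      _ = _ := by
          have := smul_finsum ((Equiv.Perm.sign τ : ℤ) : ℂ)
            (fun y : {y : Cell ϖ Γ (i + 1) // y.face 0 = x} => f.1 y.1)
          simpa only [smul_eq_mul] using this.symm

/-- For `τ` a permutation of `0, …, i + 1` and an index `j`, the permutation of `0, …, i` induced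
by `τ` after deleting `j` and `τ j`, with its sign. -/
theorem exists_perm_succAbove {i : ℕ} (τ : Equiv.Perm (Fin (i + 2))) (j : Fin (i + 2)) :
    ∃ τ' : Equiv.Perm (Fin (i + 1)), (∀ k, τ (j.succAbove k) = (τ j).succAbove (τ' k)) ∧
      (-1 : ℂ) ^ (j : ℕ) * ((Equiv.Perm.sign τ' : ℤ) : ℂ)
        = ((Equiv.Perm.sign τ : ℤ) : ℂ) * (-1) ^ ((τ j : Fin (i + 2)) : ℕ) := by
  let ρ : Equiv.Perm (Fin (i + 2)) := (τ j).cycleRange * τ * (j.cycleRange)⁻¹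
  have h0 : ρ 0 = 0 := by
    simp only [ρ, Equiv.Perm.mul_apply, Equiv.Perm.inv_def, Fin.cycleRange_symm_zero,
      Fin.cycleRange_self]
  obtain ⟨⟨p, τ'⟩, hρ⟩ := Equiv.Perm.decomposeFin.symm.surjective ρ
  have hp : p = 0 := by
    rw [← hρ, Equiv.Perm.decomposeFin_symm_apply_zero] at h0; exact h0
  subst hp
  have hk : ∀ k : Fin (i + 1), ρ k.succ = (τ' k).succ := fun k => by
    rw [← hρ]; simp
  refine ⟨τ', fun k => ?_, ?_⟩
  · have := hk k
    simp only [ρ, Equiv.Perm.mul_apply, Equiv.Perm.inv_def, Fin.cycleRange_symm_succ] at this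
    rw [← Fin.cycleRange_symm_succ (τ j), ← this, Equiv.symm_apply_apply]
  · have hs : Equiv.Perm.sign τ' = Equiv.Perm.sign ρ := by
      rw [← hρ]; simp
    have hs' : (Equiv.Perm.sign τ' : ℤ)
        = (-1) ^ ((τ j : Fin (i + 2)) : ℕ) * (Equiv.Perm.sign τ : ℤ) * (-1) ^ (j : ℕ) := by
      rw [hs]
      simp [ρ, Fin.sign_cycleRange]
    rw [hs']
    push_cast
    have : ((-1 : ℂ) ^ (j : ℕ)) * (-1) ^ (j : ℕ) = 1 := by
      rw [← mul_pow]; norm_num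
    linear_combination ((-1) ^ ((τ j : Fin (i + 2)) : ℕ) * ((Equiv.Perm.sign τ : ℤ) : ℂ)) * this

/-- The coboundary map `Ωⁱ(X) → Ωⁱ⁺¹(X)`, `(δf)(y) = ∑ⱼ (-1)ʲ f(y ∖ yⱼ)`. -/
def coboundary {ϖ : 𝒪[F]} {Γ : Subgroup PGL(3, F)} {i : ℕ}
    (f : Form ϖ Γ i) : Form ϖ Γ (i + 1) where
  val y := ∑ j : Fin (i + 2), (-1) ^ (j : ℕ) * f.1 (y.face j)
  property τ y := by
    have h : ∀ j : Fin (i + 2), (-1 : ℂ) ^ (j : ℕ) * f.1 ((y.perm τ).face j)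
        = ((Equiv.Perm.sign τ : ℤ) : ℂ) *
          ((-1) ^ ((τ j : Fin (i + 2)) : ℕ) * f.1 (y.face (τ j))) := fun j => by
      obtain ⟨τ', h1, h2⟩ := exists_perm_succAbove τ j
      have h3 : (y.perm τ).face j = (y.face (τ j)).perm τ' := by
        simp only [Cell.perm, Cell.face, Cell.comp_comp]
        congr 1
        ext k : 1
        exact h1 k
      rw [h3, f.2 τ', ← mul_assoc, h2, mul_assoc]
    change ∑ j : Fin (i + 2), (-1 : ℂ) ^ (j : ℕ) * f.1 ((y.perm τ).face j) = _
    rw [Finset.sum_congr rfl fun j _ => h j, ← Finset.mul_sum]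
    congr 1
    exact Equiv.sum_comp τ fun j => (-1) ^ (j : ℕ) * f.1 (y.face j)

theorem latticeOf_mul {F : Type*} [Field F] [ValuativeRel F] (g h : GL (Fin 3) F) :
    latticeOf (g * h) = (fun v => g.1.mulVec v) '' latticeOf h := by
  ext v
  simp [latticeOf, Matrix.mulVec_mulVec]

theorem mulVec_injective {F : Type*} [Field F] (g : GL (Fin 3) F) : Function.Injective (fun v => g.1.mulVec v) := by
  intro v w h
  have := congrArg (fun v => (g⁻¹).1.mulVec v) h
  simpa [Matrix.mulVec_mulVec] using this

theorem latticeOf_sigma_pow_strictAnti {F : Type*} [Field F] [ValuativeRel F] {ϖ : 𝒪[F]} (hϖ : Irreducible ϖ) (g : GL (Fin 3) F) :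
    StrictAnti fun m : ℕ => latticeOf (g * sigmaGL hϖ ^ m) := by
  have h1 : latticeOf (sigmaGL hϖ) ⊂ latticeOf (1 : GL (Fin 3) F) := by
    rw [Set.ssubset_iff_exists]
    constructor
    · rintro _ ⟨w, rfl⟩
      refine ⟨![w 1, w 2, ϖ * w 0], ?_⟩
      ext k
      fin_cases k <;> simp [sigmaGL, Matrix.mulVec, dotProduct, Fin.sum_univ_three]
    · refine ⟨fun k => (1 : F), ⟨fun _ => 1, by simp⟩, ?_⟩
      rintro ⟨w, hw⟩
      have h := congrFun hw 2
      simp [sigmaGL, Matrix.mulVec, dotProduct, Fin.sum_univ_three] at h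
      have h' : ϖ * w 0 = 1 := Subtype.ext h
      exact hϖ.not_isUnit (IsUnit.of_mul_eq_one _ h')
  refine strictAnti_nat_of_succ_lt fun m => ?_
  rw [pow_succ, ← mul_assoc]
  rw [latticeOf_mul]
  have : latticeOf (g * sigmaGL hϖ ^ m)
      = (fun v => (g * sigmaGL hϖ ^ m).1.mulVec v) '' latticeOf 1 := by
    rw [← latticeOf_mul, mul_one]
  rw [this]
  exact (Function.Injective.image_strictMono (mulVec_injective _)) h1

theorem smul_latticeOf {F : Type*} [Field F] [ValuativeRel F] {ϖ : 𝒪[F]} (hϖ : Irreducible ϖ) (g : GL (Fin 3) F) :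
    (ϖ : F) • latticeOf g = latticeOf (g * sigmaGL hϖ ^ 3) := by
  have h3 : (sigmaGL hϖ ^ 3).1 = (ϖ : F) • (1 : Matrix (Fin 3) (Fin 3) F) := by
    rw [pow_succ, pow_two]
    ext i j
    fin_cases i <;> fin_cases j <;>
      simp [sigmaGL, Matrix.mul_apply, Fin.sum_univ_three]
  ext v
  simp only [latticeOf, Set.mem_smul_set, Set.mem_range, exists_exists_eq_and, Units.val_mul, h3,
    Matrix.mul_smul, mul_one, Matrix.smul_mulVec]

theorem isCell_sigma {ϖ : 𝒪[F]} (hϖ : Irreducible ϖ) {i : ℕ} (hi : i ≤ 2) (g : PGL(3, F)) :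
    IsCell ϖ fun j : Fin (i + 1) =>
      g • ((sigma hϖ ^ (j : ℕ) : PGL(3, F)) : Vertex F) := by
  obtain ⟨g, rfl⟩ := Matrix.ProjGenLinGroup.mk_surjective g
  have ha := latticeOf_sigma_pow_strictAnti hϖ g
  refine ⟨fun j => g * sigmaGL hϖ ^ (j : ℕ), fun j => ?_, fun j k hjk => ?_, fun j k => ?_⟩
  · simp only [vertexOf, sigma, map_mul, map_pow]
    rfl
  · rcases lt_or_gt_of_ne (Fin.val_ne_of_ne hjk) with h | h
    · exact Or.inr (ha h)
    · exact Or.inl (ha h)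
  · rw [smul_latticeOf hϖ, mul_assoc, ← pow_add]
    exact ha (by omega)

/-- The map `Γg ↦ Γgcᵢ` from `Γ\G` to the ordered `i`-cells of `X = Γ\ℬ`, where the `cᵢ` are the
fundamental cells `c₀ = v₀`, `c₁ = e₀ = [v₀, σv₀]` and `c₂ = t₀ = [v₀, σv₀, σ²v₀]`. -/
noncomputable def cosetToCell {ϖ : 𝒪[F]} (hϖ : Irreducible ϖ) (Γ : Subgroup PGL(3, F)) {i : ℕ}
    (hi : i ≤ 2) : Coset Γ → Cell ϖ Γ i :=
  Quotient.map (fun g => (⟨_, isCell_sigma hϖ hi g⟩ : BuildingCell ϖ i)) (by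
    rintro _ b ⟨γ, rfl⟩
    refine ⟨(γ : PGL(3, F))⁻¹, Γ.inv_mem γ.2, fun j => ?_⟩
    simp only [← mul_smul]
    congr 1
    exact (inv_mul_cancel_left (γ : PGL(3, F)) b).symm)

/-- `E = K ∩ σKσ⁻¹`, the stabilizer of the oriented edge `e₀`. -/
noncomputable def E {ϖ : 𝒪[F]} (hϖ : Irreducible ϖ) : Subgroup PGL(3, F) :=
  K F ⊓ (K F).map (MulAut.conj (sigma hϖ)).toMonoidHom

/-- The Iwahori subgroup `I = K ∩ σKσ⁻¹ ∩ σ²Kσ⁻²`. -/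
noncomputable def Iwahori {ϖ : 𝒪[F]} (hϖ : Irreducible ϖ) : Subgroup PGL(3, F) :=
  K F ⊓ (K F).map (MulAut.conj (sigma hϖ)).toMonoidHom ⊓
    (K F).map (MulAut.conj (sigma hϖ ^ 2)).toMonoidHom

/-- `T`, the stabilizer in `G` of the triangle `t₀` with vertices `v₀`, `σv₀`, `σ²v₀`. -/
noncomputable def T {ϖ : 𝒪[F]} (hϖ : Irreducible ϖ) : Subgroup PGL(3, F) :=
  MulAction.stabilizer PGL(3, F)
    ({((1 : PGL(3, F)) : Vertex F), ((sigma hϖ : PGL(3, F)) : Vertex F),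
      ((sigma hϖ ^ 2 : PGL(3, F)) : Vertex F)} : Set (Vertex F))

/-- The Iwahori–Hecke algebra `ℋ = C_c(I\G/I)`, as a vector space of functions: the compactly supported bi-`I`-invariant complex
functions on `G`. -/
def IwahoriHecke {ϖ : 𝒪[F]} (hϖ : Irreducible ϖ) : Submodule ℂ (PGL(3, F) → ℂ) where
  carrier := {η | (∀ g, ∀ a ∈ Iwahori hϖ, ∀ b ∈ Iwahori hϖ, η (a * g * b) = η g) ∧
    HasCompactSupport η}
  add_mem' h h' := ⟨fun g a ha b hb => by
    simp only [Pi.add_apply, h.1 g a ha b hb, h'.1 g a ha b hb], h.2.add h'.2⟩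
  zero_mem' := ⟨fun _ _ _ _ _ => rfl, HasCompactSupport.zero⟩
  smul_mem' c η h := ⟨fun g a ha b hb => by
    simp only [Pi.smul_apply, h.1 g a ha b hb], h.2.smul_left (f := fun _ => c)⟩

/-- The characteristic function of a subset of `G`. -/
noncomputable def charFun (S : Set PGL(3, F)) : PGL(3, F) → ℂ := S.indicator 1

/-- `∂₁ = μ(E)^{-1/2} (𝟙_{Kσ²} - 𝟙_K)`. -/
noncomputable def heckeBoundary₁ {ϖ : 𝒪[F]} (hϖ : Irreducible ϖ) (μ : Measure PGL(3, F)) :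
    PGL(3, F) → ℂ :=
  ((1 / Real.sqrt (μ.real (E hϖ)) : ℝ) : ℂ) •
    (charFun ((K F : Set PGL(3, F)) * {sigma hϖ ^ 2}) - charFun (K F : Set PGL(3, F)))

/-- `δ₁ = μ(E)^{-1/2} (𝟙_{σK} - 𝟙_K)`. -/
noncomputable def heckeCoboundary₁ {ϖ : 𝒪[F]} (hϖ : Irreducible ϖ) (μ : Measure PGL(3, F)) :
    PGL(3, F) → ℂ :=
  ((1 / Real.sqrt (μ.real (E hϖ)) : ℝ) : ℂ) •
    (charFun ({sigma hϖ} * (K F : Set PGL(3, F))) - charFun (K F : Set PGL(3, F)))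

/-- `∂₂ = (μ(E) μ(T))^{-1/2} 𝟙_{ET}`. -/
noncomputable def heckeBoundary₂ {ϖ : 𝒪[F]} (hϖ : Irreducible ϖ) (μ : Measure PGL(3, F)) :
    PGL(3, F) → ℂ :=
  ((1 / Real.sqrt (μ.real (E hϖ) * μ.real (T hϖ)) : ℝ) : ℂ) •
    charFun ((E hϖ : Set PGL(3, F)) * (T hϖ : Set PGL(3, F)))

/-- `δ₂ = (μ(E) μ(T))^{-1/2} 𝟙_{TE}`. -/
noncomputable def heckeCoboundary₂ {ϖ : 𝒪[F]} (hϖ : Irreducible ϖ) (μ : Measure PGL(3, F)) :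
    PGL(3, F) → ℂ :=
  ((1 / Real.sqrt (μ.real (E hϖ) * μ.real (T hϖ)) : ℝ) : ℂ) •
    charFun ((T hϖ : Set PGL(3, F)) * (E hϖ : Set PGL(3, F)))

/-- The subspace `L²(Γ\G)^H` of vectors fixed by a subgroup `H` of `G`. -/
noncomputable abbrev L2Fixed (Γ : Subgroup PGL(3, F)) [IsTorsionFreeCocompactLattice Γ]
    (μ : Measure PGL(3, F)) [μ.IsHaarMeasure] (H : Subgroup PGL(3, F)) : Submodule ℂ (L2 Γ μ) :=
  fixedVectors (regularRep Γ μ) H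

/-- A linear bijection `Φ : Ωⁱ(X) → L²(Γ\G)^H` is the identification of forms with `H`-fixed
vectors if it is given by `f(gcᵢ) = √μ(H) (Φf)(Γg)`, where `cᵢ` is the fundamental `i`-cell. -/
def IsIdentification {ϖ : 𝒪[F]} (hϖ : Irreducible ϖ) {Γ : Subgroup PGL(3, F)}
    [IsTorsionFreeCocompactLattice Γ] {μ : Measure PGL(3, F)} [μ.IsHaarMeasure] {i : ℕ}
    (hi : i ≤ 2) {H : Subgroup PGL(3, F)} (Φ : Form ϖ Γ i ≃ₗ[ℂ] L2Fixed Γ μ H) : Prop :=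
  ∀ f : Form ϖ Γ i, ∀ᵐ x ∂(quotientMeasure Γ μ),
    f.1 (cosetToCell hϖ Γ hi x) = (Real.sqrt (μ.real H) : ℂ) * (Φ f : L2 Γ μ) x

end

end PGL3

set_option linter.unusedSectionVars false
namespace PGL3
-- Integral matrices, lattices and the type of a vertex.
section
variable {F : Type*} [Field F] [ValuativeRel F] [TopologicalSpace F] [IsNonarchimedeanLocalField F]

/-! Two facts about the building carry the proof. By elementary divisors modulo $\pi$, every ordered
$i$-cell with $i\le 2$ is $gc_i$ with its vertices permuted (`exists_perm_of_isCell`). The valuation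
of the determinant modulo 3 is a homomorphism on $G$ that is trivial on $K$ and not on $\sigma$, so
$G$ preserves differences of vertex types, and a permutation of $c_i$ induced by an element of $G$
is a rotation, hence even (`sign_eq_one_of_smul`).

Consequently a form is determined by the function $g\mapsto f(gc_i)$, which is left
$\Gamma$-invariant and right $K_i$-invariant, and every such function extends by skew-symmetry to a
form (`IsCellStabilizer.exists_form`). To match these functions with $L^2(\Gamma\backslash
G)^{K_i}$, note that forms are bounded because $X$ has finitely many cells, and that the quotient
has finite measure. Conversely, a class fixed by $K_i$ is only invariant almost everywhere for each
element of $K_i$; Fubini turns this into the existence of a genuinely invariant representative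
(`exists_right_invariant`).

If $\eta$ is right $H$-invariant with compact support and $v$ is $H$-fixed, then
$\int\eta(g)\rho(g)v$ is a finite sum over $G/H$ with weight $\mu(H)$. With the square roots in the
identifications, each of the four operator identities becomes a formula without measures
(`heckeAct_equiv`): the value of the (co)boundary at $gc_j$ is $\sum_{s\in G/H}\eta(s)f(gsc_i)$,
where $\eta$ now stands for the unnormalized function.

These formulas are counts of cells. Torsion-freeness and discreteness make $\Gamma$ act freely on
vertices, so the cells of $X$ that extend a given cell correspond to the cells of $\mathcal B$ that
extend a fixed lift (`boundary_mk`). The relevant sets $K\sigma^2$, $K$, $\sigma K$ are transporters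
between standard vertices; the cosets in $ET/T$ give the triangles on an edge, and those in $TE/E$
the three edges of a triangle. The signs come from edges met with reversed orientation. -/

theorem mem_K_iff {x : PGL(3, F)} : x ∈ K F ↔
    ∃ y : GL (Fin 3) 𝒪[F],
      Matrix.ProjGenLinGroup.mk (Matrix.GeneralLinearGroup.map (algebraMap 𝒪[F] F) y) = x := by
  constructor
  · rintro ⟨y, rfl⟩
    obtain ⟨y, rfl⟩ := Matrix.ProjGenLinGroup.mk_surjective y
    exact ⟨y, rfl⟩
  · rintro ⟨y, rfl⟩
    exact ⟨Matrix.ProjGenLinGroup.mk y, rfl⟩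

theorem mk_mem_K {y : GL (Fin 3) F} (h : ∀ i j, y.1 i j ∈ 𝒪[F])
    (h' : ∀ i j, (y⁻¹).1 i j ∈ 𝒪[F]) : (Matrix.ProjGenLinGroup.mk y : PGL(3, F)) ∈ K F := by
  rw [mem_K_iff]
  let A : Matrix (Fin 3) (Fin 3) 𝒪[F] := fun i j => ⟨y.1 i j, h i j⟩
  let B : Matrix (Fin 3) (Fin 3) 𝒪[F] := fun i j => ⟨(y⁻¹).1 i j, h' i j⟩
  have hinj : Function.Injective (fun M : Matrix (Fin 3) (Fin 3) 𝒪[F] =>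
      M.map (algebraMap 𝒪[F] F)) := Matrix.map_injective Subtype.val_injective
  have hA : A.map (algebraMap 𝒪[F] F) = y.1 := rfl
  have hB : B.map (algebraMap 𝒪[F] F) = (y⁻¹).1 := rfl
  refine ⟨⟨A, B, hinj (by simp only [Matrix.map_mul, hA, hB]; simp),
    hinj (by simp only [Matrix.map_mul, hA, hB]; simp)⟩, ?_⟩
  congr 1

theorem smul_vertexOf (g h : GL (Fin 3) F) :
    (Matrix.ProjGenLinGroup.mk g : PGL(3, F)) • (vertexOf h : Vertex F) = vertexOf (g * h) := by
  simp only [vertexOf, map_mul]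
  rfl

/-- The $j$-th column of $g^{-1}h$ is $g^{-1}$ applied to the vector $he_j$ of $h\mathcal
O^3\subseteq g\mathcal O^3$, so it lies in $\mathcal O^3$. -/
theorem integral_of_latticeOf_subset {g h : GL (Fin 3) F} (hgh : latticeOf h ⊆ latticeOf g)
    (i j : Fin 3) : (g⁻¹ * h).1 i j ∈ 𝒪[F] := by
  have h1 : (fun v => (g⁻¹).1.mulVec v) '' latticeOf h
      ⊆ (fun v => (g⁻¹).1.mulVec v) '' latticeOf g := Set.image_mono hgh
  rw [← latticeOf_mul, ← latticeOf_mul, inv_mul_cancel] at h1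
  obtain ⟨w, hw⟩ := h1 ⟨Pi.single j 1, rfl⟩
  have h2 : (fun k => ((Pi.single j 1 : Fin 3 → 𝒪[F]) k : F)) = Pi.single j (1 : F) := by
    ext k
    rcases eq_or_ne k j with rfl | hk
    · simp
    · simp [hk]
  have h3 := congrFun hw i
  beta_reduce at h3
  rw [h2] at h3
  simp only [Units.val_one, Matrix.one_mulVec, Matrix.mulVec_single_one] at h3
  rw [show (g⁻¹ * h).1 i j = (g⁻¹ * h).1.col j i from rfl, ← h3]
  exact (w i).2

theorem vertexOf_eq_of_latticeOf_eq {g h : GL (Fin 3) F} (hgh : latticeOf g = latticeOf h) :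
    (vertexOf g : Vertex F) = vertexOf h := by
  refine QuotientGroup.eq.2 ?_
  rw [← map_inv, ← map_mul]
  refine mk_mem_K (integral_of_latticeOf_subset hgh.ge) ?_
  rw [mul_inv_rev, inv_inv]
  exact integral_of_latticeOf_subset hgh.le

theorem sigma_pow_three {ϖ : 𝒪[F]} (hϖ : Irreducible ϖ) : sigma hϖ ^ 3 = 1 := by
  have h3 : sigmaGL hϖ ^ 3 = .scalar (Fin 3) (Units.mk0 (ϖ : F) (coe_ne_zero hϖ)) := by
    ext1
    rw [pow_succ, pow_two]
    ext i j
    fin_cases i <;> fin_cases j <;>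
      simp [sigmaGL, Matrix.mul_apply, Fin.sum_univ_three]
  rw [sigma, ← map_pow, h3, Matrix.ProjGenLinGroup.mk_scalar]

theorem sigma_pow_mod {ϖ : 𝒪[F]} (hϖ : Irreducible ϖ) (n : ℕ) :
    sigma hϖ ^ (n % 3) = sigma hϖ ^ n :=
  (pow_eq_pow_mod n (sigma_pow_three hϖ)).symm

variable (F) in
/-- The products of units of `𝒪` and cubes in `Fˣ`. -/
noncomputable def unitsMulCubes : Subgroup Fˣ :=
  (Units.map (algebraMap 𝒪[F] F).toMonoidHom).range ⊔ (powMonoidHom 3).range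

variable (F) in
/-- The quotient of `Fˣ` by the units of `𝒪` and the cubes. -/
def TypeGroup : Type _ := Fˣ ⧸ unitsMulCubes F

noncomputable instance : CommGroup (TypeGroup F) :=
  inferInstanceAs (CommGroup (Fˣ ⧸ unitsMulCubes F))

variable (F) in
/-- The projection from `Fˣ` to `TypeGroup F`. -/
noncomputable def toTypeGroup : Fˣ →* TypeGroup F where
  toFun x := ((x : Fˣ ⧸ unitsMulCubes F))
  map_one' := rfl
  map_mul' _ _ := rfl

theorem toTypeGroup_eq_one_iff {x : Fˣ} : toTypeGroup F x = 1 ↔ x ∈ unitsMulCubes F :=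
  QuotientGroup.eq_one_iff x

theorem TypeGroup.pow_three (q : TypeGroup F) : q ^ 3 = 1 := by
  obtain ⟨z, rfl⟩ : ∃ z, toTypeGroup F z = q := Quotient.mk_surjective q
  rw [← map_pow, toTypeGroup_eq_one_iff]
  exact Subgroup.mem_sup_right ⟨z, rfl⟩

variable (F) in
/-- The class of the determinant modulo units of `𝒪` and cubes. -/
noncomputable def typeHom : PGL(3, F) →* TypeGroup F :=
  Matrix.ProjGenLinGroup.lift ((toTypeGroup F).comp Matrix.GeneralLinearGroup.det) (by
      ext u
      simp only [MonoidHom.comp_apply, MonoidHom.one_apply]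
      refine toTypeGroup_eq_one_iff.2 (Subgroup.mem_sup_right ⟨u, ?_⟩)
      ext
      simp)

theorem typeHom_of_mem_K {k : PGL(3, F)} (hk : k ∈ K F) : typeHom F k = 1 := by
  obtain ⟨y, rfl⟩ := mem_K_iff.1 hk
  refine toTypeGroup_eq_one_iff.2 (Subgroup.mem_sup_left
    ⟨Matrix.GeneralLinearGroup.det y, ?_⟩)
  rw [Matrix.GeneralLinearGroup.map_det]
  rfl

/-- The determinant of $\sigma$ is $\pi$, and $\pi=uc^3$ is impossible for a unit $u$: then $c$ is
integral and divisible by $\pi$, and cancelling one $\pi$ would make $\pi$ a unit. -/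
theorem typeHom_sigma_ne_one {ϖ : 𝒪[F]} (hϖ : Irreducible ϖ) : typeHom F (sigma hϖ) ≠ 1 := by
  intro h
  have h1 := toTypeGroup_eq_one_iff.1 h
  obtain ⟨_, ⟨u, rfl⟩, _, ⟨c, rfl⟩, hc⟩ := Subgroup.mem_sup.1 h1
  have hdet : (u : F) * (c : F) ^ 3 = ϖ := by
    have := congrArg Units.val hc
    have h2 : (sigmaGL hϖ).1.det = ϖ := by simp [sigmaGL, Matrix.det_fin_three]
    exact this.trans h2
  have hu : ((u⁻¹ : 𝒪[F]ˣ) : F) * ((u : 𝒪[F]) : F) = 1 := by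
    exact_mod_cast congrArg Subtype.val (Units.inv_mul u)
  have h2 : (c : F) ^ 3 = ((↑u⁻¹ * ϖ : 𝒪[F]) : F) := by
    push_cast
    rw [← hdet, ← mul_assoc, hu, one_mul]
  have h3 : (c : F) ∈ 𝒪[F] := by
    have : (c : F) ^ 3 ∈ 𝒪[F] := h2 ▸ Subtype.prop _
    rw [Valuation.mem_integer_iff, map_pow] at this
    exact (pow_le_one_iff (by norm_num)).1 this
  have h4 : (⟨c, h3⟩ : 𝒪[F]) ^ 3 = ↑u⁻¹ * ϖ := Subtype.ext h2
  have h5 : ϖ ∣ ⟨c, h3⟩ := hϖ.prime.dvd_of_dvd_pow (h4 ▸ Dvd.intro_left _ rfl)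
  obtain ⟨d, hd⟩ := h5
  rw [hd] at h4
  have h6 : ϖ * (u * ϖ * d ^ 3) = 1 := by
    have : ϖ * (ϖ * (u * ϖ * d ^ 3)) = ϖ * 1 := by
      calc ϖ * (ϖ * (u * ϖ * d ^ 3)) = u * (ϖ * d) ^ 3 := by ring
        _ = ϖ * 1 := by rw [h4, ← mul_assoc, Units.mul_inv, one_mul, mul_one]
    exact mul_left_cancel₀ hϖ.ne_zero this
  exact hϖ.not_isUnit (IsUnit.of_mul_eq_one _ h6)

/-- Since `typeHom` is trivial on $K$, it descends to vertices, and $G$ acts on the values by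
translation. -/
theorem typeHom_mul_eq {g a b : PGL(3, F)} (h : g • (a : Vertex F) = (b : Vertex F)) :
    typeHom F g * typeHom F a = typeHom F b := by
  have h1 := typeHom_of_mem_K (QuotientGroup.eq.1 h)
  rw [map_mul, map_inv, inv_mul_eq_one] at h1
  rw [← h1]
  exact (map_mul _ _ _).symm

end

/-! ### Flags between $\pi R^3$ and $R^3$ over a discrete valuation ring. -/

section
variable {R : Type*} [CommRing R] [IsDomain R] [IsDiscreteValuationRing R]

theorem dvd_of_residue_eq_zero {ϖ : R} (hϖ : Irreducible ϖ) {x : R}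
    (hx : IsLocalRing.residue R x = 0) : ϖ ∣ x := by
  rw [IsLocalRing.residue_eq_zero_iff, hϖ.maximalIdeal_eq] at hx
  exact Ideal.mem_span_singleton.1 hx

theorem dvd_or_isUnit {ϖ : R} (hϖ : Irreducible ϖ) (x : R) : ϖ ∣ x ∨ IsUnit x := by
  by_cases hx : IsLocalRing.residue R x = 0
  · exact Or.inl (dvd_of_residue_eq_zero hϖ hx)
  · exact Or.inr ((IsLocalRing.residue_ne_zero_iff_isUnit x).1 hx)

theorem mem_of_isUnit_smul_mem {A : Submodule R (Fin 3 → R)} {c : R} (hc : IsUnit c)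
    {v : Fin 3 → R} (h : c • v ∈ A) : v ∈ A := by
  obtain ⟨u, rfl⟩ := hc
  have := A.smul_mem (↑u⁻¹ : R) h
  rwa [smul_smul, Units.inv_mul, one_smul] at this

theorem smul_mem_of_dvd {ϖ : R} {A : Submodule R (Fin 3 → R)} (hA : ∀ v, ϖ • v ∈ A) {c : R}
    (hc : ϖ ∣ c) (v : Fin 3 → R) : c • v ∈ A := by
  obtain ⟨d, rfl⟩ := hc
  rw [mul_smul]
  exact hA _

/-- Vectors which are adapted to a flag `ϖR³ ⊂ B ⊂ A ⊂ R³` form a basis of `R³`. -/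
theorem isUnit_det_of_flag {ϖ : R} (hϖ : Irreducible ϖ) {A B : Submodule R (Fin 3 → R)}
    (hB : ∀ v, ϖ • v ∈ B) (hBA : B ≤ A) {v : Fin 3 → Fin 3 → R} (h0 : v 0 ∈ B)
    (h0' : ∀ w, v 0 ≠ ϖ • w) (h1 : v 1 ∈ A) (h1' : v 1 ∉ B) (h2 : v 2 ∉ A) :
    IsUnit (Matrix.of v).transpose.det := by
  by_contra hdet
  have hA : ∀ v, ϖ • v ∈ A := fun v => hBA (hB v)
  have hz : ((Matrix.of v).transpose.map (IsLocalRing.residue R)).det = 0 := by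
    rw [← RingHom.mapMatrix_apply, ← RingHom.map_det]
    by_contra h
    exact hdet ((IsLocalRing.residue_ne_zero_iff_isUnit _).1 h)
  -- A linear relation over the residue field lifts to $\sum c_kv_k\in\varpi R^3$. The flag forces
  -- $\varpi\mid c_2$, then $\varpi\mid c_1$, then $\varpi\mid c_0$, so the relation was trivial.
  obtain ⟨c', hc', hc0⟩ := Matrix.exists_mulVec_eq_zero_iff.2 hz
  choose c hc using fun k => IsLocalRing.residue_surjective (c' k)
  have hdvd : ∀ k, ϖ ∣ (c 0 • v 0 + c 1 • v 1 + c 2 • v 2) k := fun k => by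
    refine dvd_of_residue_eq_zero hϖ ?_
    have := congrFun hc0 k
    simp only [Matrix.mulVec, dotProduct, Fin.sum_univ_three, ← hc, Matrix.map_apply,
      Matrix.transpose_apply, Matrix.of_apply, Pi.zero_apply] at this
    rw [← this]
    simp [mul_comm]
  choose w hw using hdvd
  have hsum : c 0 • v 0 + c 1 • v 1 + c 2 • v 2 = ϖ • w := funext hw
  have k2 : ϖ ∣ c 2 := (dvd_or_isUnit hϖ (c 2)).resolve_right fun hu =>
    h2 (mem_of_isUnit_smul_mem hu (by
      rw [show c 2 • v 2 = ϖ • w - c 0 • v 0 - c 1 • v 1 by rw [← hsum]; abel]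
      exact A.sub_mem (A.sub_mem (hA w) (A.smul_mem _ (hBA h0))) (A.smul_mem _ h1)))
  have k1 : ϖ ∣ c 1 := (dvd_or_isUnit hϖ (c 1)).resolve_right fun hu =>
    h1' (mem_of_isUnit_smul_mem hu (by
      rw [show c 1 • v 1 = ϖ • w - c 0 • v 0 - c 2 • v 2 by rw [← hsum]; abel]
      exact B.sub_mem (B.sub_mem (hB w) (B.smul_mem _ h0)) (smul_mem_of_dvd hB k2 _)))
  have k0 : ϖ ∣ c 0 := (dvd_or_isUnit hϖ (c 0)).resolve_right fun hu => by
    obtain ⟨d1, hd1⟩ := k1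
    obtain ⟨d2, hd2⟩ := k2
    obtain ⟨u, hu⟩ := hu
    refine h0' ((↑u⁻¹ : R) • (w - d1 • v 1 - d2 • v 2)) ?_
    have : (u : R) • v 0 = ϖ • (w - d1 • v 1 - d2 • v 2) := by
      rw [hu, smul_sub, smul_sub, smul_smul, smul_smul, ← hd1, ← hd2, ← hsum]
      abel
    rw [smul_comm, ← this, smul_smul, Units.inv_mul, one_smul]
  apply hc'
  ext k
  rw [← hc, Pi.zero_apply]
  have hk : ϖ ∣ c k := by fin_cases k <;> assumption
  rw [IsLocalRing.residue_eq_zero_iff, hϖ.maximalIdeal_eq]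
  exact Ideal.mem_span_singleton.2 hk

/-- The group `GL₃(R)` acts transitively on the flags `ϖR³ ⊂ B ⊂ A ⊂ R³`. -/
theorem exists_GL_of_flag {ϖ : R} (hϖ : Irreducible ϖ) {A B : Submodule R (Fin 3 → R)}
    (hB : ∀ v, ϖ • v ∈ B) (hB' : ∃ v ∈ B, ∀ w, v ≠ ϖ • w) (hBA : B < A) (hA : A < ⊤) :
    ∃ P : GL (Fin 3) R, (∀ w, P.1.mulVec w ∈ A ↔ ϖ ∣ w 2) ∧
      ∀ w, P.1.mulVec w ∈ B ↔ ϖ ∣ w 1 ∧ ϖ ∣ w 2 := by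
  obtain ⟨v0, h0, h0'⟩ := hB'
  obtain ⟨v1, h1, h1'⟩ := SetLike.exists_of_lt hBA
  obtain ⟨v2, -, h2⟩ := SetLike.exists_of_lt hA
  have hAϖ : ∀ v, ϖ • v ∈ A := fun v => hBA.le (hB v)
  let v : Fin 3 → Fin 3 → R := ![v0, v1, v2]
  have hu : IsUnit (Matrix.of v).transpose.det :=
    isUnit_det_of_flag hϖ hB hBA.le (v := v) h0 h0' h1 h1' h2
  let P : GL (Fin 3) R := Matrix.GeneralLinearGroup.mk'' _ hu
  have hP : ∀ w, P.1.mulVec w = w 0 • v0 + w 1 • v1 + w 2 • v2 := fun w => by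
    ext k
    change (Matrix.of v).transpose.mulVec w k = _
    simp [Matrix.mulVec, dotProduct, Fin.sum_univ_three, v, mul_comm]
  have key : ∀ w, P.1.mulVec w ∈ A ↔ ϖ ∣ w 2 := fun w => by
    rw [hP]
    constructor
    · intro h
      refine (dvd_or_isUnit hϖ (w 2)).resolve_right fun hu => h2 (mem_of_isUnit_smul_mem hu ?_)
      exact (A.add_mem_iff_right
        (A.add_mem (A.smul_mem _ (hBA.le h0)) (A.smul_mem _ h1))).1 h
    · intro h
      exact A.add_mem (A.add_mem (A.smul_mem _ (hBA.le h0)) (A.smul_mem _ h1))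
        (smul_mem_of_dvd hAϖ h _)
  refine ⟨P, key, fun w => ⟨fun h => ?_, fun h => ?_⟩⟩
  · have k2 := (key w).1 (hBA.le h)
    refine ⟨(dvd_or_isUnit hϖ (w 1)).resolve_right fun hu =>
      h1' (mem_of_isUnit_smul_mem hu ?_), k2⟩
    rw [hP] at h
    have h3 := (B.add_mem_iff_left (smul_mem_of_dvd hB k2 _)).1 h
    exact (B.add_mem_iff_right (B.smul_mem _ h0)).1 h3
  · rw [hP]
    exact B.add_mem (B.add_mem (B.smul_mem _ h0) (smul_mem_of_dvd hB h.1 _))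
      (smul_mem_of_dvd hB h.2 _)

/-- Modulo $\varpi$, two vectors cannot span a space of dimension three. -/
theorem exists_ne_smul_add_smul_add {ϖ : R} (hϖ : Irreducible ϖ) (v0 v2 : Fin 3 → R) :
    ∃ w, ∀ a b : R, ∀ u : Fin 3 → R, w ≠ a • v0 + b • v2 + ϖ • u := by
  classical
  by_contra! H
  let r : (Fin 3 → R) → Fin 3 → IsLocalRing.ResidueField R := fun v k => IsLocalRing.residue R (v k)
  have hϖ0 : IsLocalRing.residue R ϖ = 0 := by
    rw [IsLocalRing.residue_eq_zero_iff]
    exact hϖ.not_isUnit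
  have htop : Submodule.span (IsLocalRing.ResidueField R) {r v0, r v2} = ⊤ := by
    rw [eq_top_iff]
    rintro y -
    choose w hw using fun k => IsLocalRing.residue_surjective (y k)
    obtain ⟨a, b, u, h⟩ := H w
    refine Submodule.mem_span_pair.2
      ⟨IsLocalRing.residue R a, IsLocalRing.residue R b, ?_⟩
    ext k
    rw [← hw k, h]
    simp [r, hϖ0]
  have h1 := finrank_span_le_card (R := IsLocalRing.ResidueField R) {r v0, r v2}
  rw [htop, finrank_top, Module.finrank_fin_fun] at h1
  have h2 : ({r v0, r v2} : Set _).toFinset.card ≤ 2 := by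
    rw [Set.toFinset_insert, Set.toFinset_singleton]
    exact Finset.card_le_two
  omega

/-- A module strictly between `ϖR³` and `R³` is part of a flag. -/
theorem exists_GL_of_submodule {ϖ : R} (hϖ : Irreducible ϖ) {C : Submodule R (Fin 3 → R)}
    (hC : ∀ v, ϖ • v ∈ C) (hC' : ∃ v ∈ C, ∀ w, v ≠ ϖ • w) (hCt : C < ⊤) :
    ∃ P : GL (Fin 3) R, (∀ w, P.1.mulVec w ∈ C ↔ ϖ ∣ w 2) ∨
      ∀ w, P.1.mulVec w ∈ C ↔ ϖ ∣ w 1 ∧ ϖ ∣ w 2 := by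
  obtain ⟨v0, h0, h0'⟩ := hC'
  let N : Submodule R (Fin 3 → R) := LinearMap.range (ϖ • (LinearMap.id : (Fin 3 → R) →ₗ[R] _))
  have hN : ∀ v, ϖ • v ∈ N := fun v => ⟨v, rfl⟩
  have hNC : N ≤ C := by rintro _ ⟨v, rfl⟩; exact hC v
  let B : Submodule R (Fin 3 → R) := Submodule.span R {v0} ⊔ N
  have hBC : B ≤ C := sup_le ((Submodule.span_singleton_le_iff_mem _ _).2 h0) hNC
  -- `B` is a line modulo $\varpi$. If it is smaller than `C`, then `C` is the upper member of a
  -- flag. Otherwise `C` is itself a line, and adding one more vector gives an upper member, which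
  -- is proper by the dimension count.
  rcases hBC.lt_or_eq with hlt | heq
  · obtain ⟨P, hP, -⟩ := exists_GL_of_flag hϖ (B := B)
      (fun v => Submodule.mem_sup_right (hN v))
      ⟨v0, Submodule.mem_sup_left (Submodule.mem_span_singleton_self _), h0'⟩ hlt hCt
    exact ⟨P, Or.inl hP⟩
  · obtain ⟨v2, -, h2⟩ := SetLike.exists_of_lt hCt
    let A : Submodule R (Fin 3 → R) := C ⊔ Submodule.span R {v2}
    have hCA : C < A := SetLike.lt_iff_le_and_exists.2 ⟨le_sup_left, v2,
      Submodule.mem_sup_right (Submodule.mem_span_singleton_self _), h2⟩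
    have hA : A < ⊤ := by
      rw [lt_top_iff_ne_top]
      intro htop
      obtain ⟨w, hw⟩ := exists_ne_smul_add_smul_add hϖ v0 v2
      have hwA : w ∈ A := htop ▸ Submodule.mem_top
      obtain ⟨c, hc, d, hd, rfl⟩ := Submodule.mem_sup.1 hwA
      rw [← heq] at hc
      obtain ⟨e, he, _, ⟨u, rfl⟩, rfl⟩ := Submodule.mem_sup.1 hc
      obtain ⟨a, rfl⟩ := Submodule.mem_span_singleton.1 he
      obtain ⟨b, rfl⟩ := Submodule.mem_span_singleton.1 hd
      refine hw a b u ?_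
      simp only [LinearMap.smul_apply, LinearMap.id_apply]
      abel
    obtain ⟨P, -, hP⟩ := exists_GL_of_flag hϖ hC ⟨v0, h0, h0'⟩ hCA hA
    exact ⟨P, Or.inr hP⟩

end

/-! ### Normal forms for chains of lattices. -/

section
variable {F : Type*} [Field F] [ValuativeRel F] [TopologicalSpace F] [IsNonarchimedeanLocalField F]

/-- The inclusion of `𝒪³` in `F³`. -/
def coeVec (w : Fin 3 → 𝒪[F]) : Fin 3 → F := fun k => (w k : F)

/-- The matrix in `GL₃(F)` given by a matrix in `GL₃(𝒪)`. -/
noncomputable abbrev integralGL (P : GL (Fin 3) 𝒪[F]) : GL (Fin 3) F :=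
  Matrix.GeneralLinearGroup.map (algebraMap 𝒪[F] F) P

theorem integralGL_mulVec (P : GL (Fin 3) 𝒪[F]) (w : Fin 3 → 𝒪[F]) :
    (integralGL P).1.mulVec (coeVec w) = coeVec (P.1.mulVec w) := by
  ext k
  simp only [Matrix.mulVec, dotProduct, coeVec, Fin.sum_univ_three]
  rfl

theorem latticeOf_one : latticeOf (1 : GL (Fin 3) F) = Set.range coeVec := by
  simp [latticeOf]
  rfl

/-- Here $\sigma w=(w_1,w_2,\pi w_0)$, so $\sigma\mathcal O^3$ is cut out by a divisibility of the
last coordinate. This is the form in which `exists_GL_of_flag` describes the upper member of a flag;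
the next lemma treats the lower one. -/
theorem latticeOf_integralGL_sigma {ϖ : 𝒪[F]} (hϖ : Irreducible ϖ) (P : GL (Fin 3) 𝒪[F]) :
    latticeOf (integralGL P * sigmaGL hϖ) = {v | ∃ w, ϖ ∣ w 2 ∧ coeVec (P.1.mulVec w) = v} := by
  rw [latticeOf_mul]
  ext v
  constructor
  · rintro ⟨_, ⟨w, rfl⟩, rfl⟩
    refine ⟨![w 1, w 2, ϖ * w 0], Dvd.intro _ rfl, ?_⟩
    rw [← integralGL_mulVec]
    congr 1
    ext k
    fin_cases k <;> simp [sigmaGL, Matrix.mulVec, dotProduct, Fin.sum_univ_three, coeVec]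
  · rintro ⟨w, ⟨d, hd⟩, rfl⟩
    refine ⟨coeVec w, ⟨![d, w 0, w 1], ?_⟩, integralGL_mulVec P w⟩
    ext k
    fin_cases k <;> simp [sigmaGL, Matrix.mulVec, dotProduct, Fin.sum_univ_three, coeVec, hd]

theorem latticeOf_integralGL_sigma_sq {ϖ : 𝒪[F]} (hϖ : Irreducible ϖ) (P : GL (Fin 3) 𝒪[F]) :
    latticeOf (integralGL P * sigmaGL hϖ ^ 2)
      = {v | ∃ w, (ϖ ∣ w 1 ∧ ϖ ∣ w 2) ∧ coeVec (P.1.mulVec w) = v} := by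
  have hs : (sigmaGL hϖ ^ 2).1 = !![0, 0, 1; (ϖ : F), 0, 0; 0, (ϖ : F), 0] := by
    rw [pow_two]
    ext i j
    fin_cases i <;> fin_cases j <;>
      simp [sigmaGL, Matrix.mul_apply, Fin.sum_univ_three]
  rw [latticeOf_mul]
  ext v
  constructor
  · rintro ⟨_, ⟨w, rfl⟩, rfl⟩
    refine ⟨![w 2, ϖ * w 0, ϖ * w 1], ⟨Dvd.intro _ rfl, Dvd.intro _ rfl⟩, ?_⟩
    rw [← integralGL_mulVec]
    congr 1
    rw [hs]
    ext k
    fin_cases k <;> simp [Matrix.mulVec, dotProduct, Fin.sum_univ_three, coeVec]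
  · rintro ⟨w, ⟨⟨d, hd⟩, ⟨e, he⟩⟩, rfl⟩
    refine ⟨coeVec w, ⟨![d, e, w 0], ?_⟩, integralGL_mulVec P w⟩
    beta_reduce
    rw [hs]
    ext k
    fin_cases k <;> simp [Matrix.mulVec, dotProduct, Fin.sum_univ_three, coeVec, hd, he]

/-- The intersection of a lattice with `𝒪³`. -/
noncomputable def integralLattice (g : GL (Fin 3) F) : Submodule 𝒪[F] (Fin 3 → 𝒪[F]) where
  carrier := {w | coeVec w ∈ latticeOf g}
  add_mem' := by
    rintro a b ⟨x, hx⟩ ⟨y, hy⟩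
    refine ⟨x + y, ?_⟩
    have : coeVec (a + b) = coeVec a + coeVec b := by ext; simp [coeVec]
    beta_reduce at hx hy
    rw [this, ← hx, ← hy, ← Matrix.mulVec_add]
    congr 1
  zero_mem' := ⟨0, by ext; simp [Matrix.mulVec, dotProduct, coeVec]⟩
  smul_mem' := by
    rintro c a ⟨x, hx⟩
    refine ⟨c • x, ?_⟩
    have : coeVec (c • a) = (c : F) • coeVec a := by ext; simp [coeVec]
    beta_reduce at hx
    rw [this, ← hx, ← Matrix.mulVec_smul]
    congr 1

theorem mem_integralLattice {g : GL (Fin 3) F} {w : Fin 3 → 𝒪[F]} :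
    w ∈ integralLattice g ↔ coeVec w ∈ latticeOf g := Iff.rfl

theorem latticeOf_eq_image {g : GL (Fin 3) F} (hg : latticeOf g ⊆ latticeOf 1) :
    latticeOf g = coeVec '' {w | w ∈ integralLattice g} := by
  rw [latticeOf_one] at hg
  ext v
  constructor
  · intro h
    obtain ⟨w, rfl⟩ := hg h
    exact ⟨w, h, rfl⟩
  · rintro ⟨w, h, rfl⟩
    exact h

theorem latticeOf_eq_of_iff {g : GL (Fin 3) F} (hg : latticeOf g ⊆ latticeOf 1)
    {P : GL (Fin 3) 𝒪[F]} {p : (Fin 3 → 𝒪[F]) → Prop}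
    (h : ∀ w, P.1.mulVec w ∈ integralLattice g ↔ p w) :
    latticeOf g = {v | ∃ w, p w ∧ coeVec (P.1.mulVec w) = v} := by
  rw [latticeOf_eq_image hg]
  ext v
  constructor
  · rintro ⟨w, hw, rfl⟩
    have hPw : P.1.mulVec ((P⁻¹).1.mulVec w) = w := by
      rw [Matrix.mulVec_mulVec, ← Units.val_mul, mul_inv_cancel, Units.val_one, Matrix.one_mulVec]
    exact ⟨(P⁻¹).1.mulVec w, (h _).1 (hPw.symm ▸ hw), by rw [hPw]⟩
  · rintro ⟨w, hw, rfl⟩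
    exact ⟨_, (h w).2 hw, rfl⟩

theorem integralLattice_lt_top {g : GL (Fin 3) F} (hg : latticeOf g ⊂ latticeOf 1) :
    integralLattice g < ⊤ := by
  rw [lt_top_iff_ne_top]
  intro h
  refine hg.2 ?_
  rw [latticeOf_one]
  rintro _ ⟨w, rfl⟩
  exact mem_integralLattice.1 (h ▸ Submodule.mem_top)

/-- This translates the strict inclusion of lattices in $F^3$ into the hypotheses of the flag lemmas
on submodules of $\mathcal O^3$. -/
theorem smul_latticeOf_one_ssubset {ϖ : 𝒪[F]} {g : GL (Fin 3) F}
    (h : (ϖ : F) • latticeOf (1 : GL (Fin 3) F) ⊂ latticeOf g) (hg : latticeOf g ⊆ latticeOf 1) :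
    (∀ v, ϖ • v ∈ integralLattice g) ∧ ∃ v ∈ integralLattice g, ∀ w, v ≠ ϖ • w := by
  rw [latticeOf_one] at h hg
  have hs : ∀ w : Fin 3 → 𝒪[F], coeVec (ϖ • w) = (ϖ : F) • coeVec w := fun w => by
    ext; simp [coeVec]
  refine ⟨fun v => ?_, ?_⟩
  · rw [mem_integralLattice, hs]
    exact h.1 (Set.smul_mem_smul_set ⟨v, rfl⟩)
  · obtain ⟨x, hx, hx'⟩ := Set.exists_of_ssubset h
    obtain ⟨v, rfl⟩ := hg hx
    refine ⟨v, hx, ?_⟩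
    rintro w rfl
    exact hx' (hs w ▸ Set.smul_mem_smul_set ⟨w, rfl⟩)

theorem vertexOf_mul_integralGL (P : GL (Fin 3) 𝒪[F]) (g : GL (Fin 3) F) :
    (vertexOf (g * integralGL P) : Vertex F) = vertexOf g := by
  refine QuotientGroup.eq.2 (mem_K_iff.2 ⟨P⁻¹, ?_⟩)
  rw [← map_inv, ← map_mul, map_inv]
  congr 1
  group

theorem latticeOf_mul_ssubset_iff (g h k : GL (Fin 3) F) :
    latticeOf (g * h) ⊂ latticeOf (g * k) ↔ latticeOf h ⊂ latticeOf k := by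
  rw [latticeOf_mul, latticeOf_mul]
  exact ((mulVec_injective g).injOn (s := Set.univ)).image_ssubset_image_iff
    (Set.subset_univ _) (Set.subset_univ _)

theorem smul_latticeOf_mul {ϖ : 𝒪[F]} (g h k : GL (Fin 3) F) :
    (ϖ : F) • latticeOf (g * h) ⊂ latticeOf (g * k) ↔ (ϖ : F) • latticeOf h ⊂ latticeOf k := by
  have : (ϖ : F) • latticeOf (g * h) = (fun v => g.1.mulVec v) '' ((ϖ : F) • latticeOf h) := by
    rw [latticeOf_mul]
    ext v
    simp [Set.mem_smul_set, Matrix.mulVec_smul]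
  rw [this, latticeOf_mul g k]
  exact ((mulVec_injective g).injOn (s := Set.univ)).image_ssubset_image_iff
    (Set.subset_univ _) (Set.subset_univ _)

/-- A chain of two lattices is, up to the action of `G`, one of the two standard ones. -/
theorem exists_sigma_of_chain_two {ϖ : 𝒪[F]} (hϖ : Irreducible ϖ) {a b : GL (Fin 3) F}
    (hba : latticeOf b ⊂ latticeOf a) (hab : (ϖ : F) • latticeOf a ⊂ latticeOf b) :
    ∃ g : PGL(3, F), (vertexOf a : Vertex F) = (g : PGL(3, F)) ∧
      ((vertexOf b : Vertex F) = ((g * sigma hϖ : PGL(3, F)) : Vertex F) ∨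
      (vertexOf b : Vertex F) = ((g * sigma hϖ ^ 2 : PGL(3, F)) : Vertex F)) := by
  -- Translating by `a⁻¹` makes the larger lattice $\mathcal O^3$. The base change `P` found below
  -- lies in $\mathrm{GL}_3(\mathcal O)$, so it preserves this lattice while putting the smaller one
  -- in standard position.
  obtain ⟨c, rfl⟩ : ∃ c, b = a * c := ⟨a⁻¹ * b, by group⟩
  rw [← mul_one a, mul_assoc, one_mul, latticeOf_mul_ssubset_iff] at hba
  rw [← mul_one a, mul_assoc, one_mul, smul_latticeOf_mul] at hab
  obtain ⟨h1, h2⟩ := smul_latticeOf_one_ssubset hab hba.1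
  obtain ⟨P, hP⟩ := exists_GL_of_submodule hϖ h1 h2 (integralLattice_lt_top hba)
  refine ⟨Matrix.ProjGenLinGroup.mk (a * integralGL P), (vertexOf_mul_integralGL P a).symm, ?_⟩
  refine hP.imp (fun hP => ?_) (fun hP => ?_)
  · have := latticeOf_eq_of_iff hba.1 hP
    rw [← latticeOf_integralGL_sigma hϖ] at this
    rw [← smul_vertexOf, vertexOf_eq_of_latticeOf_eq this, smul_vertexOf, ← mul_assoc]
    simp only [vertexOf, sigma, map_mul]
  · have := latticeOf_eq_of_iff hba.1 hP
    rw [← latticeOf_integralGL_sigma_sq hϖ] at this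
    rw [← smul_vertexOf, vertexOf_eq_of_latticeOf_eq this, smul_vertexOf, ← mul_assoc]
    simp only [vertexOf, sigma, map_mul, map_pow]

/-- A chain of three lattices is, up to the action of `G`, the standard one. -/
theorem exists_sigma_of_chain_three {ϖ : 𝒪[F]} (hϖ : Irreducible ϖ) {a b c : GL (Fin 3) F}
    (hba : latticeOf b ⊂ latticeOf a) (hcb : latticeOf c ⊂ latticeOf b)
    (hac : (ϖ : F) • latticeOf a ⊂ latticeOf c) :
    ∃ g : PGL(3, F), (vertexOf a : Vertex F) = (g : PGL(3, F)) ∧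
      (vertexOf b : Vertex F) = ((g * sigma hϖ : PGL(3, F)) : Vertex F) ∧
      (vertexOf c : Vertex F) = ((g * sigma hϖ ^ 2 : PGL(3, F)) : Vertex F) := by
  obtain ⟨b, rfl⟩ : ∃ d, b = a * d := ⟨a⁻¹ * b, by group⟩
  obtain ⟨c, rfl⟩ : ∃ d, c = a * d := ⟨a⁻¹ * c, by group⟩
  rw [latticeOf_mul_ssubset_iff] at hcb
  rw [← mul_one a, mul_assoc, one_mul, latticeOf_mul_ssubset_iff] at hba
  rw [← mul_one a, mul_assoc, one_mul, smul_latticeOf_mul] at hac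
  obtain ⟨h1, h2⟩ := smul_latticeOf_one_ssubset hac (hcb.trans hba).1
  have hlt : integralLattice c < integralLattice b := by
    refine SetLike.lt_iff_le_and_exists.2 ⟨fun w hw => hcb.1 hw, ?_⟩
    obtain ⟨x, hx, hx'⟩ := Set.exists_of_ssubset hcb
    have hx1 := hba.1 hx
    rw [latticeOf_one] at hx1
    obtain ⟨w, rfl⟩ := hx1
    exact ⟨w, hx, hx'⟩
  obtain ⟨P, hPb, hPc⟩ := exists_GL_of_flag hϖ h1 h2 hlt (integralLattice_lt_top hba)
  refine ⟨Matrix.ProjGenLinGroup.mk (a * integralGL P), (vertexOf_mul_integralGL P a).symm, ?_, ?_⟩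
  · have := latticeOf_eq_of_iff hba.1 hPb
    rw [← latticeOf_integralGL_sigma hϖ] at this
    rw [← smul_vertexOf, vertexOf_eq_of_latticeOf_eq this, smul_vertexOf, ← mul_assoc]
    simp only [vertexOf, sigma, map_mul]
  · have := latticeOf_eq_of_iff (hcb.trans hba).1 hPc
    rw [← latticeOf_integralGL_sigma_sq hϖ] at this
    rw [← smul_vertexOf, vertexOf_eq_of_latticeOf_eq this, smul_vertexOf, ← mul_assoc]
    simp only [vertexOf, sigma, map_mul, map_pow]

end

/-! ### Standard vertices, orientation and stabilizers of the fundamental cells. -/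

section
variable {F : Type*} [Field F] [ValuativeRel F] [TopologicalSpace F] [IsNonarchimedeanLocalField F]
variable {ϖ : 𝒪[F]} (hϖ : Irreducible ϖ)

/-- The vertex `σʲv₀`. -/
noncomputable def stdVertex (j : ℕ) : Vertex F := ((sigma hϖ ^ j : PGL(3, F)) : Vertex F)

theorem smul_stdVertex (g : PGL(3, F)) (j : ℕ) :
    g • stdVertex hϖ j = ((g * sigma hϖ ^ j : PGL(3, F)) : Vertex F) := rfl

theorem sigma_pow_smul_stdVertex (n j : ℕ) :
    sigma hϖ ^ n • stdVertex hϖ j = stdVertex hϖ (n + j) := by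
  rw [smul_stdVertex, ← pow_add]
  rfl

theorem stdVertex_mod (n : ℕ) : stdVertex hϖ (n % 3) = stdVertex hϖ n := by
  rw [stdVertex, sigma_pow_mod]
  rfl

theorem stdVertex_eq_of_mod_eq {m n : ℕ} (h : m % 3 = n % 3) :
    stdVertex hϖ m = stdVertex hϖ n := by
  rw [← stdVertex_mod hϖ m, h, stdVertex_mod]

theorem orderOf_typeHom_sigma : orderOf (typeHom F (sigma hϖ)) = 3 :=
  orderOf_eq_prime (TypeGroup.pow_three _) (typeHom_sigma_ne_one hϖ)

/-- The action of `G` preserves the differences of the types of vertices. -/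
theorem type_eq {g h : PGL(3, F)} {a a' b b' : ℕ}
    (h1 : g • stdVertex hϖ a = h • stdVertex hϖ b)
    (h2 : g • stdVertex hϖ a' = h • stdVertex hϖ b') : (a + b') % 3 = (a' + b) % 3 := by
  have key : ∀ {a b : ℕ}, g • stdVertex hϖ a = h • stdVertex hϖ b →
      typeHom F g * typeHom F (sigma hϖ) ^ a = typeHom F h * typeHom F (sigma hϖ) ^ b := by
    intro a b hab
    have := typeHom_mul_eq (g := g) (a := sigma hϖ ^ a) (b := h * sigma hϖ ^ b) hab
    rwa [map_mul, map_pow, map_pow] at this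
  have e1 := key h1
  have e2 := key h2
  have e3 : typeHom F (sigma hϖ) ^ (a + b') = typeHom F (sigma hϖ) ^ (a' + b) := by
    set s := typeHom F (sigma hϖ)
    have : typeHom F g * (typeHom F h * s ^ (a + b')) = typeHom F g * (typeHom F h * s ^ (a' + b)) := by
      calc _ = (typeHom F g * s ^ a) * (typeHom F h * s ^ b') := by
            rw [pow_add, mul_mul_mul_comm, ← mul_assoc]
        _ = (typeHom F g * s ^ a') * (typeHom F h * s ^ b) := by rw [e1, e2, mul_comm]
        _ = _ := by rw [pow_add, mul_mul_mul_comm, mul_assoc]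
    exact mul_left_cancel (mul_left_cancel this)
  rw [pow_inj_mod, orderOf_typeHom_sigma] at e3
  exact e3

theorem stdVertex_injective {m n : ℕ} (h : stdVertex hϖ m = stdVertex hϖ n) : m % 3 = n % 3 := by
  have := type_eq hϖ (g := 1) (h := 1) (a := 0) (b := 0) rfl (by simpa using h)
  omega

/-- Preservation of type differences gives $\tau(j)\equiv j+\tau(0)$ modulo 3. For $i\le1$ this
leaves only the identity, because a swap of two vertices would need $0\equiv2$; for $i=2$ it leaves
the rotations of a triangle, which are even. -/
theorem sign_eq_one_of_smul {i : ℕ} (hi : i ≤ 2) {g h : PGL(3, F)} {τ : Equiv.Perm (Fin (i + 1))}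
    (H : ∀ j : Fin (i + 1), g • stdVertex hϖ j = h • stdVertex hϖ (τ j : ℕ)) :
    Equiv.Perm.sign τ = 1 := by
  have key : ∀ j : Fin (i + 1), ((0 : Fin (i + 1)) + (τ j : ℕ)) % 3 = (j + (τ 0 : ℕ)) % 3 :=
    fun j => type_eq hϖ (H 0) (H j)
  clear H
  interval_cases i
  all_goals
    revert τ
    decide

theorem exists_perm_of_isCell {i : ℕ} (hi : i ≤ 2) {x : Fin (i + 1) → Vertex F}
    (hx : IsCell ϖ x) : ∃ (g : PGL(3, F)) (τ : Equiv.Perm (Fin (i + 1))),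
      ∀ j, x j = g • stdVertex hϖ (τ j : ℕ) := by
  obtain ⟨a, ha, hne, hle⟩ := hx
  interval_cases i
  · refine ⟨Matrix.ProjGenLinGroup.mk (a 0), 1, fun j => ?_⟩
    obtain rfl := Fin.fin_one_eq_zero j
    rw [← ha, smul_stdVertex]
    simp [vertexOf]
  · have key : ∀ k l : Fin 2, latticeOf (a l) ⊂ latticeOf (a k) →
        ∃ g : PGL(3, F), ((vertexOf (a k) : Vertex F) = g • stdVertex hϖ 0 ∧
            (vertexOf (a l) : Vertex F) = g • stdVertex hϖ 1) ∨
          ((vertexOf (a l) : Vertex F) = g • stdVertex hϖ 0 ∧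
            (vertexOf (a k) : Vertex F) = g • stdVertex hϖ 1) := by
      intro k l h
      obtain ⟨g, h1, h2⟩ := exists_sigma_of_chain_two hϖ h (hle k l)
      rcases h2 with h2 | h2
      · exact ⟨g, Or.inl ⟨by rw [h1, smul_stdVertex]; simp, by rw [h2, smul_stdVertex]; simp⟩⟩
      -- Since $\sigma^3=1$, the vertex $gv_0$ equals $g\sigma^2\cdot\sigma v_0$, so the edge is
      -- $g\sigma^2e_0$ with its vertices exchanged.
      · exact ⟨g * sigma hϖ ^ 2, Or.inr ⟨by rw [h2, smul_stdVertex]; simp,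
          by rw [h1, smul_stdVertex, mul_assoc, ← pow_add, sigma_pow_three, mul_one]⟩⟩
    obtain ⟨g, hg⟩ : ∃ g : PGL(3, F), ((vertexOf (a 0) : Vertex F) = g • stdVertex hϖ 0 ∧
            (vertexOf (a 1) : Vertex F) = g • stdVertex hϖ 1) ∨
          ((vertexOf (a 1) : Vertex F) = g • stdVertex hϖ 0 ∧
            (vertexOf (a 0) : Vertex F) = g • stdVertex hϖ 1) := by
      rcases hne 0 1 (by decide) with h | h
      · obtain ⟨g, hg⟩ := key 1 0 h
        exact ⟨g, hg.symm⟩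
      · exact key 0 1 h
    rcases hg with ⟨h0, h1⟩ | ⟨h1, h0⟩
    · refine ⟨g, 1, fun j => ?_⟩
      rw [← ha]
      fin_cases j
      · exact h0
      · exact h1
    · refine ⟨g, Equiv.swap 0 1, fun j => ?_⟩
      rw [← ha]
      fin_cases j
      · exact h0
      · exact h1
  · have key : ∀ (k l m : Fin 3) (ρ : Equiv.Perm (Fin 3)), (ρ 0 = k ∧ ρ 1 = l ∧ ρ 2 = m) →
        latticeOf (a l) ⊂ latticeOf (a k) → latticeOf (a m) ⊂ latticeOf (a l) →
        ∃ (g : PGL(3, F)) (τ : Equiv.Perm (Fin 3)),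
          ∀ j, x j = g • stdVertex hϖ (τ j : ℕ) := by
      rintro _ _ _ ρ ⟨rfl, rfl, rfl⟩ h1 h2
      obtain ⟨g, e0, e1, e2⟩ := exists_sigma_of_chain_three hϖ h1 h2 (hle (ρ 0) (ρ 2))
      -- `ρ` lists the indices from the largest lattice to the smallest, so its inverse gives the
      -- position of a vertex in the chain.
      refine ⟨g, ρ.symm, fun j => ?_⟩
      obtain ⟨k, rfl⟩ := ρ.surjective j
      rw [← ha, Equiv.symm_apply_apply, smul_stdVertex]
      fin_cases k
      · simpa using e0
      · simpa using e1
      · exact e2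
    rcases hne 0 1 (by decide) with h01 | h01 <;> rcases hne 1 2 (by decide) with h12 | h12
    · exact key 2 1 0 (Equiv.swap 0 2) (by decide) h12 h01
    · rcases hne 0 2 (by decide) with h02 | h02
      · exact key 1 2 0 (finRotate 3) (by decide) h12 h02
      · exact key 1 0 2 (Equiv.swap 0 1) (by decide) h01 h02
    · rcases hne 0 2 (by decide) with h02 | h02
      · exact key 2 0 1 (finRotate 3).symm (by decide) h02 h01
      · exact key 0 2 1 (Equiv.swap 1 2) (by decide) h02 h12
    · exact key 0 1 2 1 (by decide) h01 h12

theorem mem_K_iff_smul {h : PGL(3, F)} : h ∈ K F ↔ h • stdVertex hϖ 0 = stdVertex hϖ 0 := by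
  rw [smul_stdVertex, pow_zero, mul_one, stdVertex, pow_zero, eq_comm, QuotientGroup.eq, inv_one,
    one_mul]

theorem mem_conj_sigma_iff {h : PGL(3, F)} (n : ℕ) :
    h ∈ (K F).map (MulAut.conj (sigma hϖ ^ n)).toMonoidHom ↔
      h • stdVertex hϖ n = stdVertex hϖ n := by
  rw [smul_stdVertex, stdVertex, eq_comm, QuotientGroup.eq, Subgroup.mem_map]
  constructor
  · rintro ⟨k, hk, rfl⟩
    convert hk using 1
    simp only [MulEquiv.coe_toMonoidHom, MulAut.conj_apply]
    group
  · intro hk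
    refine ⟨_, hk, ?_⟩
    simp only [MulEquiv.coe_toMonoidHom, MulAut.conj_apply]
    group

theorem mem_E_iff {h : PGL(3, F)} :
    h ∈ E hϖ ↔ h • stdVertex hϖ 0 = stdVertex hϖ 0 ∧ h • stdVertex hϖ 1 = stdVertex hϖ 1 := by
  rw [← mem_K_iff_smul, ← mem_conj_sigma_iff, pow_one]
  rfl

theorem mem_Iwahori_iff {h : PGL(3, F)} :
    h ∈ Iwahori hϖ ↔ h • stdVertex hϖ 0 = stdVertex hϖ 0 ∧ h • stdVertex hϖ 1 = stdVertex hϖ 1 ∧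
      h • stdVertex hϖ 2 = stdVertex hϖ 2 := by
  rw [← and_assoc, ← mem_E_iff, ← mem_conj_sigma_iff]
  rfl

/-- `H` is the stabilizer of the cell with vertices `v₀, …, σⁱv₀`. -/
def IsCellStabilizer (i : ℕ) (H : Subgroup PGL(3, F)) : Prop :=
  ∀ h, h ∈ H ↔ ∃ τ : Equiv.Perm (Fin (i + 1)), ∀ j : Fin (i + 1),
    h • stdVertex hϖ j = stdVertex hϖ (τ j : ℕ)

theorem isCellStabilizer_K : IsCellStabilizer hϖ 0 (K F) := by
  intro h
  rw [mem_K_iff_smul hϖ]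
  constructor
  · refine fun H => ⟨1, fun j => ?_⟩
    obtain rfl := Fin.fin_one_eq_zero j
    exact H
  · rintro ⟨τ, H⟩
    simpa using H 0

/-- No element of $G$ reverses $e_0$, by types, so the stabilizer of the edge as a set fixes both
ends. This lets $K$, $E$ and $T$ be treated uniformly. -/
theorem isCellStabilizer_E : IsCellStabilizer hϖ 1 (E hϖ) := by
  intro h
  rw [mem_E_iff hϖ]
  constructor
  · refine fun H => ⟨1, fun j => ?_⟩
    fin_cases j
    · exact H.1
    · exact H.2
  · rintro ⟨τ, H⟩
    have hs := sign_eq_one_of_smul hϖ (i := 1) (by norm_num) (h := 1) fun j => by simpa using H j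
    have : τ = 1 := by
      clear H
      revert τ
      decide
    subst this
    exact ⟨H 0, H 1⟩

theorem isCellStabilizer_T : IsCellStabilizer hϖ 2 (T hϖ) := by
  intro h
  have hS : ({((1 : PGL(3, F)) : Vertex F), ((sigma hϖ : PGL(3, F)) : Vertex F),
      ((sigma hϖ ^ 2 : PGL(3, F)) : Vertex F)} : Set (Vertex F))
      = Set.range fun j : Fin 3 => stdVertex hϖ j := by
    ext x
    simp only [Set.mem_insert_iff, Set.mem_singleton_iff, Set.mem_range, stdVertex,
      Fin.exists_fin_succ]
    simp [eq_comm]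
  rw [T, MulAction.mem_stabilizer_iff, hS]
  constructor
  · intro H
    have h1 : ∀ j : Fin 3, ∃ k : Fin 3, stdVertex hϖ k = h • stdVertex hϖ j := fun j => by
      have : h • stdVertex hϖ j ∈ h • Set.range fun j : Fin 3 => stdVertex hϖ j :=
        Set.smul_mem_smul_set ⟨j, rfl⟩
      rwa [H] at this
    choose e he using h1
    have hinj : Function.Injective e := fun j k hjk => by
      have h2 : h • stdVertex hϖ j = h • stdVertex hϖ k := by rw [← he, ← he, hjk]
      have h3 := stdVertex_injective hϖ (smul_left_cancel _ h2)
      rw [Nat.mod_eq_of_lt j.2, Nat.mod_eq_of_lt k.2] at h3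
      exact Fin.ext h3
    exact ⟨Equiv.ofBijective e (Finite.injective_iff_bijective.1 hinj), fun j => (he j).symm⟩
  · rintro ⟨τ, H⟩
    rw [Set.smul_set_range]
    have : (fun j : Fin 3 => h • stdVertex hϖ j) = (fun j : Fin 3 => stdVertex hϖ j) ∘ τ :=
      funext H
    rw [this, τ.surjective.range_comp]

variable {Γ : Subgroup PGL(3, F)}

theorem cosetToCell_perm_eq_iff {i : ℕ} (hi : i ≤ 2) {g g' : PGL(3, F)}
    {τ : Equiv.Perm (Fin (i + 1))} :
    (cosetToCell hϖ Γ hi (Quotient.mk _ g)).perm τ = cosetToCell hϖ Γ hi (Quotient.mk _ g') ↔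
      ∃ γ ∈ Γ, ∀ j : Fin (i + 1),
        g' • stdVertex hϖ j = (γ * g) • stdVertex hϖ (τ j : ℕ) := by
  refine Quotient.eq.trans ?_
  simp only [mul_smul]
  rfl

theorem exists_eq_cosetToCell_perm {i : ℕ} (hi : i ≤ 2) (y : Cell ϖ Γ i) :
    ∃ (g : PGL(3, F)) (τ : Equiv.Perm (Fin (i + 1))),
      y = (cosetToCell hϖ Γ hi (Quotient.mk _ g)).perm τ := by
  induction y using Quotient.inductionOn with
  | h y =>
    obtain ⟨g, τ, h⟩ := exists_perm_of_isCell hϖ hi y.2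
    exact ⟨g, τ, Quotient.sound ⟨1, Γ.one_mem, fun j => by rw [one_smul, h]; rfl⟩⟩

theorem perm_perm {i : ℕ} (y : Cell ϖ Γ i) (τ ρ : Equiv.Perm (Fin (i + 1))) :
    (y.perm τ).perm ρ = y.perm (τ * ρ) := by
  simp only [Cell.perm, Cell.comp_comp]
  rfl

theorem perm_one {i : ℕ} (y : Cell ϖ Γ i) : y.perm 1 = y := y.comp_refl

end

/-! ### Compact open stabilizers and finiteness of the quotient complex. -/

section
variable {F : Type*} [Field F] [ValuativeRel F] [TopologicalSpace F] [IsNonarchimedeanLocalField F]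
variable {ϖ : 𝒪[F]} (hϖ : Irreducible ϖ)

instance : DiscreteTopology (Vertex F) := QuotientGroup.discreteTopology (isOpen_K F)

theorem continuous_smul_stdVertex (j : ℕ) :
    Continuous fun g : PGL(3, F) => g • stdVertex hϖ j := by
  simp only [smul_stdVertex]
  exact QuotientGroup.continuous_mk.comp (continuous_mul_const _)

theorem isCompact_smul_stdVertex_eq (j : ℕ) (x : Vertex F) :
    IsCompact {g : PGL(3, F) | g • stdVertex hϖ j = x} := by
  obtain ⟨h, rfl⟩ := QuotientGroup.mk_surjective x
  convert (isCompact_K F).image (f := fun k => h * k * (sigma hϖ ^ j)⁻¹) (by fun_prop) using 1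
  ext g
  simp only [Set.mem_ofPred_eq, Set.mem_image, smul_stdVertex]
  rw [eq_comm, QuotientGroup.eq]
  constructor
  · intro hg
    exact ⟨_, hg, by group⟩
  · rintro ⟨k, hk, rfl⟩
    convert hk using 1
    group
    rfl

theorem isCompact_setOf_vertex_mem {S : Set (Vertex F)} (hS : S.Finite) :
    IsCompact {g : PGL(3, F) | (g : Vertex F) ∈ S} := by
  have : {g : PGL(3, F) | (g : Vertex F) ∈ S}
      = ⋃ x ∈ S, {g : PGL(3, F) | (g : Vertex F) = x} := by ext; simp
  rw [this]
  refine hS.isCompact_biUnion fun x _ => ?_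
  obtain ⟨h, rfl⟩ := QuotientGroup.mk_surjective x
  convert (isCompact_K F).image (f := fun k => h * k) (by fun_prop) using 1
  ext g
  simp only [Set.mem_ofPred_eq, Set.mem_image]
  rw [eq_comm, QuotientGroup.eq]
  exact ⟨fun hg => ⟨_, hg, by group⟩, by rintro ⟨k, hk, rfl⟩; simpa using hk⟩

theorem IsCellStabilizer.isOpen {hϖ : Irreducible ϖ} {i : ℕ} {H : Subgroup PGL(3, F)}
    (hH : IsCellStabilizer hϖ i H) : IsOpen (H : Set PGL(3, F)) := by
  have : (H : Set PGL(3, F)) = ⋃ τ : Equiv.Perm (Fin (i + 1)), ⋂ j : Fin (i + 1),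
      (fun g : PGL(3, F) => g • stdVertex hϖ j) ⁻¹' {stdVertex hϖ (τ j : ℕ)} := by
    ext g
    simp [hH g]
  rw [this]
  exact isOpen_iUnion fun τ => isOpen_iInter_of_finite fun j =>
    (isOpen_discrete _).preimage (continuous_smul_stdVertex hϖ j)

theorem IsCellStabilizer.isCompact {hϖ : Irreducible ϖ} {i : ℕ} {H : Subgroup PGL(3, F)}
    (hH : IsCellStabilizer hϖ i H) : IsCompact (H : Set PGL(3, F)) := by
  refine IsCompact.of_isClosed_subset (s := ⋃ τ : Equiv.Perm (Fin (i + 1)),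
    {g : PGL(3, F) | g • stdVertex hϖ 0 = stdVertex hϖ (τ 0 : ℕ)})
    (isCompact_iUnion fun τ => isCompact_smul_stdVertex_eq hϖ _ _)
    (H.isClosed_of_isOpen hH.isOpen) ?_
  intro g hg
  obtain ⟨τ, hτ⟩ := (hH g).1 hg
  exact Set.mem_iUnion.2 ⟨τ, hτ 0⟩

variable (Γ : Subgroup PGL(3, F)) [hΓ : IsTorsionFreeCocompactLattice Γ]

/-- $\Gamma\backslash G/K$ is a continuous image of the compact space $\Gamma\backslash G$, and it
is discrete because $K$ is open. -/
instance : Finite (Quotient (MulAction.orbitRel Γ (Vertex F))) := by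
  have := hΓ.cocompact
  let f : Coset Γ → Quotient (MulAction.orbitRel Γ (Vertex F)) :=
    Quotient.map (fun g => (g : Vertex F)) (by rintro _ b ⟨γ, rfl⟩; exact ⟨γ, rfl⟩)
  have hf : Continuous f := QuotientGroup.continuous_mk.quotient_map' _
  have hs : Function.Surjective f := fun x => by
    induction x using Quotient.inductionOn with
    | h x =>
      obtain ⟨g, rfl⟩ := QuotientGroup.mk_surjective x
      exact ⟨Quotient.mk _ g, rfl⟩
  have : CompactSpace (Quotient (MulAction.orbitRel Γ (Vertex F))) := hs.compactSpace hf
  have : DiscreteTopology (Quotient (MulAction.orbitRel Γ (Vertex F))) := by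
    refine discreteTopology_iff_forall_isOpen.2 fun s => ?_
    exact isOpen_coinduced.2 (isOpen_discrete _)
  exact finite_of_compact_of_discrete

/-- The elements that take a given standard vertex to `v` form a compact set, whose image in the
discrete set of vertices is finite. -/
theorem finite_adjacent (hϖ : Irreducible ϖ) (v : Vertex F) :
    {w : Vertex F | ∃ x : Fin 2 → Vertex F, IsCell ϖ x ∧ x 0 = v ∧ x 1 = w}.Finite := by
  refine Set.Finite.subset (s := ⋃ a : Fin 2, ⋃ b : Fin 2, (fun g : PGL(3, F) =>
    g • stdVertex hϖ b) '' {g : PGL(3, F) | g • stdVertex hϖ a = v}) ?_ ?_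
  · refine Set.finite_iUnion fun a => Set.finite_iUnion fun b => ?_
    exact ((isCompact_smul_stdVertex_eq hϖ a v).image (continuous_smul_stdVertex hϖ b)).finite
      (isDiscrete_iff_discreteTopology.2 inferInstance)
  · rintro w ⟨x, hx, rfl, rfl⟩
    obtain ⟨g, τ, h⟩ := exists_perm_of_isCell hϖ one_le_two hx
    simp only [Set.mem_iUnion]
    exact ⟨τ 0, τ 1, g, (h 0).symm, (h 1).symm⟩

theorem IsCell.smul {i : ℕ} {x : Fin (i + 1) → Vertex F} (hx : IsCell ϖ x) (g : PGL(3, F)) :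
    IsCell ϖ fun j => g • x j := by
  obtain ⟨a, h1, h2, h3⟩ := hx
  obtain ⟨g, rfl⟩ := Matrix.ProjGenLinGroup.mk_surjective g
  refine ⟨fun j => g * a j, fun j => ?_, fun j k hjk => ?_, fun j k => ?_⟩
  · rw [← smul_vertexOf, h1]
  · rw [latticeOf_mul_ssubset_iff, latticeOf_mul_ssubset_iff]
    exact h2 j k hjk
  · rw [smul_latticeOf_mul]
    exact h3 j k

/-- An element of $\Gamma$ moves the first vertex into a finite set of orbit representatives, and
the remaining vertices are neighbours of it. -/
theorem finite_cell (hϖ : Irreducible ϖ) (i : ℕ) : Finite (Cell ϖ Γ i) := by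
  let R : Set (Vertex F) :=
    Set.range (Quotient.out : Quotient (MulAction.orbitRel Γ (Vertex F)) → Vertex F)
  let N : Set (Vertex F) := ⋃ v ∈ R, ({v} ∪
    {w : Vertex F | ∃ x : Fin 2 → Vertex F, IsCell ϖ x ∧ x 0 = v ∧ x 1 = w})
  have hN : N.Finite := (Set.finite_range _).biUnion fun v _ =>
    (Set.finite_singleton v).union (finite_adjacent hϖ v)
  let S : Set (Fin (i + 1) → Vertex F) := {x | ∀ j, x j ∈ N}
  have hS : S.Finite := Set.Finite.pi' fun _ => hN
  let A : Set (BuildingCell ϖ i) := Subtype.val ⁻¹' S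
  have hA : A.Finite := hS.preimage Subtype.val_injective.injOn
  have : Finite A := hA
  refine Finite.of_surjective (fun x : A => (Quotient.mk (cellSetoid ϖ Γ i) x.1)) fun y => ?_
  induction y using Quotient.inductionOn with
  | h y =>
    obtain ⟨γ, hγ⟩ := Quotient.mk_out (s := MulAction.orbitRel Γ (Vertex F)) (y.1 0)
    have hcell : IsCell ϖ fun j => (γ : PGL(3, F)) • y.1 j := y.2.smul _
    refine ⟨⟨⟨_, hcell⟩, fun j => ?_⟩, Quotient.sound
      ⟨(γ : PGL(3, F))⁻¹, Γ.inv_mem γ.2, fun j => (inv_smul_smul _ _).symm⟩⟩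
    have h0 : (γ : PGL(3, F)) • y.1 0 ∈ R := ⟨_, hγ.symm⟩
    refine Set.mem_biUnion h0 ?_
    by_cases hj : j = 0
    · subst hj
      exact Or.inl rfl
    · have hinj : Function.Injective ![0, j] := by
        intro a b hab
        fin_cases a <;> fin_cases b <;> simp_all
      exact Or.inr ⟨_, hcell.comp hinj, rfl, rfl⟩

end

/-! ### Forms as invariant functions, and null sets on $G$ and $\Gamma\backslash G$. -/

section
variable {F : Type*} [Field F] [ValuativeRel F] [TopologicalSpace F] [IsNonarchimedeanLocalField F]

theorem continuous_of_right_invariant {X : Type*} [TopologicalSpace X] {H : Subgroup PGL(3, F)}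
    (hH : IsOpen (H : Set PGL(3, F))) {u : PGL(3, F) → X} (hu : ∀ g, ∀ h ∈ H, u (g * h) = u g) :
    Continuous u := by
  have : DiscreteTopology (PGL(3, F) ⧸ H) := QuotientGroup.discreteTopology hH
  have h : u = (fun s : PGL(3, F) ⧸ H => u s.out) ∘ fun g : PGL(3, F) => (g : PGL(3, F) ⧸ H) := by
    ext g
    obtain ⟨h, hg⟩ := QuotientGroup.mk_out_eq_mul H g
    simp only [Function.comp_apply, hg, hu g h h.2]
  rw [h]
  exact continuous_of_discreteTopology.comp QuotientGroup.continuous_mk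

section combinatorics
variable {ϖ : 𝒪[F]} {hϖ : Irreducible ϖ} {i : ℕ} {H : Subgroup PGL(3, F)}
  {Γ : Subgroup PGL(3, F)}

theorem form_eq_of_forall (hi : i ≤ 2) {f f' : Form ϖ Γ i}
    (h : ∀ g, f.1 (cosetToCell hϖ Γ hi (Quotient.mk _ g))
      = f'.1 (cosetToCell hϖ Γ hi (Quotient.mk _ g))) : f = f' := by
  ext y
  obtain ⟨g, τ, rfl⟩ := exists_eq_cosetToCell_perm hϖ hi y
  rw [f.2 τ, f'.2 τ, h]

/-- An element of $H$ permutes the vertices of $c_i$ evenly, and a skew-symmetric function does not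
change under even reorderings. -/
theorem IsCellStabilizer.form_apply (hH : IsCellStabilizer hϖ i H) (hi : i ≤ 2) (f : Form ϖ Γ i)
    (g : PGL(3, F)) {h : PGL(3, F)} (hh : h ∈ H) :
    f.1 (cosetToCell hϖ Γ hi (Quotient.mk _ (g * h)))
      = f.1 (cosetToCell hϖ Γ hi (Quotient.mk _ g)) := by
  obtain ⟨τ, hτ⟩ := (hH h).1 hh
  have hs : Equiv.Perm.sign τ = 1 :=
    sign_eq_one_of_smul hϖ hi (h := 1) fun j => by simpa using hτ j
  have : (cosetToCell hϖ Γ hi (Quotient.mk _ g)).perm τ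
      = cosetToCell hϖ Γ hi (Quotient.mk _ (g * h)) := by
    rw [cosetToCell_perm_eq_iff]
    exact ⟨1, Γ.one_mem, fun j => by rw [mul_smul, hτ, one_mul]⟩
  rw [← this, f.2 τ, hs]
  simp

/-- The value at the reordering of $gc_i$ by $\tau$ has to be $\mathrm{sgn}(\tau)V(g)$. It is well
defined: two presentations of one cell have reorderings of the same sign, by types, and group
elements that differ by $\Gamma$ on the left and $H$ on the right. -/
theorem IsCellStabilizer.exists_form (hH : IsCellStabilizer hϖ i H) (hi : i ≤ 2)
    {V : PGL(3, F) → ℂ} (hΓ : ∀ γ ∈ Γ, ∀ g, V (γ * g) = V g)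
    (hV : ∀ g, ∀ h ∈ H, V (g * h) = V g) :
    ∃ f : Form ϖ Γ i, ∀ g, f.1 (cosetToCell hϖ Γ hi (Quotient.mk _ g)) = V g := by
  have key : ∀ {g g' : PGL(3, F)} {τ τ' : Equiv.Perm (Fin (i + 1))},
      (cosetToCell hϖ Γ hi (Quotient.mk _ g)).perm τ
        = (cosetToCell hϖ Γ hi (Quotient.mk _ g')).perm τ' →
      ((Equiv.Perm.sign τ : ℤ) : ℂ) * V g = ((Equiv.Perm.sign τ' : ℤ) : ℂ) * V g' := by
    intro g g' τ τ' h
    have h1 := congrArg (fun y => Cell.perm y τ'⁻¹) h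
    simp only [perm_perm, mul_inv_cancel, perm_one] at h1
    obtain ⟨γ, hγ, h2⟩ := (cosetToCell_perm_eq_iff hϖ hi).1 h1
    have hs := sign_eq_one_of_smul hϖ hi h2
    rw [map_mul, Equiv.Perm.sign_inv] at hs
    have hs' : Equiv.Perm.sign τ = Equiv.Perm.sign τ' := by
      rcases Int.units_eq_one_or (Equiv.Perm.sign τ) with h | h <;>
      rcases Int.units_eq_one_or (Equiv.Perm.sign τ') with h' | h' <;> simp_all
    have hmem : (γ * g)⁻¹ * g' ∈ H := (hH _).2 ⟨τ * τ'⁻¹, fun j => by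
      rw [mul_smul, h2, inv_smul_smul]⟩
    rw [hs', ← hΓ γ hγ g, ← hV (γ * g) _ hmem, mul_inv_cancel_left]
  choose G t hGt using exists_eq_cosetToCell_perm (Γ := Γ) hϖ hi
  refine ⟨⟨fun y => ((Equiv.Perm.sign (t y) : ℤ) : ℂ) * V (G y), fun τ y => ?_⟩, fun g => ?_⟩
  · have h := key (g := G (y.perm τ)) (τ := t (y.perm τ)) (g' := G y) (τ' := t y * τ)
      (by rw [← hGt, ← perm_perm, ← hGt])
    beta_reduce
    rw [h, Equiv.Perm.sign_mul]
    push_cast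
    ring
  · have := key (g := G (cosetToCell hϖ Γ hi (Quotient.mk _ g))) (g' := g) (τ' := 1)
      (by rw [← hGt, perm_one])
    simpa using this

end combinatorics

section measure
variable (Γ : Subgroup PGL(3, F)) [hΓ : IsTorsionFreeCocompactLattice Γ]
  (μ : Measure PGL(3, F)) [μ.IsHaarMeasure]

/-- The fundamental domain consists of finitely many cosets of the compact group $K$. -/
instance : IsFiniteMeasure (quotientMeasure Γ μ) := by
  refine ⟨?_⟩
  rw [quotientMeasure, Measure.map_apply measurable_quotient_mk'' MeasurableSet.univ,
    Set.preimage_univ, Measure.restrict_apply_univ]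
  exact (isCompact_setOf_vertex_mem (Set.finite_range _)).measure_lt_top

variable {Γ μ}

/-- The preimage in $G$ of a null set is $\Gamma$-invariant and null on the fundamental domain,
hence null since $\Gamma$ is countable. -/
theorem ae_of_ae_quotientMeasure {p : Coset Γ → Prop} (h : ∀ᵐ x ∂(quotientMeasure Γ μ), p x) :
    ∀ᵐ g ∂μ, p (Quotient.mk _ g) := by
  have := hΓ.discrete
  have : Countable Γ := countable_of_Lindelof_of_discrete
  obtain ⟨A, hA, hAm, hA0⟩ := exists_measurable_superset_of_null h
  have hq : Measurable (Quotient.mk (MulAction.orbitRel Γ PGL(3, F))) := measurable_quotient_mk''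
  rw [quotientMeasure, Measure.map_apply hq hAm, Measure.restrict_apply (hq hAm)] at hA0
  have h0 : μ (Quotient.mk (MulAction.orbitRel Γ PGL(3, F)) ⁻¹' A) = 0 := by
    refine (isFundamentalDomain Γ μ).measure_zero_of_invariant _ (fun γ => ?_) hA0
    ext g
    rw [Set.mem_smul_set_iff_inv_smul_mem]
    simp only [Set.mem_preimage]
    have : (Quotient.mk (MulAction.orbitRel Γ PGL(3, F)) (γ⁻¹ • g)) = Quotient.mk _ g :=
      Quotient.sound ⟨γ⁻¹, rfl⟩
    rw [this]
  exact measure_mono_null (fun g hg => hA hg) h0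

theorem ae_quotientMeasure_of_ae {p : Coset Γ → Prop} (hp : MeasurableSet {x | p x})
    (h : ∀ᵐ g ∂μ, p (Quotient.mk _ g)) : ∀ᵐ x ∂(quotientMeasure Γ μ), p x := by
  have hq : Measurable (Quotient.mk (MulAction.orbitRel Γ PGL(3, F))) := measurable_quotient_mk''
  rw [quotientMeasure, ae_map_iff hq.aemeasurable hp]
  exact ae_restrict_of_ae h

theorem rightMul_mk (x g : PGL(3, F)) :
    rightMul Γ x (Quotient.mk _ g) = Quotient.mk _ (g * x) := rfl

theorem coeFn_regularRep (x : PGL(3, F)) (v : L2 Γ μ) :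
    (regularRep Γ μ x v : L2 Γ μ) =ᵐ[quotientMeasure Γ μ] fun y => v (rightMul Γ x y) :=
  Lp.coeFn_compMeasurePreserving v (measurePreserving_rightMul Γ μ x)

/-- A function which is almost everywhere invariant under right translation by the elements of a
compact open subgroup agrees almost everywhere with a right invariant function. -/
theorem exists_right_invariant {H : Subgroup PGL(3, F)} (hHo : IsOpen (H : Set PGL(3, F)))
    {w : PGL(3, F) → ℂ} (hw : Measurable w) (h : ∀ a ∈ H, ∀ᵐ g ∂μ, w (g * a) = w g) :
    ∃ V : PGL(3, F) → ℂ, (∀ g, ∀ᵐ a ∂(μ.restrict H), w (g * a) = V g) ∧ ∀ᵐ g ∂μ, w g = V g := by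
  have hmeas : MeasurableSet {x : PGL(3, F) × PGL(3, F) | w (x.1 * x.2) = w x.1} :=
    measurableSet_eq_fun (hw.comp measurable_mul) (hw.comp measurable_fst)
  -- The exceptional null set in the hypothesis depends on `a`; Fubini exchanges the quantifiers.
  have h1 : ∀ᵐ g ∂μ, ∀ᵐ a ∂(μ.restrict H), w (g * a) = w g := by
    rw [Measure.ae_ae_comm hmeas]
    exact (ae_restrict_iff' hHo.measurableSet).2 (Filter.Eventually.of_forall h)
  have hpos : μ.restrict H ≠ 0 := by
    rw [Ne, Measure.restrict_eq_zero]
    exact (hHo.measure_pos μ ⟨1, H.one_mem⟩).ne'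
  have hne : (ae (μ.restrict H)).NeBot := ae_neBot.2 hpos
  -- Every coset $gH$, not only almost every one, carries an essential value of `w`: some point `g *
  -- a` of it satisfies `h1`, and translation by `a⁻¹` preserves the measure on $H$. This value is
  -- the invariant function sought.
  have hex : ∀ g, ∃ c, ∀ᵐ a ∂(μ.restrict H), w (g * a) = c := fun g => by
    have h2 : ∀ᵐ a ∂μ, ∀ᵐ b ∂(μ.restrict H), w (g * a * b) = w (g * a) :=
      (measurePreserving_mul_left μ g).quasiMeasurePreserving.ae h1
    obtain ⟨a, ha, haH⟩ :=
      ((ae_restrict_of_ae h2).and (ae_restrict_mem hHo.measurableSet)).exists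
    refine ⟨w (g * a), ?_⟩
    have hmp : MeasurePreserving (fun b => a⁻¹ * b) (μ.restrict H) (μ.restrict H) := by
      have h3 := (measurePreserving_mul_left μ a⁻¹).restrict_preimage_emb
        (measurableEmbedding_mulLeft a⁻¹) H
      have h4 : (fun b => a⁻¹ * b) ⁻¹' (H : Set PGL(3, F)) = H := by
        ext b
        exact H.mul_mem_cancel_left (H.inv_mem haH)
      rwa [h4] at h3
    have h5 := hmp.quasiMeasurePreserving.ae ha
    filter_upwards [h5] with b hb
    rw [← hb]
    congr 1
    group
  choose V hV using hex
  refine ⟨V, hV, ?_⟩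
  filter_upwards [h1] with g hg
  obtain ⟨a, h2, h3⟩ := (hg.and (hV g)).exists
  rw [← h2, h3]

/-- Two conditions that hold almost everywhere on $H$ hold at a common point, since $H$ has positive
measure. The case `a = 1` passes invariance under $\Gamma$ to the essential values; general `a`
gives invariance under $H$. -/
theorem right_invariant_unique {H : Subgroup PGL(3, F)} (hHo : IsOpen (H : Set PGL(3, F)))
    {w : PGL(3, F) → ℂ} {g g' : PGL(3, F)} {c c' : ℂ} (a : PGL(3, F)) (ha : a ∈ H)
    (h : ∀ᵐ b ∂(μ.restrict H), w (g * b) = c) (h' : ∀ᵐ b ∂(μ.restrict H), w (g' * b) = c')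
    (hw : ∀ b, w (g' * b) = w (g * (a * b))) : c' = c := by
  have hpos : μ.restrict H ≠ 0 := by
    rw [Ne, Measure.restrict_eq_zero]
    exact (hHo.measure_pos μ ⟨1, H.one_mem⟩).ne'
  have hne : (ae (μ.restrict H)).NeBot := ae_neBot.2 hpos
  have hmp : MeasurePreserving (fun b => a * b) (μ.restrict H) (μ.restrict H) := by
    have h3 := (measurePreserving_mul_left μ a).restrict_preimage_emb
      (measurableEmbedding_mulLeft a) H
    have h4 : (fun b => a * b) ⁻¹' (H : Set PGL(3, F)) = H := by
      ext b
      exact H.mul_mem_cancel_left ha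
    rwa [h4] at h3
  obtain ⟨b, h1, h2⟩ := ((hmp.quasiMeasurePreserving.ae h).and h').exists
  rw [← h2, ← h1, hw]

end measure

end

/-! ### The identification of forms with fixed vectors, and Hecke operators as sums over cosets. -/

section
variable {F : Type*} [Field F] [ValuativeRel F] [TopologicalSpace F] [IsNonarchimedeanLocalField F]
  {ϖ : 𝒪[F]} {hϖ : Irreducible ϖ} {i : ℕ} {H : Subgroup PGL(3, F)}
  {Γ : Subgroup PGL(3, F)} [hΓ : IsTorsionFreeCocompactLattice Γ]
  {μ : Measure PGL(3, F)} [μ.IsHaarMeasure]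

theorem IsCellStabilizer.measureReal_pos (hH : IsCellStabilizer hϖ i H) : 0 < μ.real H := by
  rw [measureReal_def, ENNReal.toReal_pos_iff]
  exact ⟨hH.isOpen.measure_pos μ ⟨1, H.one_mem⟩, hH.isCompact.measure_lt_top⟩

theorem IsCellStabilizer.sqrt_ne_zero (hH : IsCellStabilizer hϖ i H) :
    (Real.sqrt (μ.real H) : ℂ) ≠ 0 :=
  Complex.ofReal_ne_zero.2 (Real.sqrt_pos.2 hH.measureReal_pos).ne'

theorem IsCellStabilizer.measurable_form (hH : IsCellStabilizer hϖ i H) (hi : i ≤ 2)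
    (f : Form ϖ Γ i) : Measurable fun x => f.1 (cosetToCell hϖ Γ hi x) :=
  measurable_from_quotient.2
    (continuous_of_right_invariant hH.isOpen fun g _ hh => hH.form_apply hi f g hh).measurable

theorem IsCellStabilizer.memLp_form (hH : IsCellStabilizer hϖ i H) (hi : i ≤ 2)
    (f : Form ϖ Γ i) :
    MemLp (fun x => (Real.sqrt (μ.real H) : ℂ)⁻¹ * f.1 (cosetToCell hϖ Γ hi x)) 2
      (quotientMeasure Γ μ) := by
  have := finite_cell Γ hϖ i
  obtain ⟨C, hC⟩ := (Set.finite_range fun y : Cell ϖ Γ i =>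
    ‖(Real.sqrt (μ.real H) : ℂ)⁻¹ * f.1 y‖).bddAbove
  exact MemLp.of_bound ((hH.measurable_form hi f).const_mul _).aestronglyMeasurable C
    (Filter.Eventually.of_forall fun x => hC ⟨_, rfl⟩)

/-- The map from forms to fixed vectors. -/
noncomputable def IsCellStabilizer.toL2 (hH : IsCellStabilizer hϖ i H) (hi : i ≤ 2)
    (Γ : Subgroup PGL(3, F)) [IsTorsionFreeCocompactLattice Γ]
    (μ : Measure PGL(3, F)) [μ.IsHaarMeasure] : Form ϖ Γ i →ₗ[ℂ] L2Fixed Γ μ H :=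
  LinearMap.codRestrict (L2Fixed Γ μ H)
    { toFun := fun f => (hH.memLp_form (μ := μ) hi f).toLp
      map_add' := fun f f' => by
        have h1 := hH.memLp_form (μ := μ) hi f
        have h2 := hH.memLp_form (μ := μ) hi f'
        refine (MemLp.toLp_congr (hH.memLp_form (μ := μ) hi (f + f')) (h1.add h2)
          (Filter.Eventually.of_forall fun x => ?_)).trans (MemLp.toLp_add h1 h2)
        simp [mul_add]
      map_smul' := fun c f => by
        have h1 := hH.memLp_form (μ := μ) hi f
        refine (MemLp.toLp_congr (hH.memLp_form (μ := μ) hi (c • f)) (h1.const_smul c)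
          (Filter.Eventually.of_forall fun x => ?_)).trans (MemLp.toLp_const_smul c h1)
        simp [mul_left_comm] }
    fun f h hh => by
      refine Lp.ext ((coeFn_regularRep h _).trans ?_)
      have h1 := (hH.memLp_form (μ := μ) hi f).coeFn_toLp
      have h2 := (measurePreserving_rightMul Γ μ h).quasiMeasurePreserving.ae h1
      filter_upwards [h1, h2] with x hx1 hx2
      refine hx2.trans (Eq.trans ?_ hx1.symm)
      induction x using Quotient.inductionOn with
      | h g => rw [rightMul_mk, hH.form_apply hi f g hh]

theorem IsCellStabilizer.coeFn_toL2 (hH : IsCellStabilizer hϖ i H) (hi : i ≤ 2)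
    (f : Form ϖ Γ i) : (hH.toL2 hi Γ μ f : L2 Γ μ) =ᵐ[quotientMeasure Γ μ]
      fun x => (Real.sqrt (μ.real H) : ℂ)⁻¹ * f.1 (cosetToCell hϖ Γ hi x) :=
  (hH.memLp_form hi f).coeFn_toLp

/-- The functions $g\mapsto f(gc_i)$ are locally constant, and continuous functions that agree
almost everywhere for Haar measure are equal. -/
theorem IsCellStabilizer.toL2_injective (hH : IsCellStabilizer hϖ i H) (hi : i ≤ 2) :
    Function.Injective (hH.toL2 hi Γ μ) := by
  intro f f' hff
  refine form_eq_of_forall (hϖ := hϖ) hi (congrFun ?_)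
  have hc : ∀ f : Form ϖ Γ i,
      Continuous fun g => f.1 (cosetToCell hϖ Γ hi (Quotient.mk _ g)) := fun f =>
    continuous_of_right_invariant hH.isOpen fun g _ hh => hH.form_apply hi f g hh
  refine (Continuous.ae_eq_iff_eq μ (hc f) (hc f')).1 ?_
  refine ae_of_ae_quotientMeasure (p := fun x => f.1 (cosetToCell hϖ Γ hi x)
    = f'.1 (cosetToCell hϖ Γ hi x)) ?_
  have h1 := hH.coeFn_toL2 (μ := μ) hi f
  rw [hff] at h1
  filter_upwards [h1, hH.coeFn_toL2 (μ := μ) hi f'] with x hx hx'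
  exact mul_left_cancel₀ (inv_ne_zero hH.sqrt_ne_zero) (hx.symm.trans hx')

/-- The pullback of a fixed class to $G$ agrees almost everywhere with a function that is exactly
invariant under $\Gamma$ and $H$, and such a function comes from a form. -/
theorem IsCellStabilizer.toL2_surjective (hH : IsCellStabilizer hϖ i H) (hi : i ≤ 2) :
    Function.Surjective (hH.toL2 hi Γ μ) := by
  rintro ⟨v, hv⟩
  have hvm : Measurable v := (Lp.stronglyMeasurable v).measurable
  let w : PGL(3, F) → ℂ := fun g => v (Quotient.mk _ g)
  have hw : Measurable w := hvm.comp measurable_quotient_mk''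
  have hinv : ∀ a ∈ H, ∀ᵐ g ∂μ, w (g * a) = w g := fun a ha => by
    have h1 := coeFn_regularRep a v
    rw [hv a ha] at h1
    exact ae_of_ae_quotientMeasure (p := fun x => v (rightMul Γ a x) = v x)
      (h1.mono fun x hx => hx.symm)
  obtain ⟨V, hV, hwV⟩ := exists_right_invariant hH.isOpen hw hinv
  have hΓV : ∀ γ ∈ Γ, ∀ g, V (γ * g) = V g := fun γ hγ g =>
    right_invariant_unique hH.isOpen 1 H.one_mem (hV g) (hV (γ * g)) fun b => by
      have : (Quotient.mk (MulAction.orbitRel Γ PGL(3, F)) (γ * g * b)) = Quotient.mk _ (g * b) :=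
        Quotient.sound ⟨⟨γ, hγ⟩, (mul_assoc γ g b).symm⟩
      rw [one_mul]
      exact congrArg v this
  have hVH : ∀ g, ∀ a ∈ H, V (g * a) = V g := fun g a ha =>
    right_invariant_unique hH.isOpen a ha (hV g) (hV (g * a)) fun b => by rw [mul_assoc]
  obtain ⟨f, hf⟩ := hH.exists_form (Γ := Γ) hi
    (V := fun g => (Real.sqrt (μ.real H) : ℂ) * V g)
    (fun γ hγ g => by rw [hΓV γ hγ]) (fun g a ha => by rw [hVH g a ha])
  refine ⟨f, Subtype.ext (Lp.ext ((hH.coeFn_toL2 hi f).trans ?_))⟩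
  refine ae_quotientMeasure_of_ae
    (measurableSet_eq_fun ((hH.measurable_form hi f).const_mul _) hvm) ?_
  filter_upwards [hwV] with g hg
  rw [hf, inv_mul_cancel_left₀ hH.sqrt_ne_zero]
  exact hg.symm

variable (Γ μ) in
/-- The identification of forms with fixed vectors. -/
noncomputable def IsCellStabilizer.equiv (hH : IsCellStabilizer hϖ i H) (hi : i ≤ 2) :
    Form ϖ Γ i ≃ₗ[ℂ] L2Fixed Γ μ H :=
  LinearEquiv.ofBijective (hH.toL2 hi Γ μ) ⟨hH.toL2_injective hi, hH.toL2_surjective hi⟩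

theorem IsCellStabilizer.coeFn_equiv (hH : IsCellStabilizer hϖ i H) (hi : i ≤ 2)
    (f : Form ϖ Γ i) : (hH.equiv Γ μ hi f : L2 Γ μ) =ᵐ[quotientMeasure Γ μ]
      fun x => (Real.sqrt (μ.real H) : ℂ)⁻¹ * f.1 (cosetToCell hϖ Γ hi x) :=
  hH.coeFn_toL2 hi f

theorem IsCellStabilizer.isIdentification (hH : IsCellStabilizer hϖ i H) (hi : i ≤ 2) :
    IsIdentification hϖ hi (hH.equiv Γ μ hi) := by
  intro f
  filter_upwards [hH.coeFn_equiv (μ := μ) hi f] with x hx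
  rw [hx, mul_inv_cancel_left₀ hH.sqrt_ne_zero]

/-- The integrand is constant on the cosets of $H$, each of measure $\mu(H)$, and only finitely many
of these open cosets meet the compact set `S`. -/
theorem integral_of_right_invariant {V : Type*} [NormedAddCommGroup V] [NormedSpace ℂ V]
    [CompleteSpace V] (hHo : IsOpen (H : Set PGL(3, F))) (hHc : IsCompact (H : Set PGL(3, F)))
    {S : Set PGL(3, F)} (hS : IsCompact S) {u : PGL(3, F) → V}
    (hu : ∀ g, ∀ h ∈ H, u (g * h) = u g) (hu0 : ∀ g ∉ S, u g = 0) :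
    ∃ t : Finset (PGL(3, F) ⧸ H), (∀ g ∈ S, (g : PGL(3, F) ⧸ H) ∈ t) ∧
      ∫ g, u g ∂μ = ∑ s ∈ t, (μ.real H : ℂ) • u s.out := by
  classical
  have : DiscreteTopology (PGL(3, F) ⧸ H) := QuotientGroup.discreteTopology hHo
  have hfin : ((fun g : PGL(3, F) => (g : PGL(3, F) ⧸ H)) '' S).Finite :=
    (hS.image QuotientGroup.continuous_mk).finite
      (isDiscrete_iff_discreteTopology.2 inferInstance)
  refine ⟨hfin.toFinset, fun g hg => hfin.mem_toFinset.2 ⟨g, hg, rfl⟩, ?_⟩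
  let A : PGL(3, F) ⧸ H → Set PGL(3, F) := fun s => (fun g : PGL(3, F) => (g : PGL(3, F) ⧸ H)) ⁻¹' {s}
  have hA : ∀ s, MeasurableSet (A s) := fun s =>
    ((isOpen_discrete {s}).preimage QuotientGroup.continuous_mk).measurableSet
  have hμA : ∀ s, μ (A s) = μ H := fun s => by
    have : A s = (fun g => s.out⁻¹ * g) ⁻¹' (H : Set PGL(3, F)) := by
      ext g
      simp only [A, Set.mem_preimage, Set.mem_singleton_iff, SetLike.mem_coe]
      rw [← QuotientGroup.eq, QuotientGroup.out_eq', eq_comm]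
    rw [this, measure_preimage_mul]
  have hsum : u = fun g => ∑ s ∈ hfin.toFinset, (A s).indicator (fun _ => u s.out) g := by
    ext g
    have hout : u (g : PGL(3, F) ⧸ H).out = u g := by
      obtain ⟨h, hg⟩ := QuotientGroup.mk_out_eq_mul H g
      rw [hg, hu g h h.2]
    rw [Finset.sum_eq_single (g : PGL(3, F) ⧸ H)]
    · rw [Set.indicator_of_mem (show g ∈ A g from rfl), hout]
    · intro s _ hs
      exact Set.indicator_of_notMem (show g ∉ A s from fun h => hs (Set.mem_singleton_iff.1 h).symm) _
    · intro hg
      rw [Set.indicator_of_mem (show g ∈ A g from rfl), hout]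
      exact hu0 g fun hgS => hg (hfin.mem_toFinset.2 ⟨g, hgS, rfl⟩)
  conv_lhs => rw [hsum]
  rw [integral_finsetSum]
  · refine Finset.sum_congr rfl fun s _ => ?_
    rw [integral_indicator_const _ (hA s), measureReal_def, hμA, ← measureReal_def,
      Complex.coe_smul]
  · intro s _
    refine (integrable_indicator_iff (hA s)).2 (integrableOn_const (hs := ?_))
    rw [hμA]
    exact hHc.measure_lt_top.ne

theorem coeFn_sum_regularRep {ι : Type*} (t : Finset ι) (c : ι → ℂ) (x : ι → PGL(3, F))
    {v : L2 Γ μ} {ψ : Coset Γ → ℂ} (hv : v =ᵐ[quotientMeasure Γ μ] ψ) :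
    (∑ s ∈ t, c s • regularRep Γ μ (x s) v : L2 Γ μ) =ᵐ[quotientMeasure Γ μ]
      fun y => ∑ s ∈ t, c s * ψ (rightMul Γ (x s) y) := by
  classical
  induction t using Finset.induction_on with
  | empty =>
    simp only [Finset.sum_empty]
    exact Lp.coeFn_zero _ _ _
  | insert a t ha ih =>
    rw [Finset.sum_insert ha]
    have h1 := (coeFn_regularRep (x a) v).trans
      ((measurePreserving_rightMul Γ μ (x a)).quasiMeasurePreserving.ae hv)
    filter_upwards [Lp.coeFn_add (c a • regularRep Γ μ (x a) v)
      (∑ s ∈ t, c s • regularRep Γ μ (x s) v), Lp.coeFn_smul (c a) (regularRep Γ μ (x a) v),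
      h1, ih] with y e1 e2 e3 e4
    rw [e1, Pi.add_apply, e2, e4, Pi.smul_apply, e3, Finset.sum_insert ha, smul_eq_mul]

/-- This removes the analysis: an identity of operators on fixed vectors follows from a pointwise
formula for forms, summed over $G/H$. -/
theorem heckeAct_equiv {j : ℕ} {H' : Subgroup PGL(3, F)} (hH : IsCellStabilizer hϖ i H)
    (hi : i ≤ 2) (hH' : IsCellStabilizer hϖ j H') (hj : j ≤ 2) {η : PGL(3, F) → ℂ}
    {S : Set PGL(3, F)} (hS : IsCompact S) (hη : ∀ g, ∀ h ∈ H, η (g * h) = η g)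
    (hη0 : ∀ g ∉ S, η g = 0) {f : Form ϖ Γ i} {f' : Form ϖ Γ j}
    (hf : ∀ g, f'.1 (cosetToCell hϖ Γ hj (Quotient.mk _ g)) = ∑ᶠ s : PGL(3, F) ⧸ H,
      η s.out * f.1 (cosetToCell hϖ Γ hi (Quotient.mk _ (g * s.out)))) :
    heckeAct μ (regularRep Γ μ) (((1 / Real.sqrt (μ.real H * μ.real H') : ℝ) : ℂ) • η)
      (hH.equiv Γ μ hi f) = hH'.equiv Γ μ hj f' := by
  set c : ℂ := ((1 / Real.sqrt (μ.real H * μ.real H') : ℝ) : ℂ)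
  set v : L2 Γ μ := (hH.equiv Γ μ hi f).1
  have hvH : ∀ h ∈ H, regularRep Γ μ h v = v := (hH.equiv Γ μ hi f).2
  obtain ⟨t, ht, hint⟩ := integral_of_right_invariant (μ := μ) hH.isOpen hH.isCompact hS
    (u := fun g => (c • η) g • regularRep Γ μ g v)
    (fun g h hh => by
      simp only [Pi.smul_apply, hη g h hh, map_mul, Module.End.mul_apply, hvH h hh])
    (fun g hg => by simp [hη0 g hg])
  rw [heckeAct, hint]
  have hsum : ∑ s ∈ t, (μ.real H : ℂ) • ((c • η) s.out • regularRep Γ μ s.out v)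
      = ∑ s ∈ t, ((μ.real H : ℂ) * (c * η s.out)) • regularRep Γ μ s.out v := by
    refine Finset.sum_congr rfl fun s _ => ?_
    rw [mul_smul, Pi.smul_apply, smul_eq_mul]
  rw [hsum]
  refine Lp.ext ((coeFn_sum_regularRep t _ _ (hH.coeFn_equiv hi f)).trans ?_)
  refine Filter.EventuallyEq.trans (Filter.Eventually.of_forall fun x => ?_)
    (hH'.coeFn_equiv hj f').symm
  induction x using Quotient.inductionOn with
  | h g =>
    beta_reduce
    have hsupp : Function.support (fun s : PGL(3, F) ⧸ H =>
        η s.out * f.1 (cosetToCell hϖ Γ hi (Quotient.mk _ (g * s.out)))) ⊆ t := by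
      intro s hs
      have h1 : s.out ∈ S := by
        by_contra h
        exact hs (by simp [hη0 _ h])
      simpa using ht _ h1
    rw [hf, finsum_eq_sum_of_support_subset _ hsupp, Finset.mul_sum]
    refine Finset.sum_congr rfl fun s _ => ?_
    -- The factors are the measure of a coset, the normalization of the Hecke element and that of
    -- the source identification; their product is the normalization of the target.
    have hc : (μ.real H : ℂ) * c * (Real.sqrt (μ.real H) : ℂ)⁻¹
        = (Real.sqrt (μ.real H') : ℂ)⁻¹ := by
      have h0 := hH.sqrt_ne_zero (μ := μ)
      have h0' := hH'.sqrt_ne_zero (μ := μ)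
      have h1 : (μ.real H : ℂ) = (Real.sqrt (μ.real H) : ℂ) * (Real.sqrt (μ.real H) : ℂ) := by
        rw [← Complex.ofReal_mul, Real.mul_self_sqrt measureReal_nonneg]
      have h2 : c = ((Real.sqrt (μ.real H) : ℂ) * (Real.sqrt (μ.real H') : ℂ))⁻¹ := by
        simp only [c, Real.sqrt_mul measureReal_nonneg, one_div, Complex.ofReal_inv,
          Complex.ofReal_mul]
      rw [h1, h2]
      field_simp
    rw [rightMul_mk, ← hc]
    ring

end

/-! ### Boundary and coboundary maps as sums over cosets. -/

section
variable {F : Type*} [Field F] [ValuativeRel F] [TopologicalSpace F] [IsNonarchimedeanLocalField F]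
  {ϖ : 𝒪[F]} {hϖ : Irreducible ϖ} {i : ℕ} {H : Subgroup PGL(3, F)}
  {Γ : Subgroup PGL(3, F)} [hΓ : IsTorsionFreeCocompactLattice Γ]

theorem eq_one_of_smul_vertex {γ : PGL(3, F)} (hγ : γ ∈ Γ) {x : Vertex F} (h : γ • x = x) :
    γ = 1 := by
  obtain ⟨g, rfl⟩ := QuotientGroup.mk_surjective x
  refine eq_one_of_mem_conj Γ (g := g) hγ ?_
  have h1 : g⁻¹ * (γ * g) ∈ K F := QuotientGroup.eq.1 h.symm
  rwa [← mul_assoc] at h1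

/-- A cell of $X$ whose face is the orbit of `x` has a lift to $\mathcal B$ with face `x` itself,
and only one, because $\Gamma$ acts freely on vertices. -/
theorem boundary_mk (f : Form ϖ Γ (i + 1)) (x : BuildingCell ϖ i) :
    (boundary f).1 (Quotient.mk _ x) = ∑ᶠ z ∈ {z : BuildingCell ϖ (i + 1) |
      ∀ j : Fin (i + 1), z.1 j.succ = x.1 j}, f.1 (Quotient.mk _ z) := by
  let Z := {z : BuildingCell ϖ (i + 1) | ∀ j : Fin (i + 1), z.1 j.succ = x.1 j}
  rw [← finsum_set_coe_eq_finsum_mem Z]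
  have hface : ∀ z : Z, Cell.face (Quotient.mk (cellSetoid ϖ Γ (i + 1)) z.1) 0
      = Quotient.mk (cellSetoid ϖ Γ i) x := fun z =>
    Quotient.sound ⟨1, Γ.one_mem, fun j => by
      rw [one_smul, ← z.2 j]
      simp⟩
  refine (finsum_eq_of_bijective (fun z : Z => (⟨_, hface z⟩ :
    {y : Cell ϖ Γ (i + 1) // y.face 0 = Quotient.mk (cellSetoid ϖ Γ i) x})) ⟨?_, ?_⟩
    fun z => rfl).symm
  · intro z z' h
    obtain ⟨γ, hγ, h1⟩ := Quotient.exact (Subtype.ext_iff.1 h)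
    have h2 := h1 (Fin.succ 0)
    rw [z.2, z'.2] at h2
    have h3 := eq_one_of_smul_vertex hγ h2.symm
    refine Subtype.ext (Subtype.ext (funext fun j => ?_))
    rw [h1 j, h3, one_smul]
  · rintro ⟨y, hy⟩
    induction y using Quotient.inductionOn with
    | h y =>
      obtain ⟨γ, hγ, h1⟩ := Quotient.exact hy
      refine ⟨⟨⟨_, y.2.smul γ⟩, fun j => ?_⟩, Subtype.ext ?_⟩
      · rw [h1 j]
        simp
      · exact Quotient.sound ⟨γ⁻¹, Γ.inv_mem hγ, fun j => (inv_smul_smul _ _).symm⟩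

theorem IsCellStabilizer.form_out (hH : IsCellStabilizer hϖ i H) (hi : i ≤ 2) (f : Form ϖ Γ i)
    (g b : PGL(3, F)) :
    f.1 (cosetToCell hϖ Γ hi (Quotient.mk _ (g * (b : PGL(3, F) ⧸ H).out)))
      = f.1 (cosetToCell hϖ Γ hi (Quotient.mk _ (g * b))) := by
  obtain ⟨h, hb⟩ := QuotientGroup.mk_out_eq_mul H b
  rw [hb, ← mul_assoc, hH.form_apply hi f _ h.2]

/-- The cells `gbc`, for `b` in a set `B` and a reordering `c` of the fundamental cell,
correspond to the cosets of `H` that meet `B`. -/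
theorem IsCellStabilizer.exists_bijOn (hH : IsCellStabilizer hϖ i H) (hi : i ≤ 2)
    {B : Set PGL(3, F)} (hB : ∀ b ∈ B, ∀ b' ∈ B, b⁻¹ * b' ∈ H →
      ∀ j : Fin (i + 1), b' • stdVertex hϖ j = b • stdVertex hϖ j)
    (ρ : Equiv.Perm (Fin (i + 1))) (f : Form ϖ Γ i) (g : PGL(3, F)) :
    ∃ e : PGL(3, F) ⧸ H → BuildingCell ϖ i,
      Set.BijOn e ((fun b : PGL(3, F) => (b : PGL(3, F) ⧸ H)) '' B)
        {z | ∃ b ∈ B, ∀ j, z.1 j = (g * b) • stdVertex hϖ (ρ j : ℕ)} ∧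
      ∀ s ∈ (fun b : PGL(3, F) => (b : PGL(3, F) ⧸ H)) '' B,
        f.1 (cosetToCell hϖ Γ hi (Quotient.mk _ (g * s.out)))
          = ((Equiv.Perm.sign ρ : ℤ) : ℂ) * f.1 (Quotient.mk _ (e s)) := by
  have hne : Nonempty (BuildingCell ϖ i) := ⟨⟨_, isCell_sigma hϖ hi 1⟩⟩
  have hex : ∀ s ∈ (fun b : PGL(3, F) => (b : PGL(3, F) ⧸ H)) '' B,
      ∃ z : BuildingCell ϖ i, ∃ b ∈ B, (b : PGL(3, F) ⧸ H) = s ∧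
        ∀ j, z.1 j = (g * b) • stdVertex hϖ (ρ j : ℕ) := by
    rintro _ ⟨b, hb, rfl⟩
    exact ⟨⟨_, (isCell_sigma hϖ hi (g * b)).comp ρ.injective⟩, b, hb, rfl, fun j => rfl⟩
  choose! e he using hex
  refine ⟨e, ⟨fun s hs => ?_, fun s hs s' hs' h => ?_, ?_⟩, fun s hs => ?_⟩
  · obtain ⟨b, hb, -, hz⟩ := he s hs
    exact ⟨b, hb, hz⟩
  · obtain ⟨b, hb, rfl, hz⟩ := he s hs
    obtain ⟨b', hb', rfl, hz'⟩ := he s' hs'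
    refine QuotientGroup.eq.2 ((hH _).2 ⟨1, fun j => ?_⟩)
    obtain ⟨k, rfl⟩ := ρ.surjective j
    have h1 := hz k
    rw [h, hz' k, mul_smul, mul_smul] at h1
    rw [mul_smul, smul_left_cancel _ h1, inv_smul_smul]
    rfl
  · rintro z ⟨b, hb, hz⟩
    have hs : (b : PGL(3, F) ⧸ H) ∈ (fun b : PGL(3, F) => (b : PGL(3, F) ⧸ H)) '' B := ⟨b, hb, rfl⟩
    obtain ⟨b', hb', h, hz'⟩ := he _ hs
    refine ⟨_, hs, Subtype.ext (funext fun j => ?_)⟩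
    -- The representative `b'` chosen for the coset of `b` may differ from `b`; by `hB` both give
    -- the same ordered cell.
    rw [hz, hz', mul_smul, mul_smul, hB b' hb' b hb (QuotientGroup.eq.1 h)]
  · obtain ⟨b, hb, rfl, hz⟩ := he s hs
    rw [hH.form_out]
    have h1 : (Quotient.mk (cellSetoid ϖ Γ i) (e (b : PGL(3, F) ⧸ H)))
        = (cosetToCell hϖ Γ hi (Quotient.mk _ (g * b))).perm ρ :=
      Quotient.sound ⟨1, Γ.one_mem, fun j => by rw [one_smul, hz]; rfl⟩
    rw [h1, f.2 ρ, ← mul_assoc, ← Int.cast_mul, ← Units.val_mul, Int.units_mul_self]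
    simp

/-- As `S` is a union of cosets of $H$, the chosen representative of a coset lies in `S` as soon as
the coset meets `S`. -/
theorem finsum_charFun_mul {S : Set PGL(3, F)} (hS : ∀ g ∈ S, ∀ h ∈ H, g * h ∈ S)
    (φ : PGL(3, F) ⧸ H → ℂ) : ∑ᶠ s : PGL(3, F) ⧸ H, charFun S s.out * φ s
      = ∑ᶠ s ∈ (fun b : PGL(3, F) => (b : PGL(3, F) ⧸ H)) '' S, φ s := by
  rw [finsum_mem_def]
  refine finsum_congr fun s => ?_
  by_cases h : s.out ∈ S
  · have hs : s ∈ (fun b : PGL(3, F) => (b : PGL(3, F) ⧸ H)) '' S :=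
      ⟨_, h, QuotientGroup.out_eq' s⟩
    rw [Set.indicator_of_mem hs, charFun, Set.indicator_of_mem h]
    simp
  · rw [charFun, Set.indicator_of_notMem h, zero_mul, Set.indicator_of_notMem]
    rintro ⟨b, hb, rfl⟩
    obtain ⟨a, ha⟩ := QuotientGroup.mk_out_eq_mul H b
    exact h (ha ▸ hS b hb a a.2)

theorem finite_image_mk (hH : IsOpen (H : Set PGL(3, F))) {S : Set PGL(3, F)} (hS : IsCompact S) :
    ((fun b : PGL(3, F) => (b : PGL(3, F) ⧸ H)) '' S).Finite := by
  have : DiscreteTopology (PGL(3, F) ⧸ H) := QuotientGroup.discreteTopology hH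
  exact (hS.image QuotientGroup.continuous_mk).finite
    (isDiscrete_iff_discreteTopology.2 inferInstance)

theorem finite_support_charFun_mul (hH : IsOpen (H : Set PGL(3, F))) {S : Set PGL(3, F)}
    (hS : IsCompact S) (φ : PGL(3, F) ⧸ H → ℂ) :
    (Function.support fun s : PGL(3, F) ⧸ H => charFun S s.out * φ s).Finite := by
  refine (finite_image_mk hH hS).subset fun s hs => ?_
  by_contra h
  refine hs ?_
  have : s.out ∉ S := fun h' => h ⟨_, h', QuotientGroup.out_eq' s⟩
  beta_reduce
  rw [charFun, Set.indicator_of_notMem this, zero_mul]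

variable (hϖ) in
/-- The elements of `G` that move `σᵃv₀` to `σᵇv₀`. -/
def transporter (a b : ℕ) : Set PGL(3, F) := {g | g • stdVertex hϖ a = stdVertex hϖ b}

theorem transporter_mul_mem {a b : ℕ} {g h : PGL(3, F)} (hg : g ∈ transporter hϖ a b)
    (hh : h • stdVertex hϖ a = stdVertex hϖ a) : g * h ∈ transporter hϖ a b := by
  rw [transporter, Set.mem_ofPred_eq, mul_smul, hh]
  exact hg

theorem mul_transporter_mem {a b : ℕ} {g h : PGL(3, F)} (hg : g ∈ transporter hϖ a b)
    (hh : h • stdVertex hϖ b = stdVertex hϖ b) : h * g ∈ transporter hϖ a b := by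
  rw [transporter, Set.mem_ofPred_eq, mul_smul, show g • stdVertex hϖ a = _ from hg, hh]

theorem coe_K_eq : (K F : Set PGL(3, F)) = transporter hϖ 0 0 := by
  ext g
  exact mem_K_iff_smul hϖ

theorem K_mul_sigma_sq : (K F : Set PGL(3, F)) * {sigma hϖ ^ 2} = transporter hϖ 1 0 := by
  ext g
  rw [Set.mul_singleton, Set.mem_image]
  constructor
  · rintro ⟨k, hk, rfl⟩
    rw [transporter, Set.mem_ofPred_eq, mul_smul, sigma_pow_smul_stdVertex,
      stdVertex_eq_of_mod_eq hϖ (show (2 + 1) % 3 = 0 % 3 from rfl)]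
    exact (mem_K_iff_smul hϖ).1 hk
  · intro hg
    refine ⟨g * sigma hϖ ^ 1, (mem_K_iff_smul hϖ).2 ?_, ?_⟩
    · rw [mul_smul, sigma_pow_smul_stdVertex]
      exact hg
    · rw [mul_assoc, ← pow_add, sigma_pow_three, mul_one]

theorem sigma_mul_K : {sigma hϖ} * (K F : Set PGL(3, F)) = transporter hϖ 0 1 := by
  have h1 : stdVertex hϖ 1 = sigma hϖ • stdVertex hϖ 0 := by
    rw [← pow_one (sigma hϖ), sigma_pow_smul_stdVertex]
  ext g
  rw [Set.singleton_mul, Set.mem_image, transporter, Set.mem_ofPred_eq, h1]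
  constructor
  · rintro ⟨k, hk, rfl⟩
    rw [mul_smul, (mem_K_iff_smul hϖ).1 hk]
  · intro hg
    refine ⟨(sigma hϖ)⁻¹ * g, (mem_K_iff_smul hϖ).2 ?_, mul_inv_cancel_left _ _⟩
    rw [mul_smul, hg, inv_smul_smul]

theorem isCompact_transporter (a b : ℕ) : IsCompact (transporter hϖ a b) :=
  isCompact_smul_stdVertex_eq hϖ a _

theorem sigma_pow_mem_T (n : ℕ) : sigma hϖ ^ n ∈ T hϖ := by
  have h1 : sigma hϖ ∈ T hϖ := (isCellStabilizer_T hϖ _).2 ⟨finRotate 3, fun j => by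
    rw [← pow_one (sigma hϖ), sigma_pow_smul_stdVertex]
    refine stdVertex_eq_of_mod_eq hϖ ?_
    revert j
    decide⟩
  exact (T hϖ).pow_mem h1 n

/-- The vertices `v₀, σv₀, σ²v₀` are permuted cyclically by the stabilizer of the triangle. -/
theorem smul_stdVertex_of_mem_T {t : PGL(3, F)} (ht : t ∈ T hϖ) :
    ∃ a : Fin 3, ∀ j, t • stdVertex hϖ j = stdVertex hϖ (a + j) := by
  obtain ⟨τ, hτ⟩ := (isCellStabilizer_T hϖ t).1 ht
  refine ⟨τ 0, fun j => ?_⟩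
  have h1 : ∀ j : Fin 3, t • stdVertex hϖ j = (1 : PGL(3, F)) • stdVertex hϖ (τ j : ℕ) :=
    fun j => by rw [one_smul]; exact hτ j
  have h2 := type_eq hϖ (h1 0) (h1 ⟨j % 3, Nat.mod_lt _ (by norm_num)⟩)
  rw [← stdVertex_mod hϖ j]
  refine (hτ ⟨j % 3, Nat.mod_lt _ (by norm_num)⟩).trans (stdVertex_eq_of_mod_eq hϖ ?_)
  simp only [Fin.val_zero] at h2
  omega

/-- An ordered edge ending at $gv_0$ is either $gbe_0$ with $b\sigma v_0=v_0$, that is $b\in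
K\sigma^2$, or the reversal of $gbe_0$ with $b\in K$. The reversal produces the minus sign. -/
theorem boundary_one (f : Form ϖ Γ 1) (g : PGL(3, F)) :
    (boundary f).1 (cosetToCell hϖ Γ (Nat.zero_le 2) (Quotient.mk _ g))
      = ∑ᶠ s : PGL(3, F) ⧸ E hϖ, (charFun ((K F : Set PGL(3, F)) * {sigma hϖ ^ 2})
          - charFun (K F : Set PGL(3, F)) : PGL(3, F) → ℂ) s.out
        * f.1 (cosetToCell hϖ Γ (Nat.le_succ 1) (Quotient.mk _ (g * s.out))) := by
  have hE := isCellStabilizer_E hϖ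
  rw [K_mul_sigma_sq, coe_K_eq (hϖ := hϖ)]
  simp only [Pi.sub_apply, sub_mul]
  rw [finsum_sub_distrib (finite_support_charFun_mul hE.isOpen (isCompact_transporter _ _) _)
      (finite_support_charFun_mul hE.isOpen (isCompact_transporter _ _) _),
    finsum_charFun_mul fun g hg h hh => transporter_mul_mem hg ((mem_E_iff hϖ).1 hh).2,
    finsum_charFun_mul fun g hg h hh => transporter_mul_mem hg ((mem_E_iff hϖ).1 hh).1]
  have hB : ∀ b b' : PGL(3, F), b⁻¹ * b' ∈ E hϖ →
      ∀ j : Fin 2, b' • stdVertex hϖ j = b • stdVertex hϖ j := fun b b' h j => by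
    obtain ⟨h0, h1⟩ := (mem_E_iff hϖ).1 h
    rw [mul_smul, inv_smul_eq_iff] at h0 h1
    fin_cases j
    · exact h0
    · exact h1
  obtain ⟨e₁, hb₁, he₁⟩ := hE.exists_bijOn (Nat.le_succ 1) (B := transporter hϖ 1 0)
    (fun b _ b' _ => hB b b') 1 f g
  obtain ⟨e₂, hb₂, he₂⟩ := hE.exists_bijOn (Nat.le_succ 1) (B := transporter hϖ 0 0)
    (fun b _ b' _ => hB b b') (Equiv.swap 0 1) f g
  have s₁ := finsum_mem_eq_of_bijOn (g := fun z => f.1 (Quotient.mk _ z)) e₁ hb₁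
    fun s hs => (he₁ s hs).trans (by simp)
  have s₂ := finsum_mem_eq_of_bijOn (g := fun z => -f.1 (Quotient.mk _ z)) e₂ hb₂
    fun s hs => (he₂ s hs).trans (by simp)
  have f₁ := hb₁.finite_iff_finite.1 (finite_image_mk hE.isOpen (isCompact_transporter _ _))
  have f₂ := hb₂.finite_iff_finite.1 (finite_image_mk hE.isOpen (isCompact_transporter _ _))
  rw [s₁, s₂, finsum_mem_neg_distrib _ f₂, sub_neg_eq_add, ← finsum_mem_union ?_ f₁ f₂]
  · refine (boundary_mk f _).trans (finsum_mem_congr ?_ fun _ _ => rfl)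
    ext z
    constructor
    · intro hz
      have hz0 : z.1 1 = g • stdVertex hϖ 0 := hz 0
      obtain ⟨g', τ, h⟩ := exists_perm_of_isCell hϖ one_le_two z.2
      have hτ : τ = 1 ∨ τ = Equiv.swap 0 1 := by
        clear h
        revert τ
        decide
      have h1 := (h 1).symm.trans hz0
      rcases hτ with rfl | rfl
      · refine Or.inl ⟨g⁻¹ * g', ?_, fun j => ?_⟩
        · rw [transporter, Set.mem_ofPred_eq, mul_smul, inv_smul_eq_iff]
          exact h1
        · rw [mul_inv_cancel_left, h]
      · refine Or.inr ⟨g⁻¹ * g', ?_, fun j => ?_⟩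
        · rw [transporter, Set.mem_ofPred_eq, mul_smul, inv_smul_eq_iff]
          exact h1
        · rw [mul_inv_cancel_left, h]
    · rintro (⟨b, hb, h⟩ | ⟨b, hb, h⟩) j
      · obtain rfl := Fin.fin_one_eq_zero j
        refine (h 1).trans ?_
        rw [mul_smul]
        exact congrArg _ hb
      · obtain rfl := Fin.fin_one_eq_zero j
        refine (h 1).trans ?_
        rw [mul_smul]
        exact congrArg _ hb
  -- An edge cannot occur in both families, since its type difference would be both $1$ and $-1$
  -- modulo 3.
  · rw [Set.disjoint_left]
    rintro z ⟨b, -, h⟩ ⟨b', -, h'⟩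
    have := type_eq hϖ ((h 0).symm.trans (h' 0)) ((h 1).symm.trans (h' 1))
    simp at this

/-- The triangles whose last two vertices are $gv_0,g\sigma v_0$ are $gbt_0$ with $b\in E\sigma^2$,
and these $b$ represent exactly the cosets of $T$ in $ET$. -/
theorem boundary_two (f : Form ϖ Γ 2) (g : PGL(3, F)) :
    (boundary f).1 (cosetToCell hϖ Γ (Nat.le_succ 1) (Quotient.mk _ g))
      = ∑ᶠ s : PGL(3, F) ⧸ T hϖ, charFun ((E hϖ : Set PGL(3, F)) * (T hϖ : Set PGL(3, F))) s.out
        * f.1 (cosetToCell hϖ Γ (Nat.le_refl 2) (Quotient.mk _ (g * s.out))) := by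
  have hT := isCellStabilizer_T hϖ
  rw [finsum_charFun_mul (by
    rintro _ ⟨e, he, t, ht, rfl⟩ h hh
    exact ⟨e, he, t * h, (T hϖ).mul_mem ht hh, (mul_assoc _ _ _).symm⟩)]
  -- Elements of one coset of $T$ may give rotated triangles, so $ET$ is replaced by $E\sigma^2$,
  -- written as an intersection of transporters, where a coset determines the ordered triangle.
  have himg : (fun b : PGL(3, F) => (b : PGL(3, F) ⧸ T hϖ)) ''
        ((E hϖ : Set PGL(3, F)) * (T hϖ : Set PGL(3, F)))
      = (fun b : PGL(3, F) => (b : PGL(3, F) ⧸ T hϖ)) ''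
        (transporter hϖ 1 0 ∩ transporter hϖ 2 1) := by
    ext s
    constructor
    · rintro ⟨_, ⟨e, he, t, ht, rfl⟩, rfl⟩
      obtain ⟨h0, h1⟩ := (mem_E_iff hϖ).1 he
      refine ⟨e * sigma hϖ ^ 2, ⟨?_, ?_⟩, QuotientGroup.eq.2 ?_⟩
      · rw [transporter, Set.mem_ofPred_eq, mul_smul, sigma_pow_smul_stdVertex,
          stdVertex_eq_of_mod_eq hϖ (show (2 + 1) % 3 = 0 % 3 from rfl), h0]
      · rw [transporter, Set.mem_ofPred_eq, mul_smul, sigma_pow_smul_stdVertex,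
          stdVertex_eq_of_mod_eq hϖ (show (2 + 2) % 3 = 1 % 3 from rfl), h1]
      · rw [show (e * sigma hϖ ^ 2)⁻¹ * (e * t) = (sigma hϖ ^ 2)⁻¹ * t by group]
        exact (T hϖ).mul_mem ((T hϖ).inv_mem (sigma_pow_mem_T 2)) ht
    · rintro ⟨b, ⟨h0, h1⟩, rfl⟩
      refine ⟨b, ⟨b * sigma hϖ ^ 1, (mem_E_iff hϖ).2 ⟨?_, ?_⟩, sigma hϖ ^ 2,
        sigma_pow_mem_T 2, ?_⟩, rfl⟩
      · rw [mul_smul, sigma_pow_smul_stdVertex]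
        exact h0
      · rw [mul_smul, sigma_pow_smul_stdVertex]
        exact h1
      · beta_reduce
        rw [mul_assoc, ← pow_add, sigma_pow_three, mul_one]
  rw [himg]
  obtain ⟨e, hb, he⟩ := hT.exists_bijOn (Nat.le_refl 2)
    (B := transporter hϖ 1 0 ∩ transporter hϖ 2 1) (by
      rintro b ⟨h0, h1⟩ b' ⟨h0', h1'⟩ h j
      obtain ⟨a, ha⟩ := smul_stdVertex_of_mem_T h
      have h2 := ha 1
      rw [mul_smul, show b' • stdVertex hϖ 1 = b • stdVertex hϖ 1 from h0'.trans h0.symm,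
        inv_smul_smul] at h2
      have h3 := stdVertex_injective hϖ h2
      have h4 := ha j
      rw [mul_smul, inv_smul_eq_iff] at h4
      rw [h4]
      congr 1
      refine stdVertex_eq_of_mod_eq hϖ ?_
      omega) 1 f g
  rw [finsum_mem_eq_of_bijOn (g := fun z => f.1 (Quotient.mk _ z)) e hb
    fun s hs => (he s hs).trans (by simp)]
  refine (boundary_mk f _).trans (finsum_mem_congr ?_ fun _ _ => rfl)
  ext z
  constructor
  · intro hz
    have hz0 : z.1 1 = g • stdVertex hϖ 0 := hz 0
    have hz1 : z.1 2 = g • stdVertex hϖ 1 := hz 1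
    obtain ⟨g', τ, h⟩ := exists_perm_of_isCell hϖ le_rfl z.2
    have h1 := (h 1).symm.trans hz0
    have h2 := (h 2).symm.trans hz1
    have ht := type_eq hϖ h1 h2
    -- The types of the last two vertices force `τ` to be a rotation, which a power of $\sigma$
    -- absorbs into the group element.
    have hτ : ∀ j : Fin 3, (τ j : ℕ) % 3 = (τ 0 + j : ℕ) % 3 := by
      clear h h1 h2
      revert τ
      decide
    have key : ∀ j : Fin 3, z.1 j = (g' * sigma hϖ ^ (τ 0 : ℕ)) • stdVertex hϖ j := fun j => by
      rw [mul_smul, sigma_pow_smul_stdVertex, h, stdVertex_eq_of_mod_eq hϖ (hτ j)]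
    refine ⟨g⁻¹ * (g' * sigma hϖ ^ (τ 0 : ℕ)), ⟨?_, ?_⟩, fun j => ?_⟩
    · rw [transporter, Set.mem_ofPred_eq, mul_smul, inv_smul_eq_iff]
      exact (key 1).symm.trans hz0
    · rw [transporter, Set.mem_ofPred_eq, mul_smul, inv_smul_eq_iff]
      exact (key 2).symm.trans hz1
    · rw [mul_inv_cancel_left, key]
      rfl
  · rintro ⟨b, ⟨h0, h1⟩, h⟩ j
    fin_cases j
    · refine (h 1).trans ?_
      rw [mul_smul]
      exact congrArg _ h0
    · refine (h 2).trans ?_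
      rw [mul_smul]
      exact congrArg _ h1

theorem image_mk_transporter (b : ℕ) :
    (fun g : PGL(3, F) => (g : PGL(3, F) ⧸ K F)) '' transporter hϖ 0 b
      = {((sigma hϖ ^ b : PGL(3, F)) : PGL(3, F) ⧸ K F)} := by
  ext s
  constructor
  · rintro ⟨g, hg, rfl⟩
    have h : g • stdVertex hϖ 0 = stdVertex hϖ b := hg
    rw [smul_stdVertex, pow_zero, mul_one] at h
    exact h
  · rintro rfl
    refine ⟨sigma hϖ ^ b, ?_, rfl⟩
    rw [transporter, Set.mem_ofPred_eq, sigma_pow_smul_stdVertex, add_zero]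

theorem coboundary_apply (f : Form ϖ Γ i) (y : Cell ϖ Γ (i + 1)) :
    (coboundary f).1 y = ∑ j : Fin (i + 2), (-1) ^ (j : ℕ) * f.1 (y.face j) := rfl

/-- Each of $\sigma K$ and $K$ is a single coset of $K$; they give the end and the origin of $ge_0$.
-/
theorem coboundary_one (f : Form ϖ Γ 0) (g : PGL(3, F)) :
    (coboundary f).1 (cosetToCell hϖ Γ (Nat.le_succ 1) (Quotient.mk _ g))
      = ∑ᶠ s : PGL(3, F) ⧸ K F, (charFun ({sigma hϖ} * (K F : Set PGL(3, F)))
          - charFun (K F : Set PGL(3, F)) : PGL(3, F) → ℂ) s.out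
        * f.1 (cosetToCell hϖ Γ (Nat.zero_le 2) (Quotient.mk _ (g * s.out))) := by
  have hK := isCellStabilizer_K hϖ
  rw [sigma_mul_K, coe_K_eq (hϖ := hϖ)]
  simp only [Pi.sub_apply, sub_mul]
  rw [finsum_sub_distrib (finite_support_charFun_mul hK.isOpen (isCompact_transporter _ _) _)
      (finite_support_charFun_mul hK.isOpen (isCompact_transporter _ _) _),
    finsum_charFun_mul fun g hg h hh => transporter_mul_mem hg ((mem_K_iff_smul hϖ).1 hh),
    finsum_charFun_mul fun g hg h hh => transporter_mul_mem hg ((mem_K_iff_smul hϖ).1 hh),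
    image_mk_transporter, image_mk_transporter, finsum_mem_singleton, finsum_mem_singleton,
    hK.form_out, hK.form_out]
  have h0 : (cosetToCell hϖ Γ (Nat.le_succ 1) (Quotient.mk _ g)).face 0
      = cosetToCell hϖ Γ (Nat.zero_le 2) (Quotient.mk _ (g * sigma hϖ ^ 1)) :=
    Quotient.sound ⟨1, Γ.one_mem, fun j => by
      obtain rfl := Fin.fin_one_eq_zero j
      change (g * sigma hϖ ^ 1) • stdVertex hϖ 0 = (1 : PGL(3, F)) • g • stdVertex hϖ 1
      rw [one_smul, mul_smul, sigma_pow_smul_stdVertex]⟩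
  have h1 : (cosetToCell hϖ Γ (Nat.le_succ 1) (Quotient.mk _ g)).face 1
      = cosetToCell hϖ Γ (Nat.zero_le 2) (Quotient.mk _ (g * sigma hϖ ^ 0)) :=
    Quotient.sound ⟨1, Γ.one_mem, fun j => by
      obtain rfl := Fin.fin_one_eq_zero j
      change (g * sigma hϖ ^ 0) • stdVertex hϖ 0 = (1 : PGL(3, F)) • g • stdVertex hϖ 0
      rw [one_smul, pow_zero, mul_one]⟩
  rw [← h0, ← h1]
  rw [coboundary_apply, Fin.sum_univ_two]
  simp [sub_eq_add_neg]

/-- $TE$ consists of the cosets $\sigma^aE$ for $a=0,1,2$, which give the three edges of $gt_0$ in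
cyclic orientation. -/
theorem coboundary_two (f : Form ϖ Γ 1) (g : PGL(3, F)) :
    (coboundary f).1 (cosetToCell hϖ Γ (Nat.le_refl 2) (Quotient.mk _ g))
      = ∑ᶠ s : PGL(3, F) ⧸ E hϖ, charFun ((T hϖ : Set PGL(3, F)) * (E hϖ : Set PGL(3, F))) s.out
        * f.1 (cosetToCell hϖ Γ (Nat.le_succ 1) (Quotient.mk _ (g * s.out))) := by
  have hE := isCellStabilizer_E hϖ
  rw [finsum_charFun_mul (by
    rintro _ ⟨e, he, t, ht, rfl⟩ h hh
    exact ⟨e, he, t * h, (E hϖ).mul_mem ht hh, (mul_assoc _ _ _).symm⟩)]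
  have himg : (fun b : PGL(3, F) => (b : PGL(3, F) ⧸ E hϖ)) ''
        ((T hϖ : Set PGL(3, F)) * (E hϖ : Set PGL(3, F)))
      = Set.range fun a : Fin 3 => ((sigma hϖ ^ (a : ℕ) : PGL(3, F)) : PGL(3, F) ⧸ E hϖ) := by
    ext s
    constructor
    · rintro ⟨_, ⟨t, ht, e, he, rfl⟩, rfl⟩
      obtain ⟨a, ha⟩ := smul_stdVertex_of_mem_T ht
      obtain ⟨h0, h1⟩ := (mem_E_iff hϖ).1 he
      refine ⟨a, QuotientGroup.eq.2 ((mem_E_iff hϖ).2 ⟨?_, ?_⟩)⟩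
      · rw [mul_smul, mul_smul, h0, inv_smul_eq_iff, sigma_pow_smul_stdVertex, ha]
      · rw [mul_smul, mul_smul, h1, inv_smul_eq_iff, sigma_pow_smul_stdVertex, ha]
    · rintro ⟨a, rfl⟩
      exact ⟨_, ⟨_, sigma_pow_mem_T a, 1, (E hϖ).one_mem, rfl⟩, by simp⟩
  have hinj : Function.Injective fun a : Fin 3 =>
      ((sigma hϖ ^ (a : ℕ) : PGL(3, F)) : PGL(3, F) ⧸ E hϖ) := fun a b h => by
    have h1 := ((mem_E_iff hϖ).1 (QuotientGroup.eq.1 h)).1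
    rw [mul_smul, inv_smul_eq_iff, sigma_pow_smul_stdVertex, sigma_pow_smul_stdVertex] at h1
    have h2 := stdVertex_injective hϖ h1
    exact Fin.ext (by omega)
  rw [himg, finsum_mem_range hinj, finsum_eq_sum_of_fintype, Fin.sum_univ_three, hE.form_out,
    hE.form_out, hE.form_out]
  have h0 : (cosetToCell hϖ Γ (Nat.le_refl 2) (Quotient.mk _ g)).face 0
      = cosetToCell hϖ Γ (Nat.le_succ 1) (Quotient.mk _ (g * sigma hϖ ^ 1)) :=
    Quotient.sound ⟨1, Γ.one_mem, fun j => by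
      change (g * sigma hϖ ^ 1) • stdVertex hϖ j
        = (1 : PGL(3, F)) • g • stdVertex hϖ (Fin.succAbove 0 j : Fin 3)
      rw [one_smul, mul_smul, sigma_pow_smul_stdVertex, Fin.succAbove_zero, Fin.val_succ, add_comm]⟩
  have h2 : (cosetToCell hϖ Γ (Nat.le_refl 2) (Quotient.mk _ g)).face 2
      = cosetToCell hϖ Γ (Nat.le_succ 1) (Quotient.mk _ (g * sigma hϖ ^ 0)) :=
    Quotient.sound ⟨1, Γ.one_mem, fun j => by
      change (g * sigma hϖ ^ 0) • stdVertex hϖ j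
        = (1 : PGL(3, F)) • g • stdVertex hϖ (Fin.succAbove 2 j : Fin 3)
      rw [one_smul, pow_zero, mul_one]
      fin_cases j <;> rfl⟩
  -- Deleting the middle vertex leaves $[v_0,\sigma^2v_0]$, the reversal of
  -- $\sigma^2e_0=[\sigma^2v_0,v_0]$. Its sign cancels the one in the coboundary, so all three terms
  -- have coefficient $+1$.
  have h1 : (cosetToCell hϖ Γ (Nat.le_refl 2) (Quotient.mk _ g)).face 1
      = (cosetToCell hϖ Γ (Nat.le_succ 1) (Quotient.mk _ (g * sigma hϖ ^ 2))).perm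
        (Equiv.swap 0 1) :=
    Quotient.sound ⟨1, Γ.one_mem, fun j => by
      change (g * sigma hϖ ^ 2) • stdVertex hϖ (Equiv.swap (0 : Fin 2) 1 j : Fin 2)
        = (1 : PGL(3, F)) • g • stdVertex hϖ (Fin.succAbove 1 j : Fin 3)
      rw [one_smul, mul_smul, sigma_pow_smul_stdVertex]
      congr 1
      refine stdVertex_eq_of_mod_eq hϖ ?_
      revert j
      decide⟩
  have h1' : f.1 ((cosetToCell hϖ Γ (Nat.le_refl 2) (Quotient.mk _ g)).face 1)
      = -f.1 (cosetToCell hϖ Γ (Nat.le_succ 1) (Quotient.mk _ (g * sigma hϖ ^ 2))) := by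
    rw [h1, f.2]
    simp
  rw [coboundary_apply, Fin.sum_univ_three, h0, h1', h2]
  simp only [Fin.val_zero, Fin.val_one, Fin.val_two, pow_zero, pow_one]
  ring

end

/-! ### Membership in the Iwahori–Hecke algebra and the four operator identities. -/

section
variable {F : Type*} [Field F] [ValuativeRel F] [TopologicalSpace F] [IsNonarchimedeanLocalField F]
  {ϖ : 𝒪[F]} {hϖ : Irreducible ϖ} {H : Subgroup PGL(3, F)}

theorem charFun_mul_right {S : Set PGL(3, F)} (hS : ∀ g ∈ S, ∀ h ∈ H, g * h ∈ S)
    (g : PGL(3, F)) {h : PGL(3, F)} (hh : h ∈ H) : charFun S (g * h) = charFun S g := by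
  have : g * h ∈ S ↔ g ∈ S :=
    ⟨fun h' => by simpa using hS _ h' _ (H.inv_mem hh), fun h' => hS _ h' _ hh⟩
  by_cases hg : g ∈ S
  · simp [charFun, hg, this.2 hg]
  · simp [charFun, hg, mt this.1 hg]

theorem charFun_mul_left {S : Set PGL(3, F)} (hS : ∀ g ∈ S, ∀ h ∈ H, h * g ∈ S)
    (g : PGL(3, F)) {h : PGL(3, F)} (hh : h ∈ H) : charFun S (h * g) = charFun S g := by
  have : h * g ∈ S ↔ g ∈ S :=
    ⟨fun h' => by simpa using hS _ h' _ (H.inv_mem hh), fun h' => hS _ h' _ hh⟩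
  by_cases hg : g ∈ S
  · simp [charFun, hg, this.2 hg]
  · simp [charFun, hg, mt this.1 hg]

theorem charFun_mem_iwahoriHecke {S : Set PGL(3, F)} (hS : IsCompact S)
    (hl : ∀ g ∈ S, ∀ h ∈ Iwahori hϖ, h * g ∈ S) (hr : ∀ g ∈ S, ∀ h ∈ Iwahori hϖ, g * h ∈ S) :
    charFun S ∈ IwahoriHecke hϖ :=
  ⟨fun g a ha b hb => by rw [charFun_mul_right hr _ hb, charFun_mul_left hl _ ha],
    HasCompactSupport.intro hS fun g hg => Set.indicator_of_notMem hg _⟩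

theorem charFun_transporter_mem_iwahoriHecke {a b : ℕ} (ha : a ≤ 2) (hb : b ≤ 2) :
    charFun (transporter hϖ a b) ∈ IwahoriHecke hϖ := by
  have key : ∀ {n : ℕ}, n ≤ 2 → ∀ h ∈ Iwahori hϖ, h • stdVertex hϖ n = stdVertex hϖ n := by
    intro n hn h hh
    obtain ⟨h0, h1, h2⟩ := (mem_Iwahori_iff hϖ).1 hh
    interval_cases n
    · exact h0
    · exact h1
    · exact h2
  exact charFun_mem_iwahoriHecke (isCompact_transporter a b)
    (fun g hg h hh => mul_transporter_mem hg (key hb h hh))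
    (fun g hg h hh => transporter_mul_mem hg (key ha h hh))

theorem iwahori_le_E : Iwahori hϖ ≤ E hϖ := inf_le_left

theorem iwahori_le_T : Iwahori hϖ ≤ T hϖ := fun h hh => by
  obtain ⟨h0, h1, h2⟩ := (mem_Iwahori_iff hϖ).1 hh
  refine (isCellStabilizer_T hϖ h).2 ⟨1, fun j => ?_⟩
  fin_cases j
  · exact h0
  · exact h1
  · exact h2

theorem charFun_mul_mem_iwahoriHecke {A B : Subgroup PGL(3, F)}
    (hA : IsCompact (A : Set PGL(3, F))) (hB : IsCompact (B : Set PGL(3, F)))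
    (hIA : Iwahori hϖ ≤ A) (hIB : Iwahori hϖ ≤ B) :
    charFun ((A : Set PGL(3, F)) * (B : Set PGL(3, F))) ∈ IwahoriHecke hϖ :=
  charFun_mem_iwahoriHecke (hA.mul hB)
    (by
      rintro _ ⟨a, ha, b, hb, rfl⟩ h hh
      exact ⟨h * a, A.mul_mem (hIA hh) ha, b, hb, mul_assoc _ _ _⟩)
    (by
      rintro _ ⟨a, ha, b, hb, rfl⟩ h hh
      exact ⟨a, ha, b * h, B.mul_mem hb (hIB hh), (mul_assoc _ _ _).symm⟩)

variable (hϖ) (μ : Measure PGL(3, F))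

theorem heckeBoundary₁_mem : heckeBoundary₁ hϖ μ ∈ IwahoriHecke hϖ := by
  rw [heckeBoundary₁, K_mul_sigma_sq, coe_K_eq (hϖ := hϖ)]
  exact Submodule.smul_mem _ _ (Submodule.sub_mem _
    (charFun_transporter_mem_iwahoriHecke (by norm_num) (by norm_num))
    (charFun_transporter_mem_iwahoriHecke (by norm_num) (by norm_num)))

theorem heckeCoboundary₁_mem : heckeCoboundary₁ hϖ μ ∈ IwahoriHecke hϖ := by
  rw [heckeCoboundary₁, sigma_mul_K, coe_K_eq (hϖ := hϖ)]
  exact Submodule.smul_mem _ _ (Submodule.sub_mem _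
    (charFun_transporter_mem_iwahoriHecke (by norm_num) (by norm_num))
    (charFun_transporter_mem_iwahoriHecke (by norm_num) (by norm_num)))

theorem heckeBoundary₂_mem : heckeBoundary₂ hϖ μ ∈ IwahoriHecke hϖ :=
  Submodule.smul_mem _ _ (charFun_mul_mem_iwahoriHecke (isCellStabilizer_E hϖ).isCompact
    (isCellStabilizer_T hϖ).isCompact iwahori_le_E iwahori_le_T)

theorem heckeCoboundary₂_mem : heckeCoboundary₂ hϖ μ ∈ IwahoriHecke hϖ :=
  Submodule.smul_mem _ _ (charFun_mul_mem_iwahoriHecke (isCellStabilizer_T hϖ).isCompact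
    (isCellStabilizer_E hϖ).isCompact iwahori_le_T iwahori_le_E)

variable {Γ : Subgroup PGL(3, F)} [hΓ : IsTorsionFreeCocompactLattice Γ] {μ}
  [μ.IsHaarMeasure]

theorem heckeAct_boundary₁ (hμ : μ (K F) = 1) (f : Form ϖ Γ 1) :
    heckeAct μ (regularRep Γ μ) (heckeBoundary₁ hϖ μ)
        ((isCellStabilizer_E hϖ).equiv Γ μ (Nat.le_succ 1) f)
      = (isCellStabilizer_K hϖ).equiv Γ μ (Nat.zero_le 2) (boundary f) := by
  have h := heckeAct_equiv (μ := μ) (isCellStabilizer_E hϖ) (Nat.le_succ 1)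
    (isCellStabilizer_K hϖ) (Nat.zero_le 2)
    (η := charFun ((K F : Set PGL(3, F)) * {sigma hϖ ^ 2}) - charFun (K F : Set PGL(3, F)))
    (S := transporter hϖ 1 0 ∪ transporter hϖ 0 0)
    ((isCompact_transporter 1 0).union (isCompact_transporter 0 0))
    (fun g h hh => by
      rw [K_mul_sigma_sq, coe_K_eq (hϖ := hϖ), Pi.sub_apply, Pi.sub_apply,
        charFun_mul_right (fun g hg h hh => transporter_mul_mem hg ((mem_E_iff hϖ).1 hh).2) g hh,
        charFun_mul_right (fun g hg h hh => transporter_mul_mem hg ((mem_E_iff hϖ).1 hh).1) g hh])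
    (fun g hg => by
      rw [Set.mem_union, not_or] at hg
      rw [K_mul_sigma_sq, coe_K_eq (hϖ := hϖ)]
      simp [charFun, hg.1, hg.2])
    (boundary_one f)
  -- The normalization $\mu(K)=1$ removes one factor under the square root.
  rwa [measureReal_def μ (K F : Set PGL(3, F)), hμ, ENNReal.toReal_one, mul_one] at h

theorem heckeAct_coboundary₁ (hμ : μ (K F) = 1) (f : Form ϖ Γ 0) :
    heckeAct μ (regularRep Γ μ) (heckeCoboundary₁ hϖ μ)
        ((isCellStabilizer_K hϖ).equiv Γ μ (Nat.zero_le 2) f)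
      = (isCellStabilizer_E hϖ).equiv Γ μ (Nat.le_succ 1) (coboundary f) := by
  have h := heckeAct_equiv (μ := μ) (isCellStabilizer_K hϖ) (Nat.zero_le 2)
    (isCellStabilizer_E hϖ) (Nat.le_succ 1)
    (η := charFun ({sigma hϖ} * (K F : Set PGL(3, F))) - charFun (K F : Set PGL(3, F)))
    (S := transporter hϖ 0 1 ∪ transporter hϖ 0 0)
    ((isCompact_transporter 0 1).union (isCompact_transporter 0 0))
    (fun g h hh => by
      rw [sigma_mul_K, coe_K_eq (hϖ := hϖ), Pi.sub_apply, Pi.sub_apply,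
        charFun_mul_right (fun g hg h hh => transporter_mul_mem hg ((mem_K_iff_smul hϖ).1 hh)) g hh,
        charFun_mul_right (fun g hg h hh => transporter_mul_mem hg ((mem_K_iff_smul hϖ).1 hh)) g hh])
    (fun g hg => by
      rw [Set.mem_union, not_or] at hg
      rw [sigma_mul_K, coe_K_eq (hϖ := hϖ)]
      simp [charFun, hg.1, hg.2])
    (coboundary_one f)
  rwa [measureReal_def μ (K F : Set PGL(3, F)), hμ, ENNReal.toReal_one, one_mul] at h

theorem heckeAct_boundary₂ (f : Form ϖ Γ 2) :
    heckeAct μ (regularRep Γ μ) (heckeBoundary₂ hϖ μ)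
        ((isCellStabilizer_T hϖ).equiv Γ μ (Nat.le_refl 2) f)
      = (isCellStabilizer_E hϖ).equiv Γ μ (Nat.le_succ 1) (boundary f) := by
  -- The source group $T$ has to come first under the square root, as in `heckeAct_equiv`.
  rw [heckeBoundary₂, mul_comm]
  refine heckeAct_equiv (isCellStabilizer_T hϖ) (Nat.le_refl 2) (isCellStabilizer_E hϖ)
    (Nat.le_succ 1)
    ((isCellStabilizer_E hϖ).isCompact.mul (isCellStabilizer_T hϖ).isCompact)
    (fun g h hh => charFun_mul_right ?_ g hh) (fun g hg => Set.indicator_of_notMem hg _)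
    (boundary_two f)
  rintro _ ⟨a, ha, b, hb, rfl⟩ h hh
  exact ⟨a, ha, b * h, (T hϖ).mul_mem hb hh, (mul_assoc _ _ _).symm⟩

theorem heckeAct_coboundary₂ (f : Form ϖ Γ 1) :
    heckeAct μ (regularRep Γ μ) (heckeCoboundary₂ hϖ μ)
        ((isCellStabilizer_E hϖ).equiv Γ μ (Nat.le_succ 1) f)
      = (isCellStabilizer_T hϖ).equiv Γ μ (Nat.le_refl 2) (coboundary f) := by
  refine heckeAct_equiv (isCellStabilizer_E hϖ) (Nat.le_succ 1) (isCellStabilizer_T hϖ)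
    (Nat.le_refl 2)
    ((isCellStabilizer_T hϖ).isCompact.mul (isCellStabilizer_E hϖ).isCompact)
    (fun g h hh => charFun_mul_right ?_ g hh) (fun g hg => Set.indicator_of_notMem hg _)
    (coboundary_two f)
  rintro _ ⟨a, ha, b, hb, rfl⟩ h hh
  exact ⟨a, ha, b * h, (E hϖ).mul_mem hb hh, (mul_assoc _ _ _).symm⟩

/-- Every fixed vector comes from a form, so the intertwining identity already determines where the
operator lands. -/
theorem mem_of_forall_equiv {i j : ℕ} {H H' : Subgroup PGL(3, F)} {η : PGL(3, F) → ℂ}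
    (Φ : Form ϖ Γ i ≃ₗ[ℂ] L2Fixed Γ μ H) (Ψ : Form ϖ Γ j → L2Fixed Γ μ H')
    {D : Form ϖ Γ i → Form ϖ Γ j}
    (h : ∀ f, heckeAct μ (regularRep Γ μ) η (Φ f) = Ψ (D f)) (v : L2 Γ μ)
    (hv : v ∈ L2Fixed Γ μ H) : heckeAct μ (regularRep Γ μ) η v ∈ L2Fixed Γ μ H' := by
  obtain ⟨f, hf⟩ := Φ.surjective ⟨v, hv⟩
  have := h f
  rw [hf] at this
  rw [this]
  exact (Ψ (D f)).2

end
end PGL3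

theorem mainTheorem6 {F : Type*} [Field F] [ValuativeRel F] [TopologicalSpace F]
    [IsNonarchimedeanLocalField F] {ϖ : 𝒪[F]} (hϖ : Irreducible ϖ)
    (μ : Measure PGL(3, F)) [μ.IsHaarMeasure] (hμ : μ (PGL3.K F) = 1)
    (Γ : Subgroup PGL(3, F)) [PGL3.IsTorsionFreeCocompactLattice Γ] :
    (PGL3.heckeBoundary₁ hϖ μ ∈ PGL3.IwahoriHecke hϖ ∧
      PGL3.heckeCoboundary₁ hϖ μ ∈ PGL3.IwahoriHecke hϖ ∧
      PGL3.heckeBoundary₂ hϖ μ ∈ PGL3.IwahoriHecke hϖ ∧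
      PGL3.heckeCoboundary₂ hϖ μ ∈ PGL3.IwahoriHecke hϖ) ∧
    (∀ i, Finite (PGL3.Cell ϖ Γ i)) ∧
    ∃ (Φ₀ : PGL3.Form ϖ Γ 0 ≃ₗ[ℂ] PGL3.L2Fixed Γ μ (PGL3.K F))
      (Φ₁ : PGL3.Form ϖ Γ 1 ≃ₗ[ℂ] PGL3.L2Fixed Γ μ (PGL3.E hϖ))
      (Φ₂ : PGL3.Form ϖ Γ 2 ≃ₗ[ℂ] PGL3.L2Fixed Γ μ (PGL3.T hϖ)),
      (PGL3.IsIdentification hϖ (Nat.zero_le 2) Φ₀ ∧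
        PGL3.IsIdentification hϖ (Nat.le_succ 1) Φ₁ ∧
        PGL3.IsIdentification hϖ (Nat.le_refl 2) Φ₂) ∧
      (∀ v ∈ PGL3.L2Fixed Γ μ (PGL3.E hϖ),
        PGL3.heckeAct μ (PGL3.regularRep Γ μ) (PGL3.heckeBoundary₁ hϖ μ) v
          ∈ PGL3.L2Fixed Γ μ (PGL3.K F)) ∧
      (∀ f : PGL3.Form ϖ Γ 1,
        PGL3.heckeAct μ (PGL3.regularRep Γ μ) (PGL3.heckeBoundary₁ hϖ μ) (Φ₁ f)
          = Φ₀ (PGL3.boundary f)) ∧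
      (∀ v ∈ PGL3.L2Fixed Γ μ (PGL3.K F),
        PGL3.heckeAct μ (PGL3.regularRep Γ μ) (PGL3.heckeCoboundary₁ hϖ μ) v
          ∈ PGL3.L2Fixed Γ μ (PGL3.E hϖ)) ∧
      (∀ f : PGL3.Form ϖ Γ 0,
        PGL3.heckeAct μ (PGL3.regularRep Γ μ) (PGL3.heckeCoboundary₁ hϖ μ) (Φ₀ f)
          = Φ₁ (PGL3.coboundary f)) ∧
      (∀ v ∈ PGL3.L2Fixed Γ μ (PGL3.T hϖ),
        PGL3.heckeAct μ (PGL3.regularRep Γ μ) (PGL3.heckeBoundary₂ hϖ μ) v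
          ∈ PGL3.L2Fixed Γ μ (PGL3.E hϖ)) ∧
      (∀ f : PGL3.Form ϖ Γ 2,
        PGL3.heckeAct μ (PGL3.regularRep Γ μ) (PGL3.heckeBoundary₂ hϖ μ) (Φ₂ f)
          = Φ₁ (PGL3.boundary f)) ∧
      (∀ v ∈ PGL3.L2Fixed Γ μ (PGL3.E hϖ),
        PGL3.heckeAct μ (PGL3.regularRep Γ μ) (PGL3.heckeCoboundary₂ hϖ μ) v
          ∈ PGL3.L2Fixed Γ μ (PGL3.T hϖ)) ∧
      (∀ f : PGL3.Form ϖ Γ 1,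
        PGL3.heckeAct μ (PGL3.regularRep Γ μ) (PGL3.heckeCoboundary₂ hϖ μ) (Φ₁ f)
          = Φ₂ (PGL3.coboundary f)) := by
  exact ⟨⟨PGL3.heckeBoundary₁_mem hϖ μ, PGL3.heckeCoboundary₁_mem hϖ μ, PGL3.heckeBoundary₂_mem hϖ μ,
      PGL3.heckeCoboundary₂_mem hϖ μ⟩, PGL3.finite_cell Γ hϖ,
    (PGL3.isCellStabilizer_K hϖ).equiv Γ μ (Nat.zero_le 2),
    (PGL3.isCellStabilizer_E hϖ).equiv Γ μ (Nat.le_succ 1),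
    (PGL3.isCellStabilizer_T hϖ).equiv Γ μ (Nat.le_refl 2),
    ⟨(PGL3.isCellStabilizer_K hϖ).isIdentification _,
      (PGL3.isCellStabilizer_E hϖ).isIdentification _,
      (PGL3.isCellStabilizer_T hϖ).isIdentification _⟩,
    PGL3.mem_of_forall_equiv _ _ (PGL3.heckeAct_boundary₁ hϖ hμ),
    PGL3.heckeAct_boundary₁ hϖ hμ,
    PGL3.mem_of_forall_equiv _ _ (PGL3.heckeAct_coboundary₁ hϖ hμ),
    PGL3.heckeAct_coboundary₁ hϖ hμ,
    PGL3.mem_of_forall_equiv _ _ (PGL3.heckeAct_boundary₂ hϖ),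
    PGL3.heckeAct_boundary₂ hϖ,
    PGL3.mem_of_forall_equiv _ _ (PGL3.heckeAct_coboundary₂ hϖ),
    PGL3.heckeAct_coboundary₂ hϖ⟩
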